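/- Conventions. Manifolds are smooth, Hausdorff, second countable, without boundary; "closed" means compact without boundary. A contact form on a manifold $M$ of dimension $2n+1$ is a smooth $1$-form $\alpha$ with $\alpha\wedge(d\alpha)^n$ nowhere zero (equivalently, $\alpha$ vanishes nowhere and $d\alpha$ is nondegenerate on $\ker\alpha$); $(M,\xi=\ker\alpha)$ is then a contact manifold. An isotopy of embeddings $j_t\colon L\to M$, $t\in[0,1]$, is a family of smooth embeddings such that $(t,p)\mapsto j_t(p)$ is smooth on $[0,1]\times L$. A compactly supported contact isotopy of $(M,\xi)$ is a family of diffeomorphisms $\psi_t\colon M\to M$, $t\in[0,1]$, smooth in $(t,x)$, with $\psi_0=\mathrm{id}_M$, with $T\psi_t(\xi)=\xi$ for all $t$, and such that there is one compact set outside of which every $\psi_t$ is the identity. Theorem. Let $(M,\xi=\ker\alpha)$ be a (not necessarily compact) contact manifold of dimension $2n+1$. (1) Let $j_t\colon L\to M$, $t\in[0,1]$, be an isotopy of embeddings of a closed manifold $L$ such that every $j_t$ is isotropic, i.e. $Tj_t(T_pL)\subset\xi_{j_t(p)}$ for all $p\in L$. Then there is a compactly supported contact isotopy $\psi_t$ of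 $(M,\xi)$ with $\psi_t\circ j_0=j_t$ for all $t\in[0,1]$; in particular $\psi_t(j_0(L))=j_t(L)$. (2) Let $(M',\xi'=\ker\alpha')$ be a closed contact manifold and let $j_t\colon M'\to M$, $t\in[0,1]$, be an isotopy of embeddings such that every $j_t$ is a contact embedding, i.e. $T(j_t(M'))\cap\xi=Tj_t(\xi')$ along $j_t(M')$. Then there is a compactly supported contact isotopy $\psi_t$ of $(M,\xi)$ with $\psi_t\circ j_0=j_t$ for all $t\in[0,1]$; in particular $\psi_t(j_0(M'))=j_t(M')$. (3) Suppose $\dim M=3$. Let $j_t\colon S\to M$, $t\in[0,1]$, be an isotopy of embeddings of a closed surface $S$ such that all $j_t$ induce the same characteristic foliation on $S$. Here the characteristic foliation induced by an embedding $j$ is the singular distribution on $S$ whose value at $p$ is $(T_pS\cap\xi)^{\perp}$, the $d\alpha$-orthogonal complement of $T_pS\cap\xi_{j(p)}$ in $\xi_{j(p)}$ (with $T_pS$ identified with $Tj(T_pS)$); that is, the line $T_pS\cap\xi$ where $T_pS\neq\xi$, and $0$ where $T_pS=\xi$. Then there is a compactly supported contact isotopy $\psi_t$ of $(M,\xi)$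 with $\psi_t\circ j_0=j_t$ for all $t\in[0,1]$; in particular $\psi_t(j_0(S))=j_t(S)$. -/

import Mathlib

open scoped Manifold ContDiff
open Set

namespace ContactIsotopy

noncomputable section

section OneForms

variable {E : Type*} [NormedAddCommGroup E] [NormedSpace ℝ E]
  {M : Type*} [TopologicalSpace M] [ChartedSpace E M]

/-- A (not necessarily continuous) differential 1-form on the manifold `M` without boundary,
modelled on `E`. -/
abbrev OneForm (E : Type*) [NormedAddCommGroup E] [NormedSpace ℝ E]
    (M : Type*) [TopologicalSpace M] [ChartedSpace E M] : Type _ :=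
  ∀ x : M, TangentSpace 𝓘(ℝ, E) x →L[ℝ] ℝ

/-- The 1-form `α` is a smooth section of the cotangent bundle. -/
def OneForm.IsSmooth [IsManifold 𝓘(ℝ, E) ∞ M] (α : OneForm E M) : Prop :=
  haveI : IsManifold 𝓘(ℝ, E) 1 M := IsManifold.of_le (n := ∞) (by norm_num)
  ContMDiff 𝓘(ℝ, E) (𝓘(ℝ, E).prod 𝓘(ℝ, E →L[ℝ] ℝ)) ∞
    (fun x => (Bundle.TotalSpace.mk' (E →L[ℝ] ℝ) x (α x) :
      Bundle.TotalSpace (E →L[ℝ] ℝ)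
        (fun x : M => TangentSpace 𝓘(ℝ, E) x →L[ℝ] Bundle.Trivial M ℝ x)))

/-- The 1-form `α` written in the preferred chart `φ` at `x`: the pullback of `α` under `φ⁻¹`,
a 1-form on the target of `φ` in `E`. -/
def OneForm.inChart (α : OneForm E M) (x : M) (y : E) : E →L[ℝ] ℝ :=
  (α ((extChartAt 𝓘(ℝ, E) x).symm y)).comp
    (mfderiv 𝓘(ℝ, E) 𝓘(ℝ, E) (extChartAt 𝓘(ℝ, E) x).symm y)

/-- The exterior derivative `dα` at `x`, computed in the preferred chart `φ` at `x`:
`dα(v, w) = D_v β (w) - D_w β (v)`, where `β` is `α` in that chart and the tangent vectors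
are transported to `E` by the differential of `φ`. -/
def OneForm.extDeriv (α : OneForm E M) (x : M) :
    TangentSpace 𝓘(ℝ, E) x →L[ℝ] TangentSpace 𝓘(ℝ, E) x →L[ℝ] ℝ :=
  let B : E →L[ℝ] E →L[ℝ] ℝ := fderiv ℝ (α.inChart x) (extChartAt 𝓘(ℝ, E) x x)
  let A : E →L[ℝ] E := mfderiv 𝓘(ℝ, E) 𝓘(ℝ, E) (extChartAt 𝓘(ℝ, E) x) x
  ((B - B.flip).bilinearComp A A : E →L[ℝ] E →L[ℝ] ℝ)

/-- The field of subspaces `ξ = ker α`. -/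
def OneForm.plane (α : OneForm E M) (x : M) : Submodule ℝ (TangentSpace 𝓘(ℝ, E) x) :=
  LinearMap.ker (α x).toLinearMap

/-- `α` is a contact form: it is smooth, vanishes nowhere, and `dα` restricts to a
nondegenerate (symplectic) form on each hyperplane `ξ_x = ker α_x`; if `dim M = 2n + 1`, the last
two conditions say that `α ∧ (dα)^n` vanishes nowhere. -/
structure IsContactForm [IsManifold 𝓘(ℝ, E) ∞ M] (α : OneForm E M) : Prop where
  smooth : α.IsSmooth
  ne_zero : ∀ x, α x ≠ 0
  nondegenerate : ∀ x, ∀ v ∈ α.plane x, (∀ w ∈ α.plane x, α.extDeriv x v w = 0) → v = 0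

end OneForms

section Isotopies

variable {E : Type*} [NormedAddCommGroup E] [NormedSpace ℝ E]
  {M : Type*} [TopologicalSpace M] [ChartedSpace E M]
  {F : Type*} [NormedAddCommGroup F] [NormedSpace ℝ F]
  {L : Type*} [TopologicalSpace L] [ChartedSpace F L]

/-- `(j t)`, `t ∈ [0,1]`, is an isotopy of embeddings `L → M`: it is smooth on `[0,1] × L`, and
each `j t` is a smooth embedding. (The values `j t` for `t ∉ [0,1]` are irrelevant.) -/
structure IsIsotopyOfEmbeddings (E : Type*) [NormedAddCommGroup E] [NormedSpace ℝ E]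
    {M : Type*} [TopologicalSpace M] [ChartedSpace E M]
    (F : Type*) [NormedAddCommGroup F] [NormedSpace ℝ F]
    {L : Type*} [TopologicalSpace L] [ChartedSpace F L] (j : ℝ → L → M) : Prop where
  smooth : ContMDiffOn (𝓘(ℝ, ℝ).prod 𝓘(ℝ, F)) 𝓘(ℝ, E) ∞
    (fun p : ℝ × L => j p.1 p.2) (Icc 0 1 ×ˢ univ)
  embedding : ∀ t ∈ Icc (0 : ℝ) 1, Manifold.IsSmoothEmbedding 𝓘(ℝ, F) 𝓘(ℝ, E) ∞ (j t)

/-- The map `j` is isotropic for `ξ = ker α`: its image is everywhere tangent to `ξ`. -/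
def IsIsotropic (α : OneForm E M) (j : L → M) : Prop :=
  ∀ (p : L) (v : TangentSpace 𝓘(ℝ, F) p), mfderiv 𝓘(ℝ, F) 𝓘(ℝ, E) j p v ∈ α.plane (j p)

/-- The map `j` from `(L, ξ' = ker α')` to `(M, ξ = ker α)` is contact:
`T(j(L)) ∩ ξ = Tj(ξ')`. -/
def IsContactMap (α' : OneForm F L) (α : OneForm E M) (j : L → M) : Prop :=
  ∀ p : L, LinearMap.range (mfderiv 𝓘(ℝ, F) 𝓘(ℝ, E) j p).toLinearMap ⊓ α.plane (j p) =
    (α'.plane p).map (mfderiv 𝓘(ℝ, F) 𝓘(ℝ, E) j p).toLinearMap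

/-- The characteristic foliation induced on `S` by the hypersurface embedding `j : S → M`, as the
singular distribution `(TS ∩ ξ)^⊥`: its value at `p` consists of the `v ∈ T_p S ∩ ξ` that are
`dα`-orthogonal to `T_p S ∩ ξ`, where `T_p S` is identified with its image under `Tj`. For a surface
in a contact 3-manifold it is the line `T_p S ∩ ξ` at the points where `T_p S ≠ ξ`, and `0` at the
singular points, where `T_p S = ξ`. -/
def characteristicFoliation (α : OneForm E M) (j : L → M) (p : L) :
    Submodule ℝ (TangentSpace 𝓘(ℝ, F) p) where
  carrier := {v | mfderiv 𝓘(ℝ, F) 𝓘(ℝ, E) j p v ∈ α.plane (j p) ∧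
    ∀ w : TangentSpace 𝓘(ℝ, F) p, mfderiv 𝓘(ℝ, F) 𝓘(ℝ, E) j p w ∈ α.plane (j p) →
      α.extDeriv (j p) (mfderiv 𝓘(ℝ, F) 𝓘(ℝ, E) j p v) (mfderiv 𝓘(ℝ, F) 𝓘(ℝ, E) j p w) = 0}
  zero_mem' := by
    refine ⟨by simp, fun w _ => by simp⟩
  add_mem' := by
    rintro a b ⟨ha, ha'⟩ ⟨hb, hb'⟩
    refine ⟨?_, fun w hw => ?_⟩
    · rw [map_add]
      exact Submodule.add_mem _ ha hb
    · rw [map_add, map_add, add_apply, ha' w hw, hb' w hw, add_zero]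
  smul_mem' := by
    rintro c a ⟨ha, ha'⟩
    refine ⟨?_, fun w hw => ?_⟩
    · rw [map_smul]
      exact Submodule.smul_mem _ c ha
    · rw [map_smul, map_smul, smul_apply, ha' w hw, smul_zero]

/-- `(ψ t)`, `t ∈ [0,1]`, is a compactly supported contact isotopy of `(M, ξ = ker α)`: a family of
diffeomorphisms, smooth on `[0,1] × M`, that starts at the identity, preserves `ξ`, and is the
identity outside one compact set. (The values `ψ t` for `t ∉ [0,1]` are irrelevant.) -/
structure IsCompactlySupportedContactIsotopy (α : OneForm E M)
    (ψ : ℝ → Diffeomorph 𝓘(ℝ, E) 𝓘(ℝ, E) M M ∞) : Prop where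
  smooth : ContMDiffOn (𝓘(ℝ, ℝ).prod 𝓘(ℝ, E)) 𝓘(ℝ, E) ∞
    (fun p : ℝ × M => ψ p.1 p.2) (Icc 0 1 ×ˢ univ)
  start : ∀ x, ψ 0 x = x
  contact : ∀ t ∈ Icc (0 : ℝ) 1, ∀ x,
    (α.plane x).map (mfderiv 𝓘(ℝ, E) 𝓘(ℝ, E) (ψ t) x).toLinearMap = α.plane (ψ t x)
  support : ∃ K : Set M, IsCompact K ∧ ∀ t ∈ Icc (0 : ℝ) 1, ∀ x ∉ K, ψ t x = x

end Isotopies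

end

end ContactIsotopy

/-! A function `h` determines a unique vector field `X` with `α(X) = h` and `dα(X, ·) = -dh` on `ker
α`. The flow of this field preserves `ξ`, since `L_X α = dh(R) α` with `R` the Reeb field. It
therefore suffices to find a compactly supported time-dependent `H` whose contact field along `j_t`
is the velocity `V_t`. Then each `t ↦ j_t(p)` is an integral curve, and uniqueness gives `ψ_t ∘ j_0
= j_t` (`exists_contactIsotopy_of_hamiltonian`).

This prescribes the 1-jet of `H_t` along the image: its value is `α(V_t)`, and on `ξ` its
differential is `-dα(V_t, ·)`. The obstruction is that the differential must agree on tangent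
vectors of the image with that of the prescribed value. For `β_t = j_t^*α`, Cartan's formula reads
`d(α(V_t)) = ∂_t β_t - dα(V_t, Tj_t ·)`. So everything fits as soon as `∂_t β_t = c β_t` with `c`
smooth: the covector `c α - dα(V_t, ·)` has the right restriction both to the image and to `ξ`. A
local Hamiltonian follows by first-order expansion along a smooth family of retractions
(`exists_local_hamiltonian`). The conditions on the 1-jet are affine, so a partition of unity on `ℝ
× M` and a cutoff make it global (`exists_contactIsotopy_of_hasLocalFactor`).

All three cases thus reduce to the factor `c`, and locally so. For isotropic maps `β_t = 0`. For
contact embeddings `ker β_t` is independent of `t` and `β_t` vanishes nowhere, so `c` is a quotient.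
For surfaces the characteristic foliation again fixes `ker β_t`, now with zeros; at a zero `dβ_t ≠
0`, because `T_pS = ξ` there. Some coefficient of `β_t` then has nonzero differential, and
Hadamard's lemma divides its evolution by its initial value (`exists_eq_mul_of_zero_set`,
`HasConstKer.hasFactor_of_fderiv_ne_zero`).

The time interval `[0,1]` is closed and nothing is extended beyond it. Derivatives in time are
therefore one-sided at the ends, and smoothness in time and space is smoothness within sets that are
not open. -/

namespace ContactIsotopy

open Filter Topology Metric
open scoped NNReal

/-! ### Grönwall estimates, existence, and first-order dependence on parameters -/

section ODE

variable {G : Type*} [NormedAddCommGroup G] [NormedSpace ℝ G]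

/-- Replacing the rate `K` by `K + 1` makes it positive and at least `1`, which removes the separate
formula for rate zero and the division by the rate. -/
lemma gronwallBound_le {δ K ε x : ℝ} (hK : 0 ≤ K) (hε : 0 ≤ ε) (hx : 0 ≤ x) :
    gronwallBound δ (K + 1) ε x ≤ (δ + ε) * Real.exp ((K + 1) * x) := by
  rw [gronwallBound_of_K_ne_0 (by positivity), add_mul]
  have h1 : 0 ≤ Real.exp ((K + 1) * x) - 1 := by
    have := Real.one_le_exp (show 0 ≤ (K + 1) * x by positivity)
    linarith
  have h2 : ε / (K + 1) ≤ ε := div_le_self hε (by linarith)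
  nlinarith [mul_le_mul_of_nonneg_right h2 h1]

lemma norm_le_of_norm_deriv_le_right {f f' : ℝ → G} {K ε a b : ℝ} (hK : 0 ≤ K) (hε : 0 ≤ ε)
    (hf : ∀ t ∈ Icc a b, HasDerivWithinAt f (f' t) (Icc a b) t)
    (hb : ∀ t ∈ Icc a b, ‖f' t‖ ≤ K * ‖f t‖ + ε) {t : ℝ} (ht : t ∈ Icc a b) :
    ‖f t‖ ≤ (‖f a‖ + ε) * Real.exp ((K + 1) * (t - a)) := by
  refine le_trans (norm_le_gronwallBound_of_norm_deriv_right_le (f' := f') (K := K + 1) (ε := ε)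
    (fun t ht => (hf t ht).continuousWithinAt) (fun t ht => ?_) le_rfl (fun t ht => ?_) t ht)
    (gronwallBound_le hK hε (by linarith [ht.1]))
  · exact (hf t (Ico_subset_Icc_self ht)).mono_of_mem_nhdsWithin
      (mem_of_superset (Icc_mem_nhdsGE ht.2) (Icc_subset_Icc_left ht.1))
  · have := hb t (Ico_subset_Icc_self ht)
    nlinarith [norm_nonneg (f t)]

/-- Grönwall's inequality on both sides of the initial time. -/
lemma norm_le_of_norm_deriv_le {f f' : ℝ → G} {K ε a b t₀ : ℝ} (hK : 0 ≤ K) (hε : 0 ≤ ε)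
    (ht₀ : t₀ ∈ Icc a b)
    (hf : ∀ t ∈ Icc a b, HasDerivWithinAt f (f' t) (Icc a b) t)
    (hb : ∀ t ∈ Icc a b, ‖f' t‖ ≤ K * ‖f t‖ + ε) {t : ℝ} (ht : t ∈ Icc a b) :
    ‖f t‖ ≤ (‖f t₀‖ + ε) * Real.exp ((K + 1) * (b - a)) := by
  have key : ‖f t‖ ≤ (‖f t₀‖ + ε) * Real.exp ((K + 1) * |t - t₀|) := by
    rcases le_total t₀ t with h | h
    · rw [abs_of_nonneg (by linarith)]
      have hs : Icc t₀ b ⊆ Icc a b := Icc_subset_Icc_left ht₀.1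
      exact norm_le_of_norm_deriv_le_right hK hε (fun x hx => (hf x (hs hx)).mono hs)
        (fun x hx => hb x (hs hx)) ⟨h, ht.2⟩
    · rw [abs_of_nonpos (by linarith)]
      have hs : ∀ x ∈ Icc (-t₀) (-a), -x ∈ Icc a b :=
        fun x hx => ⟨by linarith [hx.2], by linarith [hx.1, ht₀.2]⟩
      -- Reversing time turns the estimate before `t₀` into one after `-t₀`.
      have := norm_le_of_norm_deriv_le_right (f := fun x => f (-x)) (f' := fun x => -f' (-x))
        (a := -t₀) (b := -a) (t := -t) hK hε (fun x hx => by
          have h1 := (hf (-x) (hs x hx)).scomp x (h' := -1) (s := Icc (-t₀) (-a))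
            (hasDerivAt_neg x).hasDerivWithinAt (fun y hy => hs y hy)
          simpa [Function.comp_def] using h1)
        (fun x hx => by simpa using hb _ (hs x hx)) ⟨by linarith, by linarith [ht.1]⟩
      simpa [add_comm, sub_eq_add_neg] using this
  refine key.trans (mul_le_mul_of_nonneg_left (Real.exp_le_exp.2 ?_) (by positivity))
  refine mul_le_mul_of_nonneg_left ?_ (by positivity)
  rw [abs_le]; constructor <;> linarith [ht.1, ht.2, ht₀.1, ht₀.2]

/-- Grönwall for `f - g` with no inhomogeneity: a difference that vanishes at one time vanishes
throughout. -/
lemma eqOn_of_solution {v : ℝ → G → G} {s : ℝ → Set G} {K : ℝ≥0} {f g : ℝ → G} {a b t₀ : ℝ}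
    (hv : ∀ t ∈ Icc a b, LipschitzOnWith K (v t) (s t)) (ht₀ : t₀ ∈ Icc a b)
    (hf : ∀ t ∈ Icc a b, HasDerivWithinAt f (v t (f t)) (Icc a b) t)
    (hfs : ∀ t ∈ Icc a b, f t ∈ s t)
    (hg : ∀ t ∈ Icc a b, HasDerivWithinAt g (v t (g t)) (Icc a b) t)
    (hgs : ∀ t ∈ Icc a b, g t ∈ s t) (h : f t₀ = g t₀) : EqOn f g (Icc a b) := by
  intro t ht
  have := norm_le_of_norm_deriv_le (f := fun t => f t - g t) (K := K) (ε := 0) K.2 le_rfl ht₀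
    (fun t ht => (hf t ht).sub (hg t ht))
    (fun t ht => by
      simpa using (hv t ht).norm_sub_le (hfs t ht) (hgs t ht)) ht
  simpa [h, sub_eq_zero] using this

/-- Global existence for bounded and Lipschitz time-dependent vector fields. -/
lemma exists_solution_of_bounded [CompleteSpace G] {v : ℝ → G → G} {K L : ℝ≥0} {a b : ℝ}
    (hv : ∀ t ∈ Icc a b, LipschitzWith K (v t)) (hvc : ∀ x, ContinuousOn (v · x) (Icc a b))
    (hL : ∀ t ∈ Icc a b, ∀ x, ‖v t x‖ ≤ L) {s : ℝ} (hs : s ∈ Icc a b) (x : G) :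
    ∃ f : ℝ → G, f s = x ∧ ∀ t ∈ Icc a b, HasDerivWithinAt f (v t (f t)) (Icc a b) t := by
  have hP : IsPicardLindelof v (⟨s, hs⟩ : Icc a b) x
      (L * (max (b - s) (s - a)).toNNReal) 0 L K :=
    ⟨fun t ht => (hv t ht).lipschitzOnWith, fun y _ => hvc y, fun t ht y _ => hL t ht y, by
      rw [NNReal.coe_mul, Real.coe_toNNReal _ (le_max_of_le_left (by linarith [(mem_Icc.1 hs).2]))]
      simp⟩
  exact hP.exists_eq_forall_mem_Icc_hasDerivWithinAt₀

/-- Global existence for linear equations. -/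
lemma exists_solution_linear [FiniteDimensional ℝ G] {A : ℝ → G →L[ℝ] G} {a b : ℝ}
    (hA : ContinuousOn A (Icc a b)) {s : ℝ} (hs : s ∈ Icc a b) (x : G) :
    ∃ f : ℝ → G, f s = x ∧ ∀ t ∈ Icc a b, HasDerivWithinAt f (A t (f t)) (Icc a b) t := by
  have : CompleteSpace G := FiniteDimensional.complete ℝ G
  obtain ⟨C, hC⟩ := isCompact_Icc.exists_bound_of_continuousOn hA
  have hC0 : 0 ≤ C := (norm_nonneg _).trans (hC s hs)
  -- Grönwall's a priori bound for a solution, plus `1`. Cutting the equation off beyond radius `R`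
  -- makes it bounded and Lipschitz, and the same bound shows that the solution never meets the
  -- cutoff.
  set R : ℝ := (‖x‖ + 0) * Real.exp ((C + 1) * (b - a)) + 1 with hR
  have hRpos : 0 < R := by positivity
  let χ : ContDiffBump (0 : G) := ⟨R, R + 1, hRpos, by linarith⟩
  let ρ : G → G := fun y => χ y • y
  have hρ : ContDiff ℝ 1 ρ := χ.contDiff.smul contDiff_id
  have hρc : HasCompactSupport ρ := χ.hasCompactSupport.smul_right
  obtain ⟨Kρ, hKρ⟩ := hρ.lipschitzWith_of_hasCompactSupport hρc (by norm_num)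
  obtain ⟨B, hB⟩ := hρ.continuous.bounded_above_of_compact_support hρc
  have hρle : ∀ y, ‖ρ y‖ ≤ ‖y‖ := fun y => by
    rw [norm_smul, Real.norm_of_nonneg χ.nonneg]
    exact mul_le_of_le_one_left (norm_nonneg _) χ.le_one
  have hB0 : 0 ≤ B := (norm_nonneg _).trans (hB 0)
  obtain ⟨f, hfs, hf⟩ := exists_solution_of_bounded (v := fun t y => A t (ρ y))
    (K := ⟨C, hC0⟩ * Kρ) (L := ⟨C, hC0⟩ * ⟨B, hB0⟩) (a := a) (b := b)
    (fun t ht => ((A t).lipschitz.weaken (hC t ht)).comp hKρ)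
    (fun y => hA.clm_apply continuousOn_const)
    (fun t ht y => ((A t).le_opNorm _).trans
      (mul_le_mul (hC t ht) (hB y) (norm_nonneg _) hC0)) hs x
  refine ⟨f, hfs, fun t ht => ?_⟩
  have hbound := norm_le_of_norm_deriv_le hC0 le_rfl hs hf (fun t ht => by
    rw [add_zero]
    exact ((A t).le_opNorm _).trans
      (mul_le_mul (hC t ht) (hρle _) (norm_nonneg _) hC0)) ht
  have h1 : ρ (f t) = f t := by
    have : χ (f t) = 1 := χ.one_of_mem_closedBall (by
      rw [mem_closedBall_zero_iff]; rw [hfs] at hbound; exact hbound.trans (le_add_of_nonneg_right zero_le_one))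
    simp [ρ, this]
  simpa [h1] using hf t ht

/-- The tube lemma for the compact time interval: pointwise smallness at `u₀` becomes smallness
uniform in time for nearby `u`. -/
lemma eventually_forall_Icc_norm_lt {P G : Type*} [TopologicalSpace P] [NormedAddCommGroup G]
    {h : ℝ × P → G} {U : Set P} (hU : IsOpen U) {a b : ℝ}
    (hh : ContinuousOn h (Icc a b ×ˢ U)) {u₀ : P} (hu₀ : u₀ ∈ U)
    (h0 : ∀ t ∈ Icc a b, h (t, u₀) = 0) {ε : ℝ} (hε : 0 < ε) :
    ∀ᶠ u in 𝓝 u₀, ∀ t ∈ Icc a b, ‖h (t, u)‖ < ε := by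
  refine (isCompact_Icc (a := a) (b := b)).eventually_forall_of_forall_eventually
    (P := fun u t => t ∈ Icc a b → ‖h (t, u)‖ < ε) (fun t ht => ?_) |>.mono
    fun u hu t ht => hu t ht ht
  have h1 := (hh (t, u₀) ⟨ht, hu₀⟩).norm
  have h2 : ∀ᶠ z in 𝓝[Icc a b ×ˢ U] (t, u₀), ‖h z‖ < ε :=
    h1.eventually (gt_mem_nhds (by simpa [h0 t ht] using hε))
  rw [nhdsWithin_prod_eq, hU.nhdsWithin_eq hu₀] at h2
  have h3 := (h2.filter_mono (Filter.prod_mono_left _ le_rfl))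
  have h4 : ∀ᶠ z : ℝ × P in 𝓝 t ×ˢ 𝓝 u₀, z.1 ∈ Icc a b → ‖h z‖ < ε := by
    have : 𝓝[Icc a b] t ×ˢ 𝓝 u₀ = 𝓝[Icc a b ×ˢ univ] (t, u₀) := by
      rw [nhdsWithin_prod_eq, nhdsWithin_univ]
    rw [this, eventually_nhdsWithin_iff] at h3
    rw [← nhds_prod_eq]
    filter_upwards [h3] with z hz hz1 using hz ⟨hz1, mem_univ _⟩
  rw [← nhds_prod_eq] at h4
  exact (continuous_swap.tendsto (u₀, t)).eventually h4

/-- The difference `J t u - J t u₀` solves the linear equation with coefficient `A (t, u)` and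
inhomogeneity `(A (t, u) - A (t, u₀)) (J t u₀)`. The latter is uniformly small for `u` near `u₀`, so
Grönwall gives continuity in `u` uniformly in `t`. -/
lemma continuousOn_of_solution_linear {P : Type*} [NormedAddCommGroup P] {A : ℝ × P → G →L[ℝ] G} {J : ℝ → P → G} {U : Set P}
    (hU : IsOpen U) {a b s : ℝ} (hs : s ∈ Icc a b) (hA : ContinuousOn A (Icc a b ×ˢ U))
    (hJ : ∀ u ∈ U, ∀ t ∈ Icc a b, HasDerivWithinAt (J · u) (A (t, u) (J t u)) (Icc a b) t)
    (hJs : ContinuousOn (J s) U) : ContinuousOn (fun p : ℝ × P => J p.1 p.2) (Icc a b ×ˢ U) := by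
  have key : ∀ u₀ ∈ U, ∀ ε > 0, ∀ᶠ u in 𝓝 u₀, ∀ t ∈ Icc a b, ‖J t u - J t u₀‖ < ε := by
    intro u₀ hu₀ ε hε
    have hA0 : ContinuousOn (fun t => A (t, u₀)) (Icc a b) :=
      hA.comp (by fun_prop) fun t ht => ⟨ht, hu₀⟩
    obtain ⟨K, hK⟩ := isCompact_Icc.exists_bound_of_continuousOn hA0
    have hK0 : 0 ≤ K := (norm_nonneg _).trans (hK s hs)
    obtain ⟨M, hM⟩ := isCompact_Icc.exists_bound_of_continuousOn
      (fun t ht => (hJ u₀ hu₀ t ht).continuousWithinAt)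
    have hM0 : 0 ≤ M := (norm_nonneg _).trans (hM s hs)
    set C := Real.exp ((K + 1 + 1) * (b - a))
    have hC : 0 < C := Real.exp_pos _
    -- Grönwall will give the bound `(η + η M) C`, which is below `η (M + 2) C = ε / 2`.
    set η := ε / (2 * C) / (M + 2)
    have hη : 0 < η := by positivity
    have h1 : ∀ᶠ u in 𝓝 u₀, ∀ t ∈ Icc a b, ‖A (t, u) - A (t, u₀)‖ < min 1 η :=
      eventually_forall_Icc_norm_lt (h := fun p => A p - A (p.1, u₀)) hU
        (hA.sub (hA.comp (by fun_prop) fun p hp => ⟨hp.1, hu₀⟩)) hu₀ (by simp) (by positivity)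
    have h2 : ∀ᶠ u in 𝓝 u₀, ‖J s u - J s u₀‖ < η := by
      have := (hJs.continuousAt (hU.mem_nhds hu₀)).eventually (ball_mem_nhds _ hη)
      simpa [dist_eq_norm] using this
    filter_upwards [h1, h2, hU.mem_nhds hu₀] with u hu1 hu2 huU t ht
    have := norm_le_of_norm_deriv_le (f := fun t => J t u - J t u₀) (K := K + 1) (ε := η * M)
      (by positivity) (by positivity) hs (fun t ht => (hJ u huU t ht).sub (hJ u₀ hu₀ t ht))
      (fun t ht => by
        have e : A (t, u) (J t u) - A (t, u₀) (J t u₀) =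
          A (t, u) (J t u - J t u₀) + (A (t, u) - A (t, u₀)) (J t u₀) := by simp
        rw [e]
        refine (norm_add_le _ _).trans (add_le_add ?_ ?_)
        · refine ((A (t, u)).le_opNorm _).trans (mul_le_mul_of_nonneg_right ?_ (norm_nonneg _))
          have := norm_add_le (A (t, u) - A (t, u₀)) (A (t, u₀))
          rw [sub_add_cancel] at this
          linarith [hK t ht, (hu1 t ht).trans_le (min_le_left _ _)]
        · exact (ContinuousLinearMap.le_opNorm _ _).trans (mul_le_mul
            ((hu1 t ht).trans_le (min_le_right _ _)).le (hM t ht) (norm_nonneg _) hη.le)) ht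
    refine this.trans_lt ?_
    have h3 : ‖J s u - J s u₀‖ + η * M < η * (M + 2) := by linarith
    have h4 : η * (M + 2) * C = ε / 2 := by simp only [η]; field_simp
    calc _ < η * (M + 2) * C := by gcongr
      _ < ε := by rw [h4]; linarith
  rintro ⟨t, u₀⟩ ⟨ht, hu₀⟩
  rw [ContinuousWithinAt, Metric.tendsto_nhds]
  intro ε hε
  have h1 := key u₀ hu₀ (ε / 2) (by positivity)
  have h2 := (hJ u₀ hu₀ t ht).continuousWithinAt.eventually (ball_mem_nhds _ (half_pos hε))
  have h3 := (h2.prod_mk (h1.filter_mono nhdsWithin_le_nhds : ∀ᶠ u in 𝓝[U] u₀, _))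
  rw [← nhdsWithin_prod_eq] at h3
  filter_upwards [h3, self_mem_nhdsWithin] with p hp hpm
  have := hp.2 p.1 hpm.1
  have h4 := hp.1
  calc dist (J p.1 p.2) (J t u₀) ≤ dist (J p.1 p.2) (J p.1 u₀) + dist (J p.1 u₀) (J t u₀) :=
      dist_triangle _ _ _
    _ < ε := by rw [dist_eq_norm (J p.1 p.2)]; linarith

variable {P : Type*} [NormedAddCommGroup P] [NormedSpace ℝ P]

/-- Solutions of an ODE are differentiable with respect to time and parameters; the derivative
with respect to the parameters solves the linearised equation. -/
lemma hasFDerivWithinAt_of_solution {Y : ℝ → G → G} {Y' : ℝ × G → G →L[ℝ] G} {Ω : Set G}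
    (hΩ : IsOpen Ω) {φ : ℝ → P → G} {U : Set P} (hU : IsOpen U) {a b s : ℝ} (hs : s ∈ Icc a b)
    (hY' : ContinuousOn Y' (Icc a b ×ˢ Ω))
    (hY : ∀ t ∈ Icc a b, ∀ y ∈ Ω, HasFDerivAt (Y t) (Y' (t, y)) y)
    (hφc : ContinuousOn (fun p : ℝ × P => φ p.1 p.2) (Icc a b ×ˢ U))
    (hφΩ : ∀ t ∈ Icc a b, ∀ u ∈ U, φ t u ∈ Ω)
    (hφ : ∀ u ∈ U, ∀ t ∈ Icc a b, HasDerivWithinAt (φ · u) (Y t (φ t u)) (Icc a b) t)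
    {J : ℝ → P →L[ℝ] G} {u₀ : P} (hu₀ : u₀ ∈ U) (hφs : HasFDerivAt (φ s) (J s) u₀)
    (hJ : ∀ t ∈ Icc a b, HasDerivWithinAt J ((Y' (t, φ t u₀)).comp (J t)) (Icc a b) t)
    {t : ℝ} (ht : t ∈ Icc a b) :
    HasFDerivWithinAt (fun p : ℝ × P => φ p.1 p.2)
      ((ContinuousLinearMap.toSpanSingleton ℝ (Y t (φ t u₀))).coprod (J t))
      (Icc a b ×ˢ U) (t, u₀) := by
  have hφ0 : ContinuousOn (fun t => φ t u₀) (Icc a b) :=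
    fun t ht => (hφ u₀ hu₀ t ht).continuousWithinAt
  have hA0 : ContinuousOn (fun t => Y' (t, φ t u₀)) (Icc a b) :=
    hY'.comp (by fun_prop) fun t ht => ⟨ht, hφΩ t ht _ hu₀⟩
  obtain ⟨K, hK⟩ := isCompact_Icc.exists_bound_of_continuousOn hA0
  have hK0 : 0 ≤ K := (norm_nonneg _).trans (hK s hs)
  set C := Real.exp ((K + 1 + 1) * (b - a))
  have hC : 0 < C := Real.exp_pos _
  set D := ‖J s‖ + 1
  have hD : 0 < D := by positivity
  -- a tube around the solution on which the derivative is nearly constant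
  have tube : ∀ η > 0, ∃ δ > 0, ∀ t ∈ Icc a b, ∀ y ∈ ball (φ t u₀) δ,
      y ∈ Ω ∧ ‖Y' (t, y) - Y' (t, φ t u₀)‖ ≤ η := by
    intro η hη
    have : ∀ᶠ d : G in 𝓝 0, ∀ t ∈ Icc a b,
        φ t u₀ + d ∈ Ω ∧ ‖Y' (t, φ t u₀ + d) - Y' (t, φ t u₀)‖ ≤ η := by
      refine isCompact_Icc.eventually_forall_of_forall_eventually
        (P := fun (d : G) (t : ℝ) => t ∈ Icc a b → φ t u₀ + d ∈ Ω ∧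
          ‖Y' (t, φ t u₀ + d) - Y' (t, φ t u₀)‖ ≤ η) (fun t ht => ?_) |>.mono
        fun d hd t ht => hd t ht ht
      have c1 : ContinuousWithinAt (fun z : G × ℝ => φ z.2 u₀ + z.1) (univ ×ˢ Icc a b) (0, t) :=
        ((hφ0 t ht).comp (f := (Prod.snd : G × ℝ → ℝ)) (s := univ ×ˢ Icc a b) (x := (0, t))
          continuousWithinAt_snd (fun z hz => hz.2)).add continuousWithinAt_fst
      have e1 : ∀ᶠ z : G × ℝ in 𝓝[univ ×ˢ Icc a b] (0, t), φ z.2 u₀ + z.1 ∈ Ω :=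
        c1.eventually (hΩ.mem_nhds (by simpa using hφΩ t ht _ hu₀))
      have c2 : ContinuousWithinAt (fun z : G × ℝ => Y' (z.2, φ z.2 u₀ + z.1))
          (univ ×ˢ Icc a b ∩ {z | φ z.2 u₀ + z.1 ∈ Ω}) (0, t) := by
        refine (hY' (t, φ t u₀ + 0) ⟨ht, by simpa using hφΩ t ht _ hu₀⟩).comp
          (f := fun z : G × ℝ => (z.2, φ z.2 u₀ + z.1))
          (continuousWithinAt_snd.prodMk (c1.mono inter_subset_left)) (fun z hz => mem_prod.2 ⟨hz.1.2, hz.2⟩)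
      have c3 : ContinuousWithinAt (fun z : G × ℝ => Y' (z.2, φ z.2 u₀ + z.1))
          (univ ×ˢ Icc a b) (0, t) := c2.mono_of_mem_nhdsWithin (inter_mem self_mem_nhdsWithin e1)
      have c4 : ContinuousWithinAt (fun z : G × ℝ => Y' (z.2, φ z.2 u₀)) (univ ×ˢ Icc a b) (0, t) :=
        (hA0 t ht).comp (f := (Prod.snd : G × ℝ → ℝ)) (s := univ ×ˢ Icc a b) (x := (0, t))
          continuousWithinAt_snd (fun z hz => hz.2)
      have e2 : ∀ᶠ z : G × ℝ in 𝓝[univ ×ˢ Icc a b] (0, t),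
          ‖Y' (z.2, φ z.2 u₀ + z.1) - Y' (z.2, φ z.2 u₀)‖ < η :=
        (c3.sub c4).norm.eventually (gt_mem_nhds (by simpa using hη))
      have e3 := eventually_nhdsWithin_iff.1 (e1.and e2)
      filter_upwards [e3] with z hz hz2
      exact ⟨(hz ⟨mem_univ _, hz2⟩).1, (hz ⟨mem_univ _, hz2⟩).2.le⟩
    obtain ⟨δ, hδ, h⟩ := Metric.eventually_nhds_iff_ball.1 this
    refine ⟨δ, hδ, fun t ht y hy => ?_⟩
    have := h (y - φ t u₀) (by simpa [dist_eq_norm] using hy) t ht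
    simpa using this
  have near : ∀ δ > 0, ∀ᶠ u in 𝓝 u₀, ∀ t ∈ Icc a b, φ t u ∈ ball (φ t u₀) δ := by
    intro δ hδ
    have := eventually_forall_Icc_norm_lt (h := fun p : ℝ × P => φ p.1 p.2 - φ p.1 u₀) hU
        (hφc.sub (hφc.comp (f := fun p : ℝ × P => (p.1, u₀)) (by fun_prop)
          fun p hp => ⟨hp.1, hu₀⟩)) hu₀ (by simp) hδ
    filter_upwards [this] with u hu t ht
    simpa [dist_eq_norm] using hu t ht
  -- The mean value inequality on the balls of the tube: the linearisation error of `Y t` is small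
  -- relative to the displacement, uniformly in `t`.
  have lin : ∀ η > 0, ∀ᶠ u in 𝓝 u₀, ∀ t ∈ Icc a b,
      ‖Y t (φ t u) - Y t (φ t u₀) - Y' (t, φ t u₀) (φ t u - φ t u₀)‖ ≤ η * ‖φ t u - φ t u₀‖ := by
    intro η hη
    obtain ⟨δ, hδ, hδ'⟩ := tube η hη
    filter_upwards [near δ hδ] with u hu t ht
    exact (convex_ball (φ t u₀) δ).norm_image_sub_le_of_norm_hasFDerivWithin_le'
      (fun y hy => (hY t ht y (hδ' t ht y hy).1).hasFDerivWithinAt) (fun y hy => (hδ' t ht y hy).2)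
      (mem_ball_self hδ) (hu t ht)
  have lip : ∀ᶠ u in 𝓝 u₀, ∀ t ∈ Icc a b, ‖φ t u - φ t u₀‖ ≤ D * C * ‖u - u₀‖ := by
    have h1 := hφs.isBigO_sub
    have h2 : ∀ᶠ u in 𝓝 u₀, ‖φ s u - φ s u₀‖ ≤ D * ‖u - u₀‖ := by
      have := hφs.isLittleO.def one_pos
      filter_upwards [this] with u hu
      have h3 := norm_add_le (φ s u - φ s u₀ - J s (u - u₀)) (J s (u - u₀))
      rw [sub_add_cancel] at h3
      have := (J s).le_opNorm (u - u₀)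
      simp only [D]; linarith
    filter_upwards [h2, lin 1 one_pos, hU.mem_nhds hu₀] with u hu hu' huU t ht
    have := norm_le_of_norm_deriv_le (f := fun t => φ t u - φ t u₀) (K := K + 1) (ε := 0)
      (by positivity) le_rfl hs (fun t ht => (hφ u huU t ht).sub (hφ u₀ hu₀ t ht))
      (fun t ht => by
        have h3 := norm_add_le (Y t (φ t u) - Y t (φ t u₀) - Y' (t, φ t u₀) (φ t u - φ t u₀))
          (Y' (t, φ t u₀) (φ t u - φ t u₀))
        rw [sub_add_cancel] at h3
        have h4 := (Y' (t, φ t u₀)).le_opNorm (φ t u - φ t u₀)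
        have h5 := mul_le_mul_of_nonneg_right (hK t ht) (norm_nonneg (φ t u - φ t u₀))
        have h6 := hu' t ht
        linarith) ht
    calc _ ≤ _ := this
      _ ≤ (D * ‖u - u₀‖) * C := by rw [add_zero]; gcongr
      _ = _ := by ring
  -- uniform differentiability
  have unif : ∀ ε > 0, ∀ᶠ u in 𝓝 u₀, ∀ t ∈ Icc a b,
      ‖φ t u - φ t u₀ - J t (u - u₀)‖ ≤ ε * ‖u - u₀‖ := by
    intro ε hε
    -- Chosen so that the initial error `η` and the linearisation error `η D C`, both amplified by
    -- `C`, add up to `ε`.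
    set η := ε / (C * (1 + D * C))
    have hη : 0 < η := by positivity
    filter_upwards [hφs.isLittleO.def hη, lin η hη, lip, hU.mem_nhds hu₀] with u h1 h2 h3 huU t ht
    have := norm_le_of_norm_deriv_le (f := fun t => φ t u - φ t u₀ - J t (u - u₀)) (K := K + 1)
      (ε := η * (D * C * ‖u - u₀‖)) (by positivity) (by positivity) hs
      (fun t ht => ((hφ u huU t ht).sub (hφ u₀ hu₀ t ht)).sub
        ((hJ t ht).clm_apply (hasDerivWithinAt_const t _ (u - u₀))))
      (fun t ht => by
        have e : Y t (φ t u) - Y t (φ t u₀) - (((Y' (t, φ t u₀)).comp (J t)) (u - u₀) + J t 0) =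
          (Y t (φ t u) - Y t (φ t u₀) - Y' (t, φ t u₀) (φ t u - φ t u₀)) +
            Y' (t, φ t u₀) (φ t u - φ t u₀ - J t (u - u₀)) := by
          simp
        rw [e]
        have h4 := (Y' (t, φ t u₀)).le_opNorm (φ t u - φ t u₀ - J t (u - u₀))
        have h5 := mul_le_mul_of_nonneg_right (hK t ht)
          (norm_nonneg (φ t u - φ t u₀ - J t (u - u₀)))
        have h6 := mul_le_mul_of_nonneg_left (h3 t ht) hη.le
        have h7 := h2 t ht
        have h8 := norm_nonneg (φ t u - φ t u₀ - J t (u - u₀))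
        refine (norm_add_le _ _).trans ?_
        linarith) ht
    calc _ ≤ _ := this
      _ ≤ (η * ‖u - u₀‖ + η * (D * C * ‖u - u₀‖)) * C := by gcongr
      _ = ε * ‖u - u₀‖ := by simp only [η]; field_simp
  -- conclusion
  have hJc := (hJ t ht).continuousWithinAt
  rw [hasFDerivWithinAt_iff_isLittleO, Asymptotics.isLittleO_iff]
  intro ε hε
  have h3 : (0:ℝ) < ε / 3 := by positivity
  have e1 : ∀ᶠ p : ℝ × P in 𝓝[Icc a b ×ˢ U] (t, u₀), ∀ t ∈ Icc a b,
      ‖φ t p.2 - φ t u₀ - J t (p.2 - u₀)‖ ≤ ε / 3 * ‖p.2 - u₀‖ :=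
    (continuousWithinAt_snd (s := Icc a b ×ˢ U) (p := (t, u₀))).eventually (unif _ h3)
  have tfst : Tendsto (Prod.fst : ℝ × P → ℝ) (𝓝[Icc a b ×ˢ U] (t, u₀)) (𝓝[Icc a b] t) :=
    tendsto_nhdsWithin_iff.2 ⟨continuousWithinAt_fst (s := Icc a b ×ˢ U) (p := (t, u₀)),
      eventually_nhdsWithin_of_forall fun p hp => hp.1⟩
  have e2 := tfst.eventually (((hφ u₀ hu₀ t ht).hasFDerivWithinAt.isLittleO).def h3)
  have e3 := tfst.eventually (hJc.eventually (ball_mem_nhds _ h3))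
  filter_upwards [e1, e2, e3, self_mem_nhdsWithin] with p h1 h2 h4 hp
  have h1 := h1 p.1 hp.1
  rw [dist_eq_norm] at h4
  -- The joint error splits into the parameter error at the moving time (small uniformly in time),
  -- the time error at `u₀`, and the drift of `J`.
  have e : φ p.1 p.2 - φ t u₀ - ((ContinuousLinearMap.toSpanSingleton ℝ (Y t (φ t u₀))).coprod
      (J t)) (p - (t, u₀)) = (φ p.1 p.2 - φ p.1 u₀ - J p.1 (p.2 - u₀)) +
      (φ p.1 u₀ - φ t u₀ - (p.1 - t) • (Y t (φ t u₀))) + (J p.1 - J t) (p.2 - u₀) := by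
    simp [ContinuousLinearMap.toSpanSingleton_apply]
    abel
  rw [e]
  have n1 : ‖p.1 - t‖ ≤ ‖p - (t, u₀)‖ := norm_fst_le (p - (t, u₀))
  have n2 : ‖p.2 - u₀‖ ≤ ‖p - (t, u₀)‖ := norm_snd_le (p - (t, u₀))
  have h5 : ‖(J p.1 - J t) (p.2 - u₀)‖ ≤ ε / 3 * ‖p.2 - u₀‖ :=
    (ContinuousLinearMap.le_opNorm _ _).trans (mul_le_mul_of_nonneg_right h4.le (norm_nonneg _))
  have h2' : ‖φ p.1 u₀ - φ t u₀ - (p.1 - t) • (Y t (φ t u₀))‖ ≤ ε / 3 * ‖p.1 - t‖ := by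
    simpa using h2
  calc _ ≤ _ := norm_add₃_le
    _ ≤ ε / 3 * ‖p.2 - u₀‖ + ε / 3 * ‖p.1 - t‖ + ε / 3 * ‖p.2 - u₀‖ := by gcongr
    _ ≤ ε / 3 * ‖p - (t, u₀)‖ + ε / 3 * ‖p - (t, u₀)‖ + ε / 3 * ‖p - (t, u₀)‖ := by gcongr
    _ = _ := by ring

end ODE

/-! ### Partial derivatives of smooth functions on `T ×ˢ Ω` -/

section Partial

variable {G H : Type*} [NormedAddCommGroup G] [NormedSpace ℝ G]
  [NormedAddCommGroup H] [NormedSpace ℝ H]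

lemma hasFDerivAt_snd {f : ℝ × G → H} {T : Set ℝ} {Ω : Set G} (hΩ : IsOpen Ω)
    (hf : ContDiffOn ℝ ∞ f (T ×ˢ Ω)) {t : ℝ} (ht : t ∈ T) {y : G} (hy : y ∈ Ω) :
    HasFDerivAt (fun y => f (t, y))
      ((fderivWithin ℝ f (T ×ˢ Ω) (t, y)).comp (ContinuousLinearMap.inr ℝ ℝ G)) y := by
  have h1 := ((hf.differentiableOn (by simp)) (t, y) ⟨ht, hy⟩).hasFDerivWithinAt
  exact ((h1.comp y (hasFDerivAt_prodMk_right t y).hasFDerivWithinAt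
    (fun z hz => ⟨ht, hz⟩)) : HasFDerivWithinAt _ _ Ω y).hasFDerivAt (hΩ.mem_nhds hy)

lemma hasDerivWithinAt_fst {f : ℝ × G → H} {T : Set ℝ} {Ω : Set G}
    (hf : ContDiffOn ℝ ∞ f (T ×ˢ Ω)) {t : ℝ} (ht : t ∈ T) {y : G} (hy : y ∈ Ω) :
    HasDerivWithinAt (fun t => f (t, y)) (fderivWithin ℝ f (T ×ˢ Ω) (t, y) (1, 0)) T t := by
  have h1 := ((hf.differentiableOn (by simp)) (t, y) ⟨ht, hy⟩).hasFDerivWithinAt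
  have h2 := (h1.comp (s := T) t (hasFDerivAt_prodMk_left t y).hasFDerivWithinAt
    (fun z hz => mem_prod.2 ⟨hz, hy⟩)).hasDerivWithinAt
  simpa [Function.comp_def] using h2

lemma contDiffOn_fderiv_snd {f : ℝ × G → H} {T : Set ℝ} (hT : UniqueDiffOn ℝ T) {Ω : Set G}
    (hΩ : IsOpen Ω) (hf : ContDiffOn ℝ ∞ f (T ×ˢ Ω)) :
    ContDiffOn ℝ ∞ (fun p : ℝ × G => fderiv ℝ (fun y => f (p.1, y)) p.2) (T ×ˢ Ω) := by
  have h1 : ContDiffOn ℝ ∞ (fderivWithin ℝ f (T ×ˢ Ω)) (T ×ˢ Ω) :=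
    hf.fderivWithin (hT.prod hΩ.uniqueDiffOn) (by simp)
  refine (h1.clm_comp (contDiffOn_const (c := ContinuousLinearMap.inr ℝ ℝ G))).congr fun p hp => ?_
  exact (hasFDerivAt_snd hΩ hf hp.1 hp.2).fderiv

lemma contDiffOn_derivWithin_fst {f : ℝ × G → H} {T : Set ℝ} (hT : UniqueDiffOn ℝ T) {Ω : Set G}
    (hΩ : IsOpen Ω) (hf : ContDiffOn ℝ ∞ f (T ×ˢ Ω)) :
    ContDiffOn ℝ ∞ (fun p : ℝ × G => derivWithin (fun t => f (t, p.2)) T p.1) (T ×ˢ Ω) := by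
  have h1 : ContDiffOn ℝ ∞ (fderivWithin ℝ f (T ×ˢ Ω)) (T ×ˢ Ω) :=
    hf.fderivWithin (hT.prod hΩ.uniqueDiffOn) (by simp)
  refine (h1.clm_apply (contDiffOn_const (c := ((1 : ℝ), (0 : G))))).congr fun p hp => ?_
  exact (hasDerivWithinAt_fst hf hp.1 hp.2).derivWithin (hT _ hp.1)

end Partial

/-! ### Smooth dependence on parameters and flows on a vector space -/

section Regularity

universe u

/-- Induction on `k`. The parameter derivative `J` solves the variational equation, so the pair `(φ,
J)` is again a continuous solution of a smooth equation, on `G × (P →L[ℝ] G)`, hence `C^k`. The full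
derivative of `φ` is assembled from `Y` along `φ` and from `J`, so `φ` is `C^(k+1)`. The phase space
changes in the induction, which is why it is quantified inside and shares a universe with `P`. -/
lemma contDiffOn_nat_of_solution (k : ℕ) : ∀ (G P : Type u) [NormedAddCommGroup G]
    [NormedSpace ℝ G] [FiniteDimensional ℝ G] [NormedAddCommGroup P] [NormedSpace ℝ P]
    [FiniteDimensional ℝ P] {Y : ℝ → G → G} {Ω : Set G} (_ : IsOpen Ω) {φ : ℝ → P → G} {U : Set P}
    (_ : IsOpen U) {a b s : ℝ} (_ : a < b) (_ : s ∈ Icc a b)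
    (_ : ContDiffOn ℝ ∞ (fun p : ℝ × G => Y p.1 p.2) (Icc a b ×ˢ Ω))
    (_ : ContinuousOn (fun p : ℝ × P => φ p.1 p.2) (Icc a b ×ˢ U))
    (_ : ∀ t ∈ Icc a b, ∀ u ∈ U, φ t u ∈ Ω)
    (_ : ∀ u ∈ U, ∀ t ∈ Icc a b, HasDerivWithinAt (φ · u) (Y t (φ t u)) (Icc a b) t)
    (_ : ContDiffOn ℝ ∞ (φ s) U),
    ContDiffOn ℝ k (fun p : ℝ × P => φ p.1 p.2) (Icc a b ×ˢ U) := by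
  induction k with
  | zero =>
    intro G P _ _ _ _ _ _ Y Ω hΩ φ U hU a b s hab hs hY hφc hφΩ hφ hφs
    exact contDiffOn_zero.2 hφc
  | succ k ih =>
    intro G P _ _ _ _ _ _ Y Ω hΩ φ U hU a b s hab hs hY hφc hφΩ hφ hφs
    have hT : UniqueDiffOn ℝ (Icc a b) := uniqueDiffOn_Icc hab
    set Y' : ℝ × G → G →L[ℝ] G := fun p => fderiv ℝ (fun y => Y p.1 y) p.2 with hY'def
    have hY' : ContDiffOn ℝ ∞ Y' (Icc a b ×ˢ Ω) := contDiffOn_fderiv_snd hT hΩ hY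
    have hYd : ∀ t ∈ Icc a b, ∀ y ∈ Ω, HasFDerivAt (Y t) (Y' (t, y)) y := fun t ht y hy =>
      (hasFDerivAt_snd hΩ hY ht hy).differentiableAt.hasFDerivAt
    have hcurve : ContinuousOn (fun p : ℝ × P => Y' (p.1, φ p.1 p.2)) (Icc a b ×ˢ U) :=
      hY'.continuousOn.comp (continuousOn_fst.prodMk hφc) fun p hp => ⟨hp.1, hφΩ _ hp.1 _ hp.2⟩
    let comp : (G →L[ℝ] G) →L[ℝ] (P →L[ℝ] G) →L[ℝ] (P →L[ℝ] G) :=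
      ContinuousLinearMap.compL ℝ P G G
    have hA : ContinuousOn (fun p : ℝ × P => comp (Y' (p.1, φ p.1 p.2))) (Icc a b ×ˢ U) :=
      comp.continuous.comp_continuousOn hcurve
    have hex : ∀ u : P, ∃ J : ℝ → P →L[ℝ] G, u ∈ U → J s = fderiv ℝ (φ s) u ∧ ∀ t ∈ Icc a b,
        HasDerivWithinAt J (comp (Y' (t, φ t u)) (J t)) (Icc a b) t := by
      intro u
      by_cases hu : u ∈ U
      · obtain ⟨J, h1, h2⟩ := exists_solution_linear (A := fun t => comp (Y' (t, φ t u)))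
          (hA.comp (f := fun t => (t, u)) (by fun_prop) fun t ht => ⟨ht, hu⟩) hs (fderiv ℝ (φ s) u)
        exact ⟨J, fun _ => ⟨h1, h2⟩⟩
      · exact ⟨fun _ => 0, fun h => absurd h hu⟩
    choose J hJ using hex
    have hfs : ContDiffOn ℝ ∞ (fderiv ℝ (φ s)) U := hφs.fderiv_of_isOpen hU (by simp)
    have hJs : ContDiffOn ℝ ∞ (fun u => J u s) U := hfs.congr fun u hu => (hJ u hu).1
    have hJc : ContinuousOn (fun p : ℝ × P => J p.2 p.1) (Icc a b ×ˢ U) :=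
      continuousOn_of_solution_linear (J := fun t u => J u t) hU hs hA (fun u hu => (hJ u hu).2)
        hJs.continuousOn
    have hYt : ContDiffOn ℝ ∞ (fun p : ℝ × (G × (P →L[ℝ] G)) =>
        (Y p.1 p.2.1, (Y' (p.1, p.2.1)).comp p.2.2)) (Icc a b ×ˢ (Ω ×ˢ univ)) := by
      have hm : MapsTo (fun p : ℝ × (G × (P →L[ℝ] G)) => (p.1, p.2.1)) (Icc a b ×ˢ (Ω ×ˢ univ))
        (Icc a b ×ˢ Ω) := fun p hp => ⟨hp.1, hp.2.1⟩
      refine (hY.comp (f := fun p : ℝ × (G × (P →L[ℝ] G)) => (p.1, p.2.1))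
        (by fun_prop) hm).prodMk ?_
      exact (hY'.comp (f := fun p : ℝ × (G × (P →L[ℝ] G)) => (p.1, p.2.1))
        (by fun_prop) hm).clm_comp (by fun_prop)
    have hpair := ih (G × (P →L[ℝ] G)) P
      (Y := fun t z => (Y t z.1, (Y' (t, z.1)).comp z.2)) (hΩ.prod isOpen_univ)
      (φ := fun t u => (φ t u, J u t)) hU hab hs hYt (hφc.prodMk hJc)
      (fun t ht u hu => ⟨hφΩ t ht u hu, mem_univ _⟩)
      (fun u hu t ht => (hφ u hu t ht).prodMk ((hJ u hu).2 t ht)) (hφs.prodMk hJs)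
    have hφk : ContDiffOn ℝ k (fun p : ℝ × P => φ p.1 p.2) (Icc a b ×ˢ U) := hpair.fst
    have hJk : ContDiffOn ℝ k (fun p : ℝ × P => J p.2 p.1) (Icc a b ×ˢ U) := hpair.snd
    have hYk : ContDiffOn ℝ k (fun p : ℝ × P => Y p.1 (φ p.1 p.2)) (Icc a b ×ˢ U) :=
      (hY.of_le (by exact_mod_cast le_top)).comp (f := fun p : ℝ × P => (p.1, φ p.1 p.2))
        (contDiffOn_fst.prodMk hφk) fun p hp => ⟨hp.1, hφΩ _ hp.1 _ hp.2⟩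
    push_cast
    rw [contDiffOn_succ_iff_hasFDerivWithinAt_of_uniqueDiffOn (hT.prod hU.uniqueDiffOn)]
    refine ⟨by simp, fun p => (ContinuousLinearMap.toSpanSingleton ℝ
      (Y p.1 (φ p.1 p.2))).coprod (J p.2 p.1), ?_, fun p hp => ?_⟩
    · have h1 : ContDiffOn ℝ k (fun p : ℝ × P => ContinuousLinearMap.toSpanSingleton ℝ
          (Y p.1 (φ p.1 p.2))) (Icc a b ×ˢ U) :=
        (ContinuousLinearMap.toSpanSingletonCLE (𝕜 := ℝ) (E := G)).contDiff.comp_contDiffOn hYk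
      have := (h1.clm_comp (contDiffOn_const (c := ContinuousLinearMap.fst ℝ ℝ P))).add
        (hJk.clm_comp (contDiffOn_const (c := ContinuousLinearMap.snd ℝ ℝ P)))
      refine this.congr fun p hp => ?_
      ext <;> simp
    · refine hasFDerivWithinAt_of_solution hΩ hU hs hY'.continuousOn hYd hφc hφΩ hφ (J := J p.2)
        hp.2 ?_ (hJ p.2 hp.2).2 hp.1
      rw [(hJ p.2 hp.2).1]
      exact ((hφs.contDiffAt (hU.mem_nhds hp.2)).differentiableAt (by simp)).hasFDerivAt

/-- Smooth dependence on parameters: a continuous family of solutions of a smooth ODE with smooth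
initial values is smooth. -/
theorem contDiffOn_of_solution {G P : Type u} [NormedAddCommGroup G]
    [NormedSpace ℝ G] [FiniteDimensional ℝ G] [NormedAddCommGroup P] [NormedSpace ℝ P]
    [FiniteDimensional ℝ P] {Y : ℝ → G → G} {Ω : Set G} (hΩ : IsOpen Ω) {φ : ℝ → P → G} {U : Set P}
    (hU : IsOpen U) {a b s : ℝ} (hab : a < b) (hs : s ∈ Icc a b)
    (hY : ContDiffOn ℝ ∞ (fun p : ℝ × G => Y p.1 p.2) (Icc a b ×ˢ Ω))
    (hφc : ContinuousOn (fun p : ℝ × P => φ p.1 p.2) (Icc a b ×ˢ U))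
    (hφΩ : ∀ t ∈ Icc a b, ∀ u ∈ U, φ t u ∈ Ω)
    (hφ : ∀ u ∈ U, ∀ t ∈ Icc a b, HasDerivWithinAt (φ · u) (Y t (φ t u)) (Icc a b) t)
    (hφs : ContDiffOn ℝ ∞ (φ s) U) :
    ContDiffOn ℝ ∞ (fun p : ℝ × P => φ p.1 p.2) (Icc a b ×ˢ U) :=
  contDiffOn_infty.2 fun k =>
    contDiffOn_nat_of_solution k G P hΩ hU hab hs hY hφc hφΩ hφ hφs

/-- The flow of a compactly supported smooth time-dependent vector field. -/
theorem exists_flow {G : Type u} [NormedAddCommGroup G] [NormedSpace ℝ G] [FiniteDimensional ℝ G]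
    {Y : ℝ → G → G} {a b : ℝ} (hab : a < b)
    (hY : ContDiffOn ℝ ∞ (fun p : ℝ × G => Y p.1 p.2) (Icc a b ×ˢ univ))
    {K : Set G} (hK : IsCompact K) (hYK : ∀ t ∈ Icc a b, ∀ y ∉ K, Y t y = 0) :
    ∃ L : ℝ, ∀ s ∈ Icc a b, ∃ φ : ℝ → G → G,
      ContDiffOn ℝ ∞ (fun p : ℝ × G => φ p.1 p.2) (Icc a b ×ˢ univ) ∧ (∀ y, φ s y = y) ∧
      (∀ y, ∀ t ∈ Icc a b, HasDerivWithinAt (φ · y) (Y t (φ t y)) (Icc a b) t) ∧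
      ∀ y, ∀ t ∈ Icc a b, ‖φ t y - y‖ ≤ L * |t - s| := by
  have hs0 : a ∈ Icc a b := left_mem_Icc.2 hab.le
  have : CompleteSpace G := FiniteDimensional.complete ℝ G
  obtain ⟨B, hB⟩ := (isCompact_Icc.prod hK).exists_bound_of_continuousOn
    (hY.continuousOn.mono (prod_mono_right (subset_univ K)))
  have hB' : ∀ t ∈ Icc a b, ∀ y, ‖Y t y‖ ≤ |B| := by
    intro t ht y
    by_cases hy : y ∈ K
    · exact (hB (t, y) ⟨ht, hy⟩).trans (le_abs_self B)
    · simp [hYK t ht y hy]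
  have hD := contDiffOn_fderiv_snd (uniqueDiffOn_Icc hab) isOpen_univ hY
  obtain ⟨C, hC⟩ := (isCompact_Icc.prod hK).exists_bound_of_continuousOn
    (hD.continuousOn.mono (prod_mono_right (subset_univ K)))
  have hC' : ∀ t ∈ Icc a b, ∀ y, ‖fderiv ℝ (Y t) y‖ ≤ |C| := by
    intro t ht y
    by_cases hy : y ∈ K
    · exact (hC (t, y) ⟨ht, hy⟩).trans (le_abs_self C)
    · have : Y t =ᶠ[𝓝 y] fun _ => 0 := by
        filter_upwards [hK.isClosed.isOpen_compl.mem_nhds hy] with z hz using hYK t ht z hz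
      rw [this.fderiv_eq]
      simp
  have hlip : ∀ t ∈ Icc a b, LipschitzWith ⟨|C|, abs_nonneg C⟩ (Y t) := fun t ht =>
    lipschitzWith_of_nnnorm_fderiv_le (𝕜 := ℝ)
      (fun y => (hasFDerivAt_snd isOpen_univ hY ht (mem_univ y)).differentiableAt)
      fun y => hC' t ht y
  have hcont : ∀ y, ContinuousOn (Y · y) (Icc a b) := fun y =>
    hY.continuousOn.comp (f := fun t => (t, y)) (by fun_prop) fun t ht => ⟨ht, mem_univ _⟩
  -- A bound for the speed bounds the displacement, with a constant that does not depend on the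
  -- initial time `s`; short-time existence uniform in `s` rests on this.
  refine ⟨|B|, fun s hs => ?_⟩
  choose φ hφs hφ using fun y => exists_solution_of_bounded (L := ⟨|B|, abs_nonneg B⟩)
    hlip hcont hB' hs y
  have hφL : ∀ y, ∀ t ∈ Icc a b, ∀ t' ∈ Icc a b, ‖φ y t' - φ y t‖ ≤ |B| * ‖t' - t‖ :=
    fun y t ht t' ht' => (convex_Icc a b).norm_image_sub_le_of_norm_hasDerivWithin_le
      (fun x hx => hφ y x hx) (fun x hx => hB' x hx _) ht ht'
  have hφc : ContinuousOn (fun p : ℝ × G => φ p.2 p.1) (Icc a b ×ˢ univ) := by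
    refine continuousOn_prod_of_continuousOn_lipschitzOnWith' _
      (Real.toNNReal (Real.exp ((|C| + 1) * (b - a)))) (fun t ht => ?_)
      (fun y _ t ht => (hφ y t ht).continuousWithinAt)
    refine LipschitzOnWith.of_dist_le_mul fun y _ y' _ => ?_
    rw [Real.coe_toNNReal _ (Real.exp_pos _).le, dist_eq_norm, dist_eq_norm]
    have := norm_le_of_norm_deriv_le (f := fun t => φ y t - φ y' t) (K := |C|) (ε := 0)
      (abs_nonneg _) le_rfl hs (fun t ht => (hφ y t ht).sub (hφ y' t ht))
      (fun t ht => by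
        rw [add_zero]
        exact (hlip t ht).norm_sub_le (φ y t) (φ y' t)) ht
    simp only [hφs, add_zero] at this
    linarith
  refine ⟨fun t y => φ y t, ?_, hφs, hφ, fun y t ht => ?_⟩
  · exact contDiffOn_of_solution (φ := fun t y => φ y t) isOpen_univ isOpen_univ hab hs hY hφc
      (fun _ _ _ _ => mem_univ _) (fun y _ => hφ y) (contDiffOn_id.congr fun y _ => hφs y)
  · simpa [hφs] using hφL y s hs t ht

end Regularity

/-! ### Differentials of charts and velocities of curves -/

section Charts

variable {E : Type*} [NormedAddCommGroup E] [NormedSpace ℝ E]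
  {M : Type*} [TopologicalSpace M] [ChartedSpace E M]

/-- The differential at `x` of the preferred chart at `x₀`, as an endomorphism of the model. -/
noncomputable def chartD (x₀ x : M) : E →L[ℝ] E :=
  mfderiv 𝓘(ℝ, E) 𝓘(ℝ, E) (extChartAt 𝓘(ℝ, E) x₀) x

/-- The differential at `y` of the inverse of the preferred chart at `x₀`. -/
noncomputable def chartSymmD (x₀ : M) (y : E) : E →L[ℝ] E :=
  mfderiv 𝓘(ℝ, E) 𝓘(ℝ, E) (extChartAt 𝓘(ℝ, E) x₀).symm y

/-- The curve `γ` has velocity `v` at `t` within `s`. -/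
def HasVelocity (γ : ℝ → M) (v : E) (s : Set ℝ) (t : ℝ) : Prop :=
  HasMFDerivWithinAt 𝓘(ℝ, ℝ) 𝓘(ℝ, E) γ s t (ContinuousLinearMap.toSpanSingleton ℝ v : ℝ →L[ℝ] E)

lemma hasVelocity_iff_hasDerivWithinAt {c : ℝ → E} {w : E} {s : Set ℝ} {t : ℝ} :
    HasVelocity (M := E) c w s t ↔ HasDerivWithinAt c w s t := by
  rw [hasDerivWithinAt_iff_hasFDerivWithinAt]
  exact hasMFDerivWithinAt_iff_hasFDerivWithinAt

section

variable [IsManifold 𝓘(ℝ, E) ∞ M] {x₀ x : M} {y : E}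

lemma isManifold_one : IsManifold 𝓘(ℝ, E) 1 M := IsManifold.of_le (n := ∞) (by norm_num)

lemma hasMFDerivAt_chart (hx : x ∈ (extChartAt 𝓘(ℝ, E) x₀).source) :
    HasMFDerivAt 𝓘(ℝ, E) 𝓘(ℝ, E) (extChartAt 𝓘(ℝ, E) x₀) x (chartD x₀ x : E →L[ℝ] E) := by
  have : IsManifold 𝓘(ℝ, E) 1 M := isManifold_one
  exact (mdifferentiableAt_extChartAt (by simpa using hx)).hasMFDerivAt

lemma hasMFDerivAt_chart_symm (hy : y ∈ (extChartAt 𝓘(ℝ, E) x₀).target) :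
    HasMFDerivAt 𝓘(ℝ, E) 𝓘(ℝ, E) (extChartAt 𝓘(ℝ, E) x₀).symm y
      (chartSymmD x₀ y : E →L[ℝ] E) := by
  have : IsManifold 𝓘(ℝ, E) 1 M := isManifold_one
  have h := mdifferentiableWithinAt_extChartAt_symm hy
  rw [ModelWithCorners.range_eq_univ, mdifferentiableWithinAt_univ] at h
  exact h.hasMFDerivAt

lemma chartD_chartSymmD (hy : y ∈ (extChartAt 𝓘(ℝ, E) x₀).target) (v : E) :
    chartD x₀ ((extChartAt 𝓘(ℝ, E) x₀).symm y) (chartSymmD x₀ y v) = v := by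
  have : IsManifold 𝓘(ℝ, E) 1 M := isManifold_one
  have h := mfderiv_extChartAt_comp_mfderivWithin_extChartAt_symm hy
  rw [ModelWithCorners.range_eq_univ, mfderivWithin_univ] at h
  exact congrArg (fun L : E →L[ℝ] E => L v) h

lemma chartSymmD_chartD (hx : x ∈ (extChartAt 𝓘(ℝ, E) x₀).source) (v : E) :
    chartSymmD x₀ (extChartAt 𝓘(ℝ, E) x₀ x) (chartD x₀ x v) = v := by
  have : IsManifold 𝓘(ℝ, E) 1 M := isManifold_one
  have h := mfderivWithin_extChartAt_symm_comp_mfderiv_extChartAt' hx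
  rw [ModelWithCorners.range_eq_univ, mfderivWithin_univ] at h
  exact congrArg (fun L : E →L[ℝ] E => L v) h

/-- The tangent space at `x` is the model space as seen in the preferred chart at `x`, so this chart
has the identity as differential there. -/
lemma chartD_self (x : M) (v : E) : chartD x x v = v := by
  have : IsManifold 𝓘(ℝ, E) 1 M := isManifold_one
  have h := mfderiv_extChartAt_self (I := 𝓘(ℝ, E)) (x := x)
  exact congrArg (fun L : E →L[ℝ] E => L v) h

lemma HasVelocity.chart {γ : ℝ → M} {v : E} {s : Set ℝ} {t : ℝ} (h : HasVelocity γ v s t)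
    (hx : γ t ∈ (extChartAt 𝓘(ℝ, E) x₀).source) :
    HasDerivWithinAt (fun t => extChartAt 𝓘(ℝ, E) x₀ (γ t)) (chartD x₀ (γ t) v) s t := by
  have h1 := (hasMFDerivAt_chart hx).comp_hasMFDerivWithinAt t h
  refine hasVelocity_iff_hasDerivWithinAt.1 (h1.congr_mfderiv ?_)
  refine ContinuousLinearMap.ext fun a => ?_
  exact (chartD x₀ (γ t)).map_smul a v

lemma hasVelocity_chart_symm {c : ℝ → E} {w : E} {s : Set ℝ} {t : ℝ}
    (h : HasDerivWithinAt c w s t) (hy : c t ∈ (extChartAt 𝓘(ℝ, E) x₀).target) :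
    HasVelocity (fun t => (extChartAt 𝓘(ℝ, E) x₀).symm (c t)) (chartSymmD x₀ (c t) w) s t := by
  refine ((hasMFDerivAt_chart_symm hy).comp_hasMFDerivWithinAt t
    (hasVelocity_iff_hasDerivWithinAt.2 h)).congr_mfderiv ?_
  refine ContinuousLinearMap.ext fun a => ?_
  exact (chartSymmD x₀ (c t)).map_smul a w

end

lemma HasVelocity.congr {γ γ' : ℝ → M} {v : E} {s : Set ℝ} {t : ℝ} (h : HasVelocity γ v s t)
    (h' : γ' =ᶠ[𝓝[s] t] γ) (ht : γ' t = γ t) : HasVelocity γ' v s t :=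
  HasMFDerivWithinAt.congr_of_eventuallyEq h h' ht

lemma HasVelocity.continuousWithinAt {γ : ℝ → M} {v : E} {s : Set ℝ} {t : ℝ}
    (h : HasVelocity γ v s t) : ContinuousWithinAt γ s t :=
  HasMFDerivWithinAt.continuousWithinAt h

lemma hasVelocity_const (x : M) (s : Set ℝ) (t : ℝ) : HasVelocity (fun _ => x) (0 : E) s t := by
  refine (hasMFDerivWithinAt_const (I := 𝓘(ℝ, ℝ)) (I' := 𝓘(ℝ, E)) x s t).congr_mfderiv ?_
  exact ContinuousLinearMap.ext fun a => (smul_zero (M := ℝ) (A := E) a).symm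

end Charts

/-! ### Uniqueness of integral curves on a manifold -/

section Uniqueness

variable {E : Type*} [NormedAddCommGroup E] [NormedSpace ℝ E]
  {M : Type*} [TopologicalSpace M] [ChartedSpace E M] [IsManifold 𝓘(ℝ, E) ∞ M]

/-- The time-dependent vector field `X` in the preferred chart at `x₀`. -/
noncomputable def fieldInChart (X : ℝ → M → E) (x₀ : M) (p : ℝ × E) : E :=
  chartD x₀ ((extChartAt 𝓘(ℝ, E) x₀).symm p.2) (X p.1 ((extChartAt 𝓘(ℝ, E) x₀).symm p.2))

/-- The time-dependent vector field `X` is smooth on `[0,1] × M`. -/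
def IsSmoothField (X : ℝ → M → E) : Prop :=
  ∀ x₀ : M, ContDiffOn ℝ ∞ (fieldInChart X x₀) (Icc 0 1 ×ˢ (extChartAt 𝓘(ℝ, E) x₀).target)

lemma HasVelocity.fieldInChart {X : ℝ → M → E} {x₀ : M} {γ : ℝ → M} {s : Set ℝ} {t : ℝ}
    (h : HasVelocity γ (X t (γ t)) s t) (hx : γ t ∈ (extChartAt 𝓘(ℝ, E) x₀).source) :
    HasDerivWithinAt (fun t => extChartAt 𝓘(ℝ, E) x₀ (γ t))
      (fieldInChart X x₀ (t, extChartAt 𝓘(ℝ, E) x₀ (γ t))) s t := by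
  have := h.chart hx
  rwa [ContactIsotopy.fieldInChart, (extChartAt 𝓘(ℝ, E) x₀).left_inv hx]

lemma hasVelocity_of_fieldInChart {X : ℝ → M → E} {x₀ : M} {c : ℝ → E} {s : Set ℝ} {t : ℝ}
    (h : HasDerivWithinAt c (fieldInChart X x₀ (t, c t)) s t)
    (hy : c t ∈ (extChartAt 𝓘(ℝ, E) x₀).target) :
    HasVelocity (fun t => (extChartAt 𝓘(ℝ, E) x₀).symm (c t))
      (X t ((extChartAt 𝓘(ℝ, E) x₀).symm (c t))) s t := by
  have := hasVelocity_chart_symm h hy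
  have e := chartSymmD_chartD ((extChartAt 𝓘(ℝ, E) x₀).map_target hy)
    (X t ((extChartAt 𝓘(ℝ, E) x₀).symm (c t)))
  rw [(extChartAt 𝓘(ℝ, E) x₀).right_inv hy] at e
  rwa [ContactIsotopy.fieldInChart, e] at this

/-- For a short time both curves stay in one chart. There the field is `C^1` on a product of convex
sets, hence locally Lipschitz even at the ends of `[0,1]`, and uniqueness in the vector space
applies. -/
lemma eventuallyEq_of_hasVelocity {X : ℝ → M → E} (hX : IsSmoothField X) {γ₁ γ₂ : ℝ → M} {t₀ : ℝ}
    (ht₀ : t₀ ∈ Icc (0 : ℝ) 1)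
    (h₁ : ∀ᶠ t in 𝓝[Icc 0 1] t₀, HasVelocity γ₁ (X t (γ₁ t)) (Icc 0 1) t)
    (h₂ : ∀ᶠ t in 𝓝[Icc 0 1] t₀, HasVelocity γ₂ (X t (γ₂ t)) (Icc 0 1) t)
    (h : γ₁ t₀ = γ₂ t₀) : γ₁ =ᶠ[𝓝[Icc 0 1] t₀] γ₂ := by
  set e := extChartAt 𝓘(ℝ, E) (γ₁ t₀) with he
  have htgt : e.target ∈ 𝓝 (e (γ₁ t₀)) := extChartAt_target_mem_nhds _
  obtain ⟨r, hr, hball⟩ := Metric.mem_nhds_iff.1 htgt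
  have hconv : Convex ℝ (Icc (0 : ℝ) 1 ×ˢ ball (e (γ₁ t₀)) r) :=
    (convex_Icc 0 1).prod (convex_ball _ _)
  obtain ⟨K, T, hT, hK⟩ := ((((hX (γ₁ t₀)).mono (prod_mono_right hball)).of_le (m := 1)
    (by norm_num)) (t₀, e (γ₁ t₀)) ⟨ht₀, mem_ball_self hr⟩).exists_lipschitzOnWith hconv
  rw [nhdsWithin_prod_eq, (isOpen_ball).nhdsWithin_eq (mem_ball_self hr)] at hT
  obtain ⟨T₁, hT₁, T₂, hT₂, hTT⟩ := Filter.mem_prod_iff.1 hT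
  have ev : ∀ γ : ℝ → M, γ t₀ = γ₁ t₀ →
      (∀ᶠ t in 𝓝[Icc 0 1] t₀, HasVelocity γ (X t (γ t)) (Icc 0 1) t) →
      ∀ᶠ t in 𝓝[Icc 0 1] t₀, HasVelocity γ (X t (γ t)) (Icc 0 1) t ∧ γ t ∈ e.source ∧
        e (γ t) ∈ T₂ := by
    intro γ hγ hv
    have hc := (hv.self_of_nhdsWithin ht₀).continuousWithinAt
    rw [ContinuousWithinAt, hγ] at hc
    exact hv.and ((hc.eventually (extChartAt_source_mem_nhds _)).and
      (hc.eventually ((continuousAt_extChartAt _).eventually hT₂)))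
  have hall := ((ev γ₁ rfl h₁).and (ev γ₂ h.symm h₂)).and hT₁
  obtain ⟨δ, hδ, hsub⟩ := Metric.mem_nhdsWithin_iff.1 hall
  -- A closed interval that is a neighbourhood of `t₀` within `[0,1]`; the truncation handles the
  -- endpoints.
  have hIcc : ∀ t ∈ Icc (max 0 (t₀ - δ / 2)) (min 1 (t₀ + δ / 2)),
      t ∈ ball t₀ δ ∩ Icc 0 1 := by
    intro t ht
    simp only [mem_Icc, max_le_iff, le_min_iff] at ht
    refine ⟨?_, ht.1.1, ht.2.1⟩
    rw [mem_ball, Real.dist_eq, abs_lt]; constructor <;> linarith [ht.1.2, ht.2.2]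
  have hIcc' : Icc (max 0 (t₀ - δ / 2)) (min 1 (t₀ + δ / 2)) ⊆ Icc 0 1 := fun t ht => (hIcc t ht).2
  have ht₀' : t₀ ∈ Icc (max 0 (t₀ - δ / 2)) (min 1 (t₀ + δ / 2)) := by
    simp only [mem_Icc, max_le_iff, le_min_iff]
    refine ⟨⟨ht₀.1, by linarith⟩, ht₀.2, by linarith⟩
  have heq := eqOn_of_solution (v := fun t y => fieldInChart X (γ₁ t₀) (t, y)) (s := fun _ => T₂)
    (K := K) (f := fun t => e (γ₁ t)) (g := fun t => e (γ₂ t)) (fun t ht => by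
      refine LipschitzOnWith.of_dist_le_mul fun y hy z hz => ?_
      have := hK.dist_le_mul (t, y) (hTT ⟨(hsub (hIcc t ht)).2, hy⟩) (t, z)
        (hTT ⟨(hsub (hIcc t ht)).2, hz⟩)
      simpa [Prod.dist_eq] using this) ht₀'
    (fun t ht => ((hsub (hIcc t ht)).1.1.1.fieldInChart (hsub (hIcc t ht)).1.1.2.1).mono hIcc')
    (fun t ht => (hsub (hIcc t ht)).1.1.2.2)
    (fun t ht => ((hsub (hIcc t ht)).1.2.1.fieldInChart (hsub (hIcc t ht)).1.2.2.1).mono hIcc')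
    (fun t ht => (hsub (hIcc t ht)).1.2.2.2) (by simp [h])
  filter_upwards [inter_mem_nhdsWithin (Icc 0 1) (ball_mem_nhds t₀ (half_pos hδ))] with t ht
  have ht' : t ∈ Icc (max 0 (t₀ - δ / 2)) (min 1 (t₀ + δ / 2)) := by
    have := ht.2
    rw [mem_ball, Real.dist_eq, abs_lt] at this
    simp only [mem_Icc, max_le_iff, le_min_iff]
    refine ⟨⟨ht.1.1, by linarith⟩, ht.1.2, by linarith⟩
  have := heq ht'
  exact e.injOn (hsub (hIcc t ht')).1.1.2.1 (hsub (hIcc t ht')).1.2.2.1 this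

/-- The coincidence set is closed because `M` is Hausdorff and open by local uniqueness, so it fills
the connected `J`. -/
lemma eqOn_of_hasVelocity [T2Space M] {X : ℝ → M → E} (hX : IsSmoothField X) {γ₁ γ₂ : ℝ → M}
    {J : Set ℝ} (hJ : IsPreconnected J) (hJI : J ⊆ Icc 0 1) (hJo : ∀ t ∈ J, J ∈ 𝓝[Icc 0 1] t)
    (h₁ : ∀ t ∈ J, HasVelocity γ₁ (X t (γ₁ t)) (Icc 0 1) t)
    (h₂ : ∀ t ∈ J, HasVelocity γ₂ (X t (γ₂ t)) (Icc 0 1) t) {s : ℝ} (hs : s ∈ J)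
    (h : γ₁ s = γ₂ s) : EqOn γ₁ γ₂ J := by
  have : PreconnectedSpace J := isPreconnected_iff_preconnectedSpace.1 hJ
  have hc₁ : ContinuousOn γ₁ J := fun t ht => (h₁ t ht).continuousWithinAt.mono hJI
  have hc₂ : ContinuousOn γ₂ J := fun t ht => (h₂ t ht).continuousWithinAt.mono hJI
  have hclopen : IsClopen {t : J | γ₁ t = γ₂ t} := by
    refine ⟨isClosed_eq hc₁.domRestrict hc₂.domRestrict, isOpen_iff_mem_nhds.2 fun t ht => ?_⟩
    have := eventuallyEq_of_hasVelocity hX (hJI t.2)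
      (mem_of_superset (hJo t t.2) h₁) (mem_of_superset (hJo t t.2) h₂) ht
    exact (tendsto_nhdsWithin_iff.2 ⟨continuous_subtype_val.continuousAt,
      Eventually.of_forall fun t => hJI t.2⟩).eventually this
  have huniv := hclopen.eq_univ ⟨⟨s, hs⟩, h⟩
  intro t ht
  have : (⟨t, ht⟩ : J) ∈ {t : J | γ₁ t = γ₂ t} := huniv ▸ mem_univ _
  exact this

end Uniqueness

/-! ### Smooth families of maps in charts -/

section ChartSmoothness

variable {E : Type*} [NormedAddCommGroup E] [NormedSpace ℝ E]
  {F : Type*} [NormedAddCommGroup F] [NormedSpace ℝ F]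
  {M : Type*} [TopologicalSpace M] [ChartedSpace E M] [IsManifold 𝓘(ℝ, E) ∞ M]
  {N : Type*} [TopologicalSpace N] [ChartedSpace F N] [IsManifold 𝓘(ℝ, F) ∞ N]

lemma contMDiffOn_prod_self_iff {f : ℝ × F → E} {s : Set (ℝ × F)} :
    ContMDiffOn (𝓘(ℝ, ℝ).prod 𝓘(ℝ, F)) 𝓘(ℝ, E) ∞ f s ↔ ContDiffOn ℝ ∞ f s := by
  rw [← contMDiffOn_iff_contDiffOn, modelWithCornersSelf_prod, ← chartedSpaceSelf_prod]

/-- A smooth map `ℝ × N → M`, written in charts. -/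
lemma contDiffOn_inCharts {f : ℝ → N → M} {S : Set (ℝ × N)}
    (hf : ContMDiffOn (𝓘(ℝ, ℝ).prod 𝓘(ℝ, F)) 𝓘(ℝ, E) ∞ (fun p : ℝ × N => f p.1 p.2) S)
    (p₀ : N) (x₀ : M) {S' : Set (ℝ × F)} (hS' : ∀ q ∈ S', q.2 ∈ (extChartAt 𝓘(ℝ, F) p₀).target ∧
      (q.1, (extChartAt 𝓘(ℝ, F) p₀).symm q.2) ∈ S ∧
      f q.1 ((extChartAt 𝓘(ℝ, F) p₀).symm q.2) ∈ (extChartAt 𝓘(ℝ, E) x₀).source) :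
    ContDiffOn ℝ ∞ (fun q : ℝ × F =>
      extChartAt 𝓘(ℝ, E) x₀ (f q.1 ((extChartAt 𝓘(ℝ, F) p₀).symm q.2))) S' := by
  rw [← contMDiffOn_prod_self_iff]
  have h1 : ContMDiffOn (𝓘(ℝ, ℝ).prod 𝓘(ℝ, F)) (𝓘(ℝ, ℝ).prod 𝓘(ℝ, F)) ∞
      (fun q : ℝ × F => (q.1, (extChartAt 𝓘(ℝ, F) p₀).symm q.2)) S' :=
    contMDiffOn_fst.prodMk ((contMDiffOn_extChartAt_symm p₀).comp contMDiffOn_snd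
      fun q hq => (hS' q hq).1)
  have h2 := hf.comp h1 fun q hq => (hS' q hq).2.1
  have h3 : ContMDiffOn 𝓘(ℝ, E) 𝓘(ℝ, E) ∞ (extChartAt 𝓘(ℝ, E) x₀)
      (extChartAt 𝓘(ℝ, E) x₀).source := by
    rw [extChartAt_source]
    exact contMDiffOn_extChartAt
  exact h3.comp h2 fun q hq => (hS' q hq).2.2

end ChartSmoothness

/-! ### Flows of compactly supported fields on a manifold -/

section Flow

universe u
variable {E : Type u} [NormedAddCommGroup E] [NormedSpace ℝ E]
  {M : Type*} [TopologicalSpace M] [ChartedSpace E M]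

/-- `ψ` is a local flow of `X` on `U` for times `t` with `|t - s| < ε`, starting at time `s`. -/
structure IsLocalFlow (X : ℝ → M → E) (s ε : ℝ) (U : Set M) (ψ : ℝ → M → M) : Prop where
  start : ∀ x ∈ U, ψ s x = x
  velocity : ∀ x ∈ U, ∀ t ∈ Icc 0 1 ∩ ball s ε, HasVelocity (ψ · x) (X t (ψ t x)) (Icc 0 1) t
  smooth : ContMDiffOn (𝓘(ℝ, ℝ).prod 𝓘(ℝ, E)) 𝓘(ℝ, E) ∞ (fun p : ℝ × M => ψ p.1 p.2)
    ((Icc 0 1 ∩ ball s ε) ×ˢ U)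

lemma IsLocalFlow.mono {X : ℝ → M → E} {s ε : ℝ} {U : Set M} {ψ : ℝ → M → M}
    (h : IsLocalFlow X s ε U ψ) {δ : ℝ} (hδ : δ ≤ ε) : IsLocalFlow X s δ U ψ :=
  ⟨h.start, fun x hx t ht => h.velocity x hx t ⟨ht.1, ball_subset_ball hδ ht.2⟩,
    h.smooth.mono (prod_mono_left (inter_subset_inter_right _ (ball_subset_ball hδ)))⟩

variable [IsManifold 𝓘(ℝ, E) ∞ M]

/-- The field in a chart is cut off outside a ball of radius `r` and integrated in the vector space.
A solution starting within `r / 4` of the centre stays within `r / 2`, where the cutoff is `1`,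
while the displacement bound is at most `r / 4`. As that bound is independent of the starting time,
so are `U` and `ε`. -/
lemma exists_isLocalFlow [FiniteDimensional ℝ E] {X : ℝ → M → E} (hX : IsSmoothField X) (x₀ : M) :
    ∃ U ∈ 𝓝 x₀, ∃ ε > 0, ∀ s ∈ Icc (0 : ℝ) 1, ∃ ψ, IsLocalFlow X s ε U ψ := by
  set e := extChartAt 𝓘(ℝ, E) x₀ with he
  have htgt : e.target ∈ 𝓝 (e x₀) := extChartAt_target_mem_nhds _
  obtain ⟨r, hr, hball⟩ := Metric.nhds_basis_closedBall.mem_iff.1 htgt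
  let χ : ContDiffBump (e x₀) := ⟨r / 2, r, by positivity, by linarith⟩
  let Y : ℝ → E → E := fun t y => χ y • fieldInChart X x₀ (t, y)
  have hY0 : ∀ t, ∀ y ∉ closedBall (e x₀) r, Y t y = 0 := by
    intro t y hy
    have : χ y = 0 := χ.zero_of_le_dist (by simpa using (not_le.1 hy).le)
    simp [Y, this]
  have hY : ContDiffOn ℝ ∞ (fun p : ℝ × E => Y p.1 p.2) (Icc 0 1 ×ˢ univ) := by
    rintro ⟨t, y⟩ ⟨ht, -⟩
    by_cases hy : y ∈ closedBall (e x₀) r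
    · have h1 : ContDiffOn ℝ ∞ (fun p : ℝ × E => Y p.1 p.2) (Icc 0 1 ×ˢ e.target) :=
        (χ.contDiff.comp contDiff_snd).contDiffOn.smul (hX x₀)
      exact (h1 (t, y) ⟨ht, hball hy⟩).mono_of_mem_nhdsWithin (by
        rw [nhdsWithin_prod_eq]
        exact prod_mem_prod self_mem_nhdsWithin (mem_nhdsWithin_of_mem_nhds
          ((isOpen_extChartAt_target x₀).mem_nhds (hball hy))))
    · refine (contDiffWithinAt_const (c := (0 : E))).congr_of_eventuallyEq ?_ (hY0 t y hy)
      have : (Prod.snd ⁻¹' (closedBall (e x₀) r)ᶜ : Set (ℝ × E)) ∈ 𝓝 (t, y) :=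
        (isClosed_closedBall.isOpen_compl.preimage continuous_snd).mem_nhds hy
      filter_upwards [mem_nhdsWithin_of_mem_nhds this] with p hp using hY0 p.1 p.2 hp
  obtain ⟨L, hL⟩ := exists_flow one_pos hY (isCompact_closedBall (e x₀) r) (fun t _ => hY0 t)
  have hrL : 0 < r / 4 / (|L| + 1) := by positivity
  refine ⟨e.source ∩ e ⁻¹' ball (e x₀) (r / 4), ?_, r / 4 / (|L| + 1), hrL, fun s hs => ?_⟩
  · exact inter_mem (extChartAt_source_mem_nhds _)
      ((continuousAt_extChartAt x₀).preimage_mem_nhds (ball_mem_nhds _ (by positivity)))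
  obtain ⟨φ, hφ, hφs, hφv, hφL⟩ := hL s hs
  have hin : ∀ x ∈ e.source ∩ e ⁻¹' ball (e x₀) (r / 4), ∀ t ∈ Icc 0 1 ∩ ball s
      (r / 4 / (|L| + 1)), φ t (e x) ∈ closedBall (e x₀) (r / 2) := by
    intro x hx t ht
    have h1 := hφL (e x) t ht.1
    have h2 : dist (e x) (e x₀) < r / 4 := hx.2
    have h3 : |t - s| < r / 4 / (|L| + 1) := by simpa [Real.dist_eq] using ht.2
    have h4 : L * |t - s| ≤ r / 4 := by
      calc L * |t - s| ≤ (|L| + 1) * |t - s| := by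
            gcongr; linarith [le_abs_self L]
        _ ≤ (|L| + 1) * (r / 4 / (|L| + 1)) := by gcongr
        _ = r / 4 := by field_simp
    rw [mem_closedBall]
    calc dist (φ t (e x)) (e x₀) ≤ dist (φ t (e x)) (e x) + dist (e x) (e x₀) := dist_triangle _ _ _
      _ ≤ r / 2 := by rw [dist_eq_norm (φ t (e x))]; linarith
  have hin' : closedBall (e x₀) (r / 2) ⊆ e.target :=
    (closedBall_subset_closedBall (by linarith)).trans hball
  refine ⟨fun t x => e.symm (φ t (e x)), fun x hx => ?_, fun x hx t ht => ?_, ?_⟩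
  · simp only [hφs]
    exact e.left_inv hx.1
  · have h1 := hφv (e x) t ht.1
    have h2 : Y t (φ t (e x)) = fieldInChart X x₀ (t, φ t (e x)) := by
      simp only [Y]
      rw [χ.one_of_mem_closedBall (hin x hx t ht), one_smul]
    rw [h2] at h1
    exact hasVelocity_of_fieldInChart h1 (hin' (hin x hx t ht))
  · have h1 : ContMDiffOn (𝓘(ℝ, ℝ).prod 𝓘(ℝ, E)) (𝓘(ℝ, ℝ).prod 𝓘(ℝ, E)) ∞
        (fun p : ℝ × M => (p.1, e p.2)) ((Icc 0 1 ∩ ball s (r / 4 / (|L| + 1))) ×ˢ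
          (e.source ∩ e ⁻¹' ball (e x₀) (r / 4))) := by
      refine contMDiffOn_fst.prodMk ((contMDiffOn_extChartAt (x := x₀)).comp contMDiffOn_snd ?_)
      intro p hp
      simpa [he] using hp.2.1
    have h2 := (contMDiffOn_prod_self_iff.2 hφ).comp h1 (fun p hp => ⟨hp.1.1, mem_univ _⟩)
    exact (contMDiffOn_extChartAt_symm x₀).comp h2 fun p hp => hin' (hin p.2 hp.2 p.1 hp.1)

variable [T2Space M]

/-- Compactness of `K` yields one time step for all its points; at points off `K` the stationary
flow on `Kᶜ` serves for any time step. -/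
lemma exists_uniform_isLocalFlow [FiniteDimensional ℝ E] {X : ℝ → M → E} (hX : IsSmoothField X) {K : Set M}
    (hK : IsCompact K) (hXK : ∀ t ∈ Icc (0 : ℝ) 1, ∀ x ∉ K, X t x = 0) :
    ∃ ε > 0, ∀ x₀ : M, ∃ U ∈ 𝓝 x₀, ∀ s ∈ Icc (0 : ℝ) 1, ∃ ψ, IsLocalFlow X s ε U ψ := by
  obtain ⟨ε, hε, h⟩ : ∃ ε > 0, ∀ x₀ ∈ K, ∃ U ∈ 𝓝 x₀, ∀ s ∈ Icc (0 : ℝ) 1,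
      ∃ ψ, IsLocalFlow X s ε U ψ := by
    refine hK.induction_on (p := fun K => ∃ ε > 0, ∀ x₀ ∈ K, ∃ U ∈ 𝓝 x₀, ∀ s ∈ Icc (0 : ℝ) 1,
      ∃ ψ, IsLocalFlow X s ε U ψ) ⟨1, one_pos, by simp⟩ ?_ ?_ ?_
    · rintro s t hst ⟨ε, hε, h⟩
      exact ⟨ε, hε, fun x hx => h x (hst hx)⟩
    · rintro s t ⟨ε, hε, h⟩ ⟨ε', hε', h'⟩
      refine ⟨min ε ε', lt_min hε hε', fun x hx => ?_⟩
      rcases hx with hx | hx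
      · obtain ⟨U, hU, hs⟩ := h x hx
        exact ⟨U, hU, fun s hs' => (hs s hs').imp fun ψ hψ => hψ.mono (min_le_left _ _)⟩
      · obtain ⟨U, hU, hs⟩ := h' x hx
        exact ⟨U, hU, fun s hs' => (hs s hs').imp fun ψ hψ => hψ.mono (min_le_right _ _)⟩
    · intro x _
      obtain ⟨U, hU, ε, hε, h⟩ := exists_isLocalFlow hX x
      obtain ⟨V, hVU, hV, hxV⟩ := mem_nhds_iff.1 hU
      exact ⟨V, mem_nhdsWithin_of_mem_nhds (hV.mem_nhds hxV), ε, hε,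
        fun y hy => ⟨U, mem_of_superset (hV.mem_nhds hy) hVU, h⟩⟩
  refine ⟨ε, hε, fun x₀ => ?_⟩
  by_cases hx : x₀ ∈ K
  · exact h x₀ hx
  · refine ⟨Kᶜ, hK.isClosed.isOpen_compl.mem_nhds hx, fun s _ => ⟨fun _ x => x, fun _ _ => rfl,
      fun x hx t ht => ?_, contMDiffOn_snd⟩⟩
    rw [hXK t ht.1 x hx]
    exact hasVelocity_const x _ _

/-- A step of uniform size makes `A` closed as well as open in `[0,1]`: a point within `ε` of `A`
lies in `A`. -/
lemma eq_Icc_of_ball_subset {A : Set ℝ} (hA : A ⊆ Icc 0 1) {s ε : ℝ} (hs : s ∈ A) (hε : 0 < ε)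
    (h : ∀ t ∈ A, Icc 0 1 ∩ ball t ε ⊆ A) : A = Icc 0 1 := by
  refine hA.antisymm fun t ht => ?_
  have : PreconnectedSpace (Icc (0 : ℝ) 1) :=
    isPreconnected_iff_preconnectedSpace.1 isPreconnected_Icc
  have hcl : IsClopen {t : Icc (0 : ℝ) 1 | (t : ℝ) ∈ A} := by
    constructor
    · refine ⟨isOpen_iff_mem_nhds.2 fun t ht => ?_⟩
      filter_upwards [ball_mem_nhds t hε] with u hu hu'
      exact ht (h u hu' ⟨t.2, by rw [mem_ball']; exact hu⟩)
    · refine isOpen_iff_mem_nhds.2 fun t ht => ?_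
      filter_upwards [ball_mem_nhds t hε] with u hu
      exact h t ht ⟨u.2, hu⟩
  have := hcl.eq_univ ⟨⟨s, hA hs⟩, hs⟩
  exact (this ▸ mem_univ _ : (⟨t, ht⟩ : Icc (0 : ℝ) 1) ∈ {t : Icc (0 : ℝ) 1 | (t : ℝ) ∈ A})

/-- The curves agree on the connected overlap by uniqueness. Both domains are relatively open, so
the glued curve coincides near each time with one of the two and inherits its velocity. -/
lemma exists_glue {X : ℝ → M → E} (hX : IsSmoothField X) {γ₁ γ₂ : ℝ → M} {J₁ J₂ : Set ℝ}
    (hJ₁ : J₁.OrdConnected) (hJ₂ : J₂.OrdConnected) (hI₁ : J₁ ⊆ Icc 0 1)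
    (ho₁ : ∀ t ∈ J₁, J₁ ∈ 𝓝[Icc 0 1] t) (ho₂ : ∀ t ∈ J₂, J₂ ∈ 𝓝[Icc 0 1] t)
    (h₁ : ∀ t ∈ J₁, HasVelocity γ₁ (X t (γ₁ t)) (Icc 0 1) t)
    (h₂ : ∀ t ∈ J₂, HasVelocity γ₂ (X t (γ₂ t)) (Icc 0 1) t) {c : ℝ} (hc₁ : c ∈ J₁) (hc₂ : c ∈ J₂)
    (hc : γ₁ c = γ₂ c) :
    ∃ γ : ℝ → M, EqOn γ γ₁ J₁ ∧ ∀ t ∈ J₁ ∪ J₂, HasVelocity γ (X t (γ t)) (Icc 0 1) t := by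
  classical
  have heq : EqOn γ₁ γ₂ (J₁ ∩ J₂) := eqOn_of_hasVelocity hX (hJ₁.inter hJ₂).isPreconnected
    (inter_subset_left.trans hI₁) (fun t ht => inter_mem (ho₁ t ht.1) (ho₂ t ht.2))
    (fun t ht => h₁ t ht.1) (fun t ht => h₂ t ht.2) ⟨hc₁, hc₂⟩ hc
  let γ : ℝ → M := fun t => if t ∈ J₁ then γ₁ t else γ₂ t
  have e₁ : EqOn γ γ₁ J₁ := fun t ht => if_pos ht
  have e₂ : EqOn γ γ₂ J₂ := fun t ht => by
    by_cases h : t ∈ J₁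
    · exact (e₁ h).trans (heq ⟨h, ht⟩)
    · exact if_neg h
  refine ⟨γ, e₁, fun t ht => ?_⟩
  rcases ht with ht | ht
  · rw [e₁ ht]
    exact (h₁ t ht).congr (mem_of_superset (ho₁ t ht) e₁) (e₁ ht)
  · rw [e₂ ht]
    exact (h₂ t ht).congr (mem_of_superset (ho₂ t ht) e₂) (e₂ ht)

/-- Every solution through `(s, x)` can be prolonged by `ε` around any time it reaches, so all times
in `[0,1]` are reached. A solution that reaches `0`, glued to one that reaches `1`, covers the
interval. -/
lemma exists_global_solution {X : ℝ → M → E} (hX : IsSmoothField X) {ε : ℝ} (hε : 0 < ε)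
    (h : ∀ x₀ : M, ∃ U ∈ 𝓝 x₀, ∀ s ∈ Icc (0 : ℝ) 1, ∃ ψ, IsLocalFlow X s ε U ψ) {s : ℝ}
    (hs : s ∈ Icc (0 : ℝ) 1) (x : M) :
    ∃ γ : ℝ → M, γ s = x ∧ ∀ t ∈ Icc (0 : ℝ) 1, HasVelocity γ (X t (γ t)) (Icc 0 1) t := by
  have hb : ∀ s : ℝ, (Icc 0 1 ∩ ball s ε).OrdConnected := fun s => by
    rw [Real.ball_eq_Ioo]; exact ordConnected_Icc.inter ordConnected_Ioo
  have hbo : ∀ s : ℝ, ∀ t ∈ Icc 0 1 ∩ ball s ε, Icc 0 1 ∩ ball s ε ∈ 𝓝[Icc 0 1] t := fun s t ht =>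
    inter_mem_nhdsWithin _ (isOpen_ball.mem_nhds ht.2)
  let Good : Set ℝ → (ℝ → M) → Prop := fun J γ => J.OrdConnected ∧ J ⊆ Icc 0 1 ∧
    (∀ t ∈ J, J ∈ 𝓝[Icc 0 1] t) ∧ s ∈ J ∧ γ s = x ∧
    ∀ t ∈ J, HasVelocity γ (X t (γ t)) (Icc 0 1) t
  have loc : ∀ s ∈ Icc (0 : ℝ) 1, ∀ x : M, ∃ γ : ℝ → M, γ s = x ∧
      ∀ t ∈ Icc 0 1 ∩ ball s ε, HasVelocity γ (X t (γ t)) (Icc 0 1) t := by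
    intro s hs x
    obtain ⟨U, hU, h'⟩ := h x
    obtain ⟨ψ, hψ⟩ := h' s hs
    exact ⟨(ψ · x), hψ.start x (mem_of_mem_nhds hU), hψ.velocity x (mem_of_mem_nhds hU)⟩
  have union : ∀ J γ J' γ', Good J γ → Good J' γ' → ∃ γ'', Good (J ∪ J') γ'' := by
    rintro J γ J' γ' ⟨a1, a2, a3, a4, a5, a6⟩ ⟨b1, b2, b3, b4, b5, b6⟩
    obtain ⟨γ'', e, hv⟩ := exists_glue hX a1 b1 a2 a3 b3 a6 b6 a4 b4 (a5.trans b5.symm)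
    refine ⟨γ'', (a1.isPreconnected.union s a4 b4 b1.isPreconnected).ordConnected,
      union_subset a2 b2, ?_, Or.inl a4, (e a4).trans a5, hv⟩
    rintro t (ht | ht)
    · exact mem_of_superset (a3 t ht) subset_union_left
    · exact mem_of_superset (b3 t ht) subset_union_right
  have hA : {t | ∃ J γ, Good J γ ∧ t ∈ J} = Icc 0 1 := by
    refine eq_Icc_of_ball_subset (s := s) (ε := ε) ?_ ?_ hε ?_
    · rintro t ⟨J, γ, hJ, ht⟩
      exact hJ.2.1 ht
    · obtain ⟨γ, h1, h2⟩ := loc s hs x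
      exact ⟨_, γ, ⟨hb s, inter_subset_left, hbo s, ⟨hs, mem_ball_self hε⟩, h1, h2⟩,
        ⟨hs, mem_ball_self hε⟩⟩
    · rintro t ⟨J, γ, ⟨a1, a2, a3, a4, a5, a6⟩, ht⟩ u hu
      obtain ⟨γ', h1, h2⟩ := loc t (a2 ht) (γ t)
      have htb : t ∈ Icc 0 1 ∩ ball t ε := ⟨a2 ht, mem_ball_self hε⟩
      obtain ⟨γ'', e, hv⟩ := exists_glue hX a1 (hb t) a2 a3 (hbo t) a6 h2 ht
        htb h1.symm
      refine ⟨J ∪ (Icc 0 1 ∩ ball t ε), γ'',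
        ⟨(a1.isPreconnected.union t ht htb (hb t).isPreconnected).ordConnected,
        union_subset a2 inter_subset_left, ?_, Or.inl a4, (e a4).trans a5, hv⟩, Or.inr hu⟩
      rintro t' (ht' | ht')
      · exact mem_of_superset (a3 t' ht') subset_union_left
      · exact mem_of_superset (hbo t t' ht') subset_union_right
  obtain ⟨J, γ, hJ, h0⟩ : (0 : ℝ) ∈ {t | ∃ J γ, Good J γ ∧ t ∈ J} := hA ▸ ⟨le_rfl, zero_le_one⟩
  obtain ⟨J', γ', hJ', h1⟩ : (1 : ℝ) ∈ {t | ∃ J γ, Good J γ ∧ t ∈ J} := hA ▸ ⟨zero_le_one, le_rfl⟩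
  obtain ⟨γ'', hγ''⟩ := union J γ J' γ' hJ hJ'
  refine ⟨γ'', hγ''.2.2.2.2.1, fun t ht => hγ''.2.2.2.2.2 t ?_⟩
  exact hγ''.1.out (Or.inl h0) (Or.inr h1) ht

/-- The flow of a compactly supported smooth time-dependent vector field on a manifold: `Φ t s x`
is the position at time `t` of the solution which is at `x` at time `s`. -/
theorem exists_manifold_flow [FiniteDimensional ℝ E] {X : ℝ → M → E} (hX : IsSmoothField X) {K : Set M}
    (hK : IsCompact K) (hXK : ∀ t ∈ Icc (0 : ℝ) 1, ∀ x ∉ K, X t x = 0) :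
    ∃ Φ : ℝ → ℝ → M → M, ∀ s ∈ Icc (0 : ℝ) 1,
      ContMDiffOn (𝓘(ℝ, ℝ).prod 𝓘(ℝ, E)) 𝓘(ℝ, E) ∞ (fun p : ℝ × M => Φ p.1 s p.2)
        (Icc 0 1 ×ˢ univ) ∧ (∀ x, Φ s s x = x) ∧
      (∀ x, ∀ t ∈ Icc (0 : ℝ) 1, HasVelocity (Φ · s x) (X t (Φ t s x)) (Icc 0 1) t) ∧
      (∀ x, ∀ t ∈ Icc (0 : ℝ) 1, ∀ r ∈ Icc (0 : ℝ) 1, Φ t r (Φ r s x) = Φ t s x) ∧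
      ∀ x ∉ K, ∀ t ∈ Icc (0 : ℝ) 1, Φ t s x = x := by
  obtain ⟨ε, hε, hloc⟩ := exists_uniform_isLocalFlow hX hK hXK
  have hex : ∀ (s : ℝ) (x : M), ∃ γ : ℝ → M, s ∈ Icc (0 : ℝ) 1 → γ s = x ∧
      ∀ t ∈ Icc (0 : ℝ) 1, HasVelocity γ (X t (γ t)) (Icc 0 1) t := by
    intro s x
    by_cases hs : s ∈ Icc (0 : ℝ) 1
    · obtain ⟨γ, hγ⟩ := exists_global_solution hX hε hloc hs x
      exact ⟨γ, fun _ => hγ⟩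
    · exact ⟨fun _ => x, fun h => absurd h hs⟩
  choose Γ hΓ using hex
  have uniq : ∀ {γ₁ γ₂ : ℝ → M} {c : ℝ}, c ∈ Icc (0 : ℝ) 1 →
      (∀ t ∈ Icc (0 : ℝ) 1, HasVelocity γ₁ (X t (γ₁ t)) (Icc 0 1) t) →
      (∀ t ∈ Icc (0 : ℝ) 1, HasVelocity γ₂ (X t (γ₂ t)) (Icc 0 1) t) → γ₁ c = γ₂ c →
      EqOn γ₁ γ₂ (Icc 0 1) := fun hc h1 h2 h =>
    eqOn_of_hasVelocity hX isPreconnected_Icc subset_rfl (fun t _ => self_mem_nhdsWithin) h1 h2 hc h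
  have cocycle : ∀ s ∈ Icc (0 : ℝ) 1, ∀ x, ∀ t ∈ Icc (0 : ℝ) 1, ∀ r ∈ Icc (0 : ℝ) 1,
      Γ r (Γ s x r) t = Γ s x t := fun s hs x t ht r hr =>
    uniq hr (hΓ r _ hr).2 (hΓ s x hs).2 (hΓ r _ hr).1 ht
  -- smoothness for short times
  have short : ∀ r ∈ Icc (0 : ℝ) 1, ContMDiffOn (𝓘(ℝ, ℝ).prod 𝓘(ℝ, E)) 𝓘(ℝ, E) ∞
      (fun p : ℝ × M => Γ r p.2 p.1) ((Icc 0 1 ∩ ball r ε) ×ˢ univ) := by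
    rintro r hr ⟨t, x⟩ ⟨ht, -⟩
    obtain ⟨U, hU, h'⟩ := hloc x
    obtain ⟨ψ, hψ⟩ := h' r hr
    have heq : ∀ y ∈ U, EqOn (Γ r y) (ψ · y) (Icc 0 1 ∩ ball r ε) := by
      intro y hy
      refine eqOn_of_hasVelocity hX ?_ inter_subset_left
        (fun t ht => inter_mem_nhdsWithin _ (isOpen_ball.mem_nhds ht.2))
        (fun t ht => (hΓ r y hr).2 t ht.1) (hψ.velocity y hy) (s := r) ⟨hr, mem_ball_self hε⟩
        ((hΓ r y hr).1.trans (hψ.start y hy).symm)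
      rw [Real.ball_eq_Ioo]
      exact (ordConnected_Icc.inter ordConnected_Ioo).isPreconnected
    have h1 := hψ.smooth.congr (f₁ := fun p : ℝ × M => Γ r p.2 p.1)
      (fun p hp => heq p.2 hp.2 hp.1)
    refine (h1 (t, x) ⟨ht, mem_of_mem_nhds hU⟩).mono_of_mem_nhdsWithin ?_
    rw [nhdsWithin_prod_eq]
    exact prod_mem_prod self_mem_nhdsWithin (mem_nhdsWithin_of_mem_nhds hU)
  -- By the cocycle identity the map from time `s` is the map from `s` to `r` followed by a
  -- short-time flow. Smoothness at time `r` thus spreads to all times within `ε`, and then to all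
  -- of `[0,1]`.
  have step : ∀ s ∈ Icc (0 : ℝ) 1, ∀ r ∈ Icc (0 : ℝ) 1,
      ContMDiff 𝓘(ℝ, E) 𝓘(ℝ, E) ∞ (fun x => Γ s x r) →
      ContMDiffOn (𝓘(ℝ, ℝ).prod 𝓘(ℝ, E)) 𝓘(ℝ, E) ∞
        (fun p : ℝ × M => Γ s p.2 p.1) ((Icc 0 1 ∩ ball r ε) ×ˢ univ) := by
    intro s hs r hr hsm
    have h1 : ContMDiffOn (𝓘(ℝ, ℝ).prod 𝓘(ℝ, E)) (𝓘(ℝ, ℝ).prod 𝓘(ℝ, E)) ∞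
        (fun p : ℝ × M => (p.1, Γ s p.2 r)) ((Icc 0 1 ∩ ball r ε) ×ˢ univ) :=
      contMDiffOn_fst.prodMk (hsm.comp_contMDiffOn contMDiffOn_snd)
    refine ((short r hr).comp h1 fun p hp => ⟨hp.1, mem_univ _⟩).congr fun p hp => ?_
    exact (cocycle s hs p.2 p.1 hp.1.1 r hr).symm
  have hsm : ∀ s ∈ Icc (0 : ℝ) 1, ∀ r ∈ Icc (0 : ℝ) 1,
      ContMDiff 𝓘(ℝ, E) 𝓘(ℝ, E) ∞ (fun x => Γ s x r) := by
    intro s hs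
    have hA : {r ∈ Icc (0 : ℝ) 1 | ContMDiff 𝓘(ℝ, E) 𝓘(ℝ, E) ∞ (fun x => Γ s x r)} = Icc 0 1 := by
      refine eq_Icc_of_ball_subset (s := s) (ε := ε) (fun r hr => hr.1) ⟨hs, ?_⟩ hε ?_
      · simp only [fun x => (hΓ s x hs).1]
        exact contMDiff_id
      · rintro r ⟨hr, hr'⟩ t ht
        refine ⟨ht.1, ?_⟩
        have h1 : ContMDiff 𝓘(ℝ, E) (𝓘(ℝ, ℝ).prod 𝓘(ℝ, E)) ∞ (fun x : M => (t, x)) :=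
          contMDiff_const.prodMk contMDiff_id
        exact ((step s hs r hr hr').comp_contMDiff h1 fun x => ⟨ht, mem_univ _⟩)
    intro r hr
    rw [← hA] at hr
    exact hr.2
  refine ⟨fun t s x => Γ s x t, fun s hs => ⟨?_, fun x => (hΓ s x hs).1, fun x => (hΓ s x hs).2,
    fun x t ht r hr => cocycle s hs x t ht r hr, fun x hx t ht => ?_⟩⟩
  · rintro ⟨t, x⟩ ⟨ht, -⟩
    refine (step s hs t ht (hsm s hs t ht) (t, x) ⟨⟨ht, mem_ball_self hε⟩, mem_univ _⟩
      ).mono_of_mem_nhdsWithin ?_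
    rw [nhdsWithin_prod_eq]
    exact prod_mem_prod (inter_mem_nhdsWithin _ (ball_mem_nhds _ hε)) self_mem_nhdsWithin
  · refine uniq (γ₂ := fun _ => x) hs (hΓ s x hs).2 (fun t ht => ?_) (hΓ s x hs).1 ht
    rw [hXK t ht x hx]
    exact hasVelocity_const x _ _

end Flow

end ContactIsotopy

namespace ContactIsotopy

open Filter Topology Metric
open scoped NNReal Bundle

/-! ### Differential forms in charts -/

section FormInChart

variable {E : Type*} [NormedAddCommGroup E] [NormedSpace ℝ E]
  {M : Type*} [TopologicalSpace M] [ChartedSpace E M]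

/-- The value of the form `α` at `x`, as a linear form on the model space. -/
abbrev OneForm.val (α : OneForm E M) (x : M) : E →L[ℝ] ℝ := α x

/-- The value of the exterior derivative of `α` at `x`, as a bilinear form on the model space. -/
noncomputable abbrev OneForm.dval (α : OneForm E M) (x : M) : E →L[ℝ] E →L[ℝ] ℝ := α.extDeriv x

lemma OneForm.inChart_apply (α : OneForm E M) (x₀ : M) (y v : E) :
    α.inChart x₀ y v = α.val ((extChartAt 𝓘(ℝ, E) x₀).symm y) (chartSymmD x₀ y v) := rfl

variable [IsManifold 𝓘(ℝ, E) ∞ M]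

lemma OneForm.val_eq_inChart (α : OneForm E M) {x₀ x : M}
    (hx : x ∈ (extChartAt 𝓘(ℝ, E) x₀).source) (v : E) :
    α.val x v = α.inChart x₀ (extChartAt 𝓘(ℝ, E) x₀ x) (chartD x₀ x v) := by
  rw [α.inChart_apply, chartSymmD_chartD hx, (extChartAt 𝓘(ℝ, E) x₀).left_inv hx]

/-- In the bundle trivialisation at `x₀`, the fibre coordinate of `α` is `α` composed with the
differential of the inverse chart, that is, the chart expression; the trivial target line
contributes the identity. -/
lemma OneForm.IsSmooth.contDiffOn_inChart {α : OneForm E M} (hα : α.IsSmooth) (x₀ : M) :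
    ContDiffOn ℝ ∞ (α.inChart x₀) (extChartAt 𝓘(ℝ, E) x₀).target := by
  have : IsManifold 𝓘(ℝ, E) 1 M := isManifold_one
  have h1 := (Bundle.Trivialization.contMDiffOn_section_baseSet_iff (IB := 𝓘(ℝ, E)) (n := ∞)
    (trivializationAt (E →L[ℝ] ℝ) (fun x : M => TangentSpace 𝓘(ℝ, E) x →L[ℝ] Bundle.Trivial M ℝ x)
    x₀) (s := α)).1 hα.contMDiffOn
  have htriv : ∀ x : M, Bundle.Trivialization.continuousLinearMapAt ℝ
      (trivializationAt ℝ (Bundle.Trivial M ℝ) x₀) x = ContinuousLinearMap.id ℝ ℝ := fun x => 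
    Bundle.Trivial.continuousLinearMapAt_trivialization ℝ M ℝ x
  have h2 : ContMDiffOn 𝓘(ℝ, E) 𝓘(ℝ, E →L[ℝ] ℝ) ∞
      (fun x => (α.val x).comp (chartSymmD x₀ (extChartAt 𝓘(ℝ, E) x₀ x)))
      (extChartAt 𝓘(ℝ, E) x₀).source := by
    refine (h1.mono ?_).congr fun x hx => ?_
    · intro x hx
      exact ⟨by simpa using hx, mem_univ _⟩
    · have hx' : x ∈ (chartAt E x₀).source := by simpa using hx
      have h3 := TangentBundle.symmL_trivializationAt (I := 𝓘(ℝ, E)) hx'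
      rw [ModelWithCorners.range_eq_univ, mfderivWithin_univ] at h3
      refine (congrArg (fun L : E →L[ℝ] E => (α.val x).comp L) h3.symm).trans ?_
      rw [hom_trivializationAt_apply]
      ext v
      simp only [ContinuousLinearMap.inCoordinates, ContinuousLinearMap.comp_apply]
      refine Eq.trans ?_ (congrArg (fun L : ℝ →L[ℝ] ℝ => L (α.val x _)) (htriv x)).symm
      rfl
  rw [← contMDiffOn_iff_contDiffOn]
  refine (h2.comp (contMDiffOn_extChartAt_symm x₀)
    (fun y hy => (extChartAt 𝓘(ℝ, E) x₀).map_target hy)).congr fun y hy => ?_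
  simp only [Function.comp_apply, (extChartAt 𝓘(ℝ, E) x₀).right_inv hy]
  rfl

end FormInChart

/-! ### The exterior derivative and its independence of charts -/

section Exterior

variable {E : Type*} [NormedAddCommGroup E] [NormedSpace ℝ E]
  {F : Type*} [NormedAddCommGroup F] [NormedSpace ℝ F]

/-- The exterior derivative of a 1-form on a normed space. -/
noncomputable def dForm (β : E → E →L[ℝ] ℝ) (y : E) : E →L[ℝ] E →L[ℝ] ℝ :=
  fderiv ℝ β y - (fderiv ℝ β y).flip

lemma dForm_apply (β : E → E →L[ℝ] ℝ) (y v w : E) :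
    dForm β y v w = fderiv ℝ β y v w - fderiv ℝ β y w v := rfl

lemma dForm_swap (β : E → E →L[ℝ] ℝ) (y v w : E) : dForm β y v w = -dForm β y w v := by
  simp [dForm_apply]

/-- Naturality of `d`: the product rule adds the term `β (D²τ (v, w))`, which is symmetric in `v`
and `w` and cancels under antisymmetrisation. -/
lemma dForm_pullback {β : E → E →L[ℝ] ℝ} {β' : F → F →L[ℝ] ℝ} {τ : F → E} {u : F}
    (hτ : ContDiffAt ℝ ∞ τ u) (hβ : DifferentiableAt ℝ β (τ u))
    (h : ∀ᶠ z in 𝓝 u, β' z = (β (τ z)).comp (fderiv ℝ τ z)) (v w : F) :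
    dForm β' u v w = dForm β (τ u) (fderiv ℝ τ u v) (fderiv ℝ τ u w) := by
  have hτ' : DifferentiableAt ℝ (fderiv ℝ τ) u :=
    (hτ.fderiv_right (m := 1) (WithTop.coe_le_coe.2 (le_top : (2 : ℕ∞) ≤ ⊤))).differentiableAt (by simp)
  have hτ1 : DifferentiableAt ℝ τ u := hτ.differentiableAt (by simp)
  have h1 : HasFDerivAt (fun z => (β (τ z)).comp (fderiv ℝ τ z)) _ u :=
    (hβ.hasFDerivAt.comp u hτ1.hasFDerivAt).clm_comp hτ'.hasFDerivAt
  have h2 : ∀ v w, fderiv ℝ β' u v w = fderiv ℝ β (τ u) (fderiv ℝ τ u v) (fderiv ℝ τ u w) +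
      β (τ u) (fderiv ℝ (fderiv ℝ τ) u v w) := by
    intro v w
    rw [Filter.EventuallyEq.fderiv_eq h, h1.fderiv]
    simp [add_comm]
  have hsymm : IsSymmSndFDerivAt ℝ τ u := hτ.isSymmSndFDerivAt (by 
    simp only [minSmoothness_of_isRCLikeNormedField]; exact WithTop.coe_le_coe.2 (le_top : (2 : ℕ∞) ≤ ⊤))
  rw [dForm_apply, dForm_apply, h2, h2, hsymm v w]
  ring

end Exterior

section ExtDerivInChart

variable {E : Type*} [NormedAddCommGroup E] [NormedSpace ℝ E]
  {M : Type*} [TopologicalSpace M] [ChartedSpace E M] [IsManifold 𝓘(ℝ, E) ∞ M]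

lemma OneForm.dval_eq_dForm_self (α : OneForm E M) (x : M) (v w : E) :
    α.dval x v w = dForm (α.inChart x) (extChartAt 𝓘(ℝ, E) x x) v w := by
  have : α.dval x v w = dForm (α.inChart x) (extChartAt 𝓘(ℝ, E) x x) (chartD x x v)
    (chartD x x w) := rfl
  rw [this, chartD_self, chartD_self]

/-- The exterior derivative may be computed in any chart. -/
lemma OneForm.IsSmooth.dval_eq_dForm {α : OneForm E M} (hα : α.IsSmooth) {x₀ x : M}
    (hx : x ∈ (extChartAt 𝓘(ℝ, E) x₀).source) (v w : E) :
    α.dval x v w = dForm (α.inChart x₀) (extChartAt 𝓘(ℝ, E) x₀ x) (chartD x₀ x v)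
      (chartD x₀ x w) := by
  set κ := extChartAt 𝓘(ℝ, E) x
  set φ := extChartAt 𝓘(ℝ, E) x₀
  have hxκ : κ x ∈ κ.target := mem_extChartAt_target x
  have hκx : κ.symm (κ x) = x := extChartAt_to_inv x
  have hnear : ∀ᶠ z in 𝓝 (κ x), z ∈ κ.target ∧ κ.symm z ∈ φ.source := by
    refine inter_mem (extChartAt_target_mem_nhds x) ?_
    exact (continuousAt_extChartAt_symm x).eventually
      ((isOpen_extChartAt_source x₀).mem_nhds (by rwa [hκx]))
  have hτ : ∀ z, z ∈ κ.target → κ.symm z ∈ φ.source →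
      HasFDerivAt (fun z => φ (κ.symm z)) ((chartD x₀ (κ.symm z)).comp (chartSymmD x z)) z :=
    fun z hz hz' => hasMFDerivAt_iff_hasFDerivAt.1
      ((hasMFDerivAt_chart hz').comp z (hasMFDerivAt_chart_symm hz))
  have hτs : ContDiffAt ℝ ∞ (fun z => φ (κ.symm z)) (κ x) := by
    rw [← contMDiffAt_iff_contDiffAt]
    refine ContMDiffAt.comp (I' := 𝓘(ℝ, E)) (κ x) (g := φ) (f := κ.symm) ?_ ?_
    · rw [hκx]
      exact contMDiffAt_extChartAt' (by simpa [φ] using hx)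
    · exact (contMDiffOn_extChartAt_symm x).contMDiffAt (extChartAt_target_mem_nhds x)
  have hβ : DifferentiableAt ℝ (α.inChart x₀) (φ (κ.symm (κ x))) := by
    rw [hκx]
    exact ((hα.contDiffOn_inChart x₀).contDiffAt ((isOpen_extChartAt_target x₀).mem_nhds
      (φ.map_source hx))).differentiableAt (by simp)
  -- The transition map between the two charts pulls one chart expression of `α` back to the other.
  have key := dForm_pullback (β := α.inChart x₀) (β' := α.inChart x)
    (τ := fun z => φ (κ.symm z)) hτs hβ ?_ v w
  · rw [α.dval_eq_dForm_self, key, (hτ _ hxκ (by rwa [hκx])).fderiv]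
    have e : ∀ v, chartSymmD x (κ x) v = v := fun v => by
      have := chartSymmD_chartD (mem_extChartAt_source (I := 𝓘(ℝ, E)) x) v
      rwa [chartD_self] at this
    simp only [ContinuousLinearMap.comp_apply, e, hκx]
  · filter_upwards [hnear] with z hz
    ext v
    rw [(hτ z hz.1 hz.2).fderiv]
    simp only [ContinuousLinearMap.comp_apply]
    rw [α.inChart_apply, α.val_eq_inChart hz.2]

end ExtDerivInChart

/-! ### Pointwise contact linear algebra -/

section ContactAlgebra

variable {E : Type*} [NormedAddCommGroup E] [NormedSpace ℝ E]

/-- A linear form `a` and a bilinear form `b` as they occur at the points of a contact manifold. -/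
structure IsContactPair (a : E →L[ℝ] ℝ) (b : E →L[ℝ] E →L[ℝ] ℝ) : Prop where
  ne_zero : a ≠ 0
  alt : ∀ v w, b v w = -b w v
  nondegenerate : ∀ v, a v = 0 → (∀ w, a w = 0 → b v w = 0) → v = 0

/-- The map `v ↦ b(v, ·) + a(v) a`. -/
noncomputable def musical (a : E →L[ℝ] ℝ) (b : E →L[ℝ] E →L[ℝ] ℝ) : E →L[ℝ] E →L[ℝ] ℝ :=
  b + a.smulRight a

lemma musical_apply (a : E →L[ℝ] ℝ) (b : E →L[ℝ] E →L[ℝ] ℝ) (v w : E) :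
    musical a b v w = b v w + a v * a w := by simp [musical]

/-- The Reeb vector. -/
noncomputable def reeb (a : E →L[ℝ] ℝ) (b : E →L[ℝ] E →L[ℝ] ℝ) : E := (musical a b).inverse a

/-- The vector `X` with `a X = h` and `b(X, ·) = -η` on `ker a`. -/
noncomputable def contactVec (a : E →L[ℝ] ℝ) (b : E →L[ℝ] E →L[ℝ] ℝ) (h : ℝ) (η : E →L[ℝ] ℝ) : E :=
  (musical a b).inverse ((h + η (reeb a b)) • a - η)

namespace IsContactPair

variable {a : E →L[ℝ] ℝ} {b : E →L[ℝ] E →L[ℝ] ℝ}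

lemma ext (h : IsContactPair a b) {v v' : E} (h1 : a v = a v')
    (h2 : ∀ w, a w = 0 → b v w = b v' w) : v = v' := by
  refine sub_eq_zero.1 (h.nondegenerate _ (by simp [h1]) fun w hw => by simp [h2 w hw])

variable [FiniteDimensional ℝ E]

/-- Take `e` with `a e = 1`. As `b` is nondegenerate on `ker a`, some `u` in `ker a` represents `b
e` there, and `e - u` is then `b`-orthogonal to `ker a` and, `b` being alternating, to itself. -/
lemma exists_reeb (h : IsContactPair a b) : ∃ R, a R = 1 ∧ ∀ w, b R w = 0 := by
  obtain ⟨w₀, hw₀⟩ : ∃ w, a w ≠ 0 := by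
    by_contra! H
    exact h.ne_zero (ContinuousLinearMap.ext H)
  set e := (a w₀)⁻¹ • w₀
  have he : a e = 1 := by simp [e, hw₀]
  let K := LinearMap.ker a.toLinearMap
  let L : K →ₗ[ℝ] Module.Dual ℝ K :=
    { toFun := fun v => (b v).toLinearMap ∘ₗ K.subtype
      map_add' := fun v w => by ext; simp
      map_smul' := fun c v => by ext; simp }
  have hinj : Function.Injective L := by
    rw [← LinearMap.ker_eq_bot, LinearMap.ker_eq_bot']
    intro v hv
    refine Subtype.ext (h.nondegenerate v v.2 fun w hw => ?_)
    exact LinearMap.congr_fun hv ⟨w, hw⟩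
  have hsurj : Function.Surjective L :=
    (LinearMap.injective_iff_surjective_of_finrank_eq_finrank
      (Subspace.dual_finrank_eq (K := ℝ) (V := K)).symm).1 hinj
  obtain ⟨u, hu⟩ := hsurj ((b e).toLinearMap ∘ₗ K.subtype)
  have hu' : ∀ w, a w = 0 → b u w = b e w := fun w hw => LinearMap.congr_fun hu ⟨w, hw⟩
  have hau : a u = 0 := u.2
  have hself : ∀ v, b v v = 0 := fun v => by have := h.alt v v; linarith
  refine ⟨e - u, by simp [he, hau], fun w => ?_⟩
  have hw : b (e - u) w = b (e - u) (w - a w • (e - u)) := by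
    rw [map_sub (b (e - u)) w, map_smul, hself, smul_zero, sub_zero]
  have h0 : a (w - a w • (e - u)) = 0 := by simp [he, hau]
  rw [hw, map_sub b, sub_apply, hu' _ h0, sub_self]

/-- If `v` is in the kernel, evaluation on the Reeb vector gives `a v = 0`, and nondegeneracy then
gives `v = 0`. Expressing Reeb and contact vectors through this inverse makes their smoothness a
consequence of the smoothness of inversion. -/
lemma musical_isInvertible (h : IsContactPair a b) : (musical a b).IsInvertible := by
  obtain ⟨R, hR, hR'⟩ := h.exists_reeb
  have hinj : Function.Injective (musical a b) := by
    rw [injective_iff_map_eq_zero]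
    intro v hv
    have h1 : ∀ w, b v w + a v * a w = 0 := fun w => by rw [← musical_apply, hv]; rfl
    have h2 : a v = 0 := by
      have := h1 R
      rwa [h.alt, hR', hR, neg_zero, zero_add, mul_one] at this
    exact h.nondegenerate v h2 fun w hw => by simpa [h2] using h1 w
  have hfin : Module.finrank ℝ E = Module.finrank ℝ (E →L[ℝ] ℝ) := by
    rw [← (LinearMap.toContinuousLinearMap (𝕜 := ℝ) (E := E) (F' := ℝ)).finrank_eq]
    exact (Subspace.dual_finrank_eq (K := ℝ) (V := E)).symm
  refine ⟨(LinearEquiv.ofInjectiveOfFinrankEq (musical a b).toLinearMap hinj hfin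
    ).toContinuousLinearEquiv, ?_⟩
  ext v w
  rfl

lemma musical_inverse (h : IsContactPair a b) (η : E →L[ℝ] ℝ) :
    musical a b ((musical a b).inverse η) = η := by
  obtain ⟨e, he⟩ := h.musical_isInvertible
  rw [← he]
  simp

lemma reeb_spec (h : IsContactPair a b) : a (reeb a b) = 1 ∧ ∀ w, b (reeb a b) w = 0 := by
  obtain ⟨R, hR, hR'⟩ := h.exists_reeb
  have : reeb a b = R := by
    have h1 : musical a b R = a := by ext w; simp [musical_apply, hR, hR']
    obtain ⟨e, he⟩ := h.musical_isInvertible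
    rw [reeb, ← he, ContinuousLinearMap.inverse_equiv]
    rw [← he] at h1
    exact (e.symm_apply_eq).2 h1.symm
  rw [this]
  exact ⟨hR, hR'⟩

/-- Evaluating the defining equation on the Reeb vector isolates `a X = c`; what remains is the
formula for `b X` on all vectors, not only on `ker a`. -/
lemma contactVec_spec (h : IsContactPair a b) (c : ℝ) (η : E →L[ℝ] ℝ) :
    a (contactVec a b c η) = c ∧
      ∀ w, b (contactVec a b c η) w = η (reeb a b) * a w - η w := by
  obtain ⟨hR, hR'⟩ := h.reeb_spec
  have key : ∀ w, b (contactVec a b c η) w + a (contactVec a b c η) * a w =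
      (c + η (reeb a b)) * a w - η w := fun w => by
    rw [← musical_apply, contactVec, h.musical_inverse]; simp
  have h1 : a (contactVec a b c η) = c := by
    have := key (reeb a b)
    rw [h.alt, hR', hR] at this
    linarith
  refine ⟨h1, fun w => ?_⟩
  have := key w
  rw [h1] at this
  linarith

/-- Only the restriction to `ker a` needs checking. This recognises the contact field both in other
charts and as the velocity of an isotopy. -/
lemma eq_contactVec (h : IsContactPair a b) {c : ℝ} {η : E →L[ℝ] ℝ} {v : E} (h1 : a v = c)
    (h2 : ∀ w, a w = 0 → b v w = -η w) : v = contactVec a b c η := by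
  obtain ⟨h3, h4⟩ := h.contactVec_spec c η
  exact h.ext (h1.trans h3.symm) fun w hw => by rw [h2 w hw, h4, hw]; ring

end IsContactPair

set_option synthInstance.maxHeartbeats 200000 in
lemma contDiffOn_musical_inverse [FiniteDimensional ℝ E] {P : Type*} [NormedAddCommGroup P]
    [NormedSpace ℝ P] {a : P → E →L[ℝ] ℝ} {b : P → E →L[ℝ] E →L[ℝ] ℝ} {s : Set P}
    (ha : ContDiffOn ℝ ∞ a s) (hb : ContDiffOn ℝ ∞ b s) (h : ∀ p ∈ s, IsContactPair (a p) (b p)) :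
    ContDiffOn ℝ ∞ (fun p => (musical (a p) (b p)).inverse) s := by
  have : CompleteSpace E := FiniteDimensional.complete ℝ E
  have h1 : ContDiffOn ℝ ∞ (fun p => musical (a p) (b p)) s := hb.add (ha.smulRight ha)
  intro p hp
  exact ((h p hp).musical_isInvertible.contDiffAt_map_inverse).comp_contDiffWithinAt p (h1 p hp)

set_option synthInstance.maxHeartbeats 200000 in
lemma contDiffOn_reeb [FiniteDimensional ℝ E] {P : Type*} [NormedAddCommGroup P]
    [NormedSpace ℝ P] {a : P → E →L[ℝ] ℝ} {b : P → E →L[ℝ] E →L[ℝ] ℝ} {s : Set P}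
    (ha : ContDiffOn ℝ ∞ a s) (hb : ContDiffOn ℝ ∞ b s) (h : ∀ p ∈ s, IsContactPair (a p) (b p)) :
    ContDiffOn ℝ ∞ (fun p => reeb (a p) (b p)) s :=
  (contDiffOn_musical_inverse ha hb h).clm_apply ha

set_option synthInstance.maxHeartbeats 200000 in
lemma contDiffOn_contactVec [FiniteDimensional ℝ E] {P : Type*} [NormedAddCommGroup P]
    [NormedSpace ℝ P] {a : P → E →L[ℝ] ℝ} {b : P → E →L[ℝ] E →L[ℝ] ℝ} {c : P → ℝ}
    {η : P → E →L[ℝ] ℝ} {s : Set P}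
    (ha : ContDiffOn ℝ ∞ a s) (hb : ContDiffOn ℝ ∞ b s) (h : ∀ p ∈ s, IsContactPair (a p) (b p))
    (hc : ContDiffOn ℝ ∞ c s) (hη : ContDiffOn ℝ ∞ η s) :
    ContDiffOn ℝ ∞ (fun p => contactVec (a p) (b p) (c p) (η p)) s :=
  (contDiffOn_musical_inverse ha hb h).clm_apply
    (((hc.add (hη.clm_apply (contDiffOn_reeb ha hb h))).smul ha).sub hη)

end ContactAlgebra

/-! ### Commuting time and space derivatives -/

section MixedDerivative

variable {G H : Type*} [NormedAddCommGroup G] [NormedSpace ℝ G] [NormedAddCommGroup H]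
  [NormedSpace ℝ H]

lemma uniqueDiffOn_Icc_inter {O : Set ℝ} (hO : IsOpen O) : UniqueDiffOn ℝ (Icc (0 : ℝ) 1 ∩ O) :=
  (uniqueDiffOn_Icc zero_lt_one).inter hO

lemma Icc_inter_subset_closure_interior {O : Set ℝ} (hO : IsOpen O) :
    Icc (0 : ℝ) 1 ∩ O ⊆ closure (interior (Icc (0 : ℝ) 1 ∩ O)) := by
  rw [interior_inter, hO.interior_eq, interior_Icc, inter_comm, inter_comm _ O,
    ← closure_Ioo (zero_ne_one (α := ℝ))]
  exact hO.inter_closure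

/-- Symmetry of the second derivative within `T ×ˢ Ω`. It extends to the endpoints of `T` because
every point of `T` is a limit of interior points. -/
lemma hasDerivWithinAt_fderiv_snd {f : ℝ × G → H} {T : Set ℝ} (hT : UniqueDiffOn ℝ T)
    (hT' : T ⊆ closure (interior T)) {Ω : Set G} (hΩ : IsOpen Ω) (hf : ContDiffOn ℝ ∞ f (T ×ˢ Ω))
    {t : ℝ} (ht : t ∈ T) {y : G} (hy : y ∈ Ω) (v : G) :
    HasDerivWithinAt (fun t => fderiv ℝ (fun y => f (t, y)) y v)
      (fderiv ℝ (fun y => derivWithin (fun t => f (t, y)) T t) y v) T t := by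
  have hS : UniqueDiffOn ℝ (T ×ˢ Ω) := hT.prod hΩ.uniqueDiffOn
  have hD : ContDiffOn ℝ ∞ (fderivWithin ℝ f (T ×ˢ Ω)) (T ×ˢ Ω) := hf.fderivWithin hS (by simp)
  have h1 := (hasDerivWithinAt_fst hD ht hy).clm_apply
    (hasDerivWithinAt_const t T ((0 : ℝ), v))
  have h2 := (hasFDerivAt_snd hΩ hD ht hy).clm_apply (hasFDerivAt_const ((1 : ℝ), (0 : G)) y)
  have hsymm : IsSymmSndFDerivWithinAt ℝ f (T ×ˢ Ω) (t, y) :=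
    (hf (t, y) ⟨ht, hy⟩).isSymmSndFDerivWithinAt (by
      simp only [minSmoothness_of_isRCLikeNormedField]
      exact WithTop.coe_le_coe.2 (le_top : (2 : ℕ∞) ≤ ⊤)) hS (by
        rw [interior_prod_eq, closure_prod_eq, hΩ.interior_eq]
        exact ⟨hT' ht, subset_closure hy⟩) ⟨ht, hy⟩
  have e2 : fderiv ℝ (fun y => derivWithin (fun t => f (t, y)) T t) y v =
      fderivWithin ℝ (fderivWithin ℝ f (T ×ˢ Ω)) (T ×ˢ Ω) (t, y) (0, v) (1, 0) := by
    have : (fun y => derivWithin (fun t => f (t, y)) T t) =ᶠ[𝓝 y]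
        fun y => fderivWithin ℝ f (T ×ˢ Ω) (t, y) (1, 0) := by
      filter_upwards [hΩ.mem_nhds hy] with z hz
      exact (hasDerivWithinAt_fst hf ht hz).derivWithin (hT t ht)
    rw [this.fderiv_eq, h2.fderiv]
    simp
  rw [e2, hsymm]
  refine (h1.congr (fun s hs => ?_) ?_).congr_deriv (by simp)
  · rw [(hasFDerivAt_snd hΩ hf hs hy).fderiv]; simp
  · rw [(hasFDerivAt_snd hΩ hf ht hy).fderiv]; simp

end MixedDerivative

/-! ### Contact vector fields of Hamiltonians -/

section ContactFieldSupport

variable {E : Type*} [NormedAddCommGroup E] [NormedSpace ℝ E]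
  {M : Type*} [TopologicalSpace M] [ChartedSpace E M]

/-- The differential of a function at a point, as a linear form on the model space. -/
noncomputable def scalarD (h : M → ℝ) (x : M) : E →L[ℝ] ℝ := mfderiv 𝓘(ℝ, E) 𝓘(ℝ, ℝ) h x

/-- The contact vector field of the time-dependent Hamiltonian `H`. -/
noncomputable def contactField (α : OneForm E M) (H : ℝ → M → ℝ) (t : ℝ) (x : M) : E :=
  contactVec (α.val x) (α.dval x) (H t x) (scalarD (H t) x)

lemma contactVec_zero (a : E →L[ℝ] ℝ) (b : E →L[ℝ] E →L[ℝ] ℝ) : contactVec a b 0 0 = 0 := by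
  simp [contactVec]

lemma contactField_eq_zero {α : OneForm E M} {H : ℝ → M → ℝ} [T2Space M] {K : Set M} (hK : IsCompact K) {t : ℝ}
    (hHK : ∀ x ∉ K, H t x = 0) {x : M} (hx : x ∉ K) : contactField α H t x = 0 := by
  have h1 : mfderiv 𝓘(ℝ, E) 𝓘(ℝ, ℝ) (H t) x = mfderiv 𝓘(ℝ, E) 𝓘(ℝ, ℝ) (fun _ => (0 : ℝ)) x := by
    refine Filter.EventuallyEq.mfderiv_eq ?_
    filter_upwards [hK.isClosed.isOpen_compl.mem_nhds hx] with z hz using hHK z hz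
  rw [contactField, scalarD, hHK x hx, h1, mfderiv_const]
  exact contactVec_zero _ _

end ContactFieldSupport

section ContactField

variable {E : Type*} [NormedAddCommGroup E] [NormedSpace ℝ E]
  {M : Type*} [TopologicalSpace M] [ChartedSpace E M] [IsManifold 𝓘(ℝ, E) ∞ M]

lemma IsContactForm.isContactPair {α : OneForm E M} (hα : IsContactForm α) (x : M) :
    IsContactPair (α.val x) (α.dval x) where
  ne_zero := hα.ne_zero x
  alt v w := by rw [α.dval_eq_dForm_self, α.dval_eq_dForm_self, dForm_swap]
  nondegenerate := hα.nondegenerate x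

lemma IsContactForm.isContactPair_inChart {α : OneForm E M} (hα : IsContactForm α) {x₀ : M} {y : E}
    (hy : y ∈ (extChartAt 𝓘(ℝ, E) x₀).target) :
    IsContactPair (α.inChart x₀ y) (dForm (α.inChart x₀) y) := by
  set e := extChartAt 𝓘(ℝ, E) x₀
  have hx : e.symm y ∈ e.source := e.map_target hy
  have h := hα.isContactPair (e.symm y)
  have hA : ∀ v, chartD x₀ (e.symm y) (chartSymmD x₀ y v) = v := chartD_chartSymmD hy
  have hd : ∀ v w, dForm (α.inChart x₀) y v w =
      α.dval (e.symm y) (chartSymmD x₀ y v) (chartSymmD x₀ y w) := fun v w => by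
    rw [hα.smooth.dval_eq_dForm hx, hA, hA, e.right_inv hy]
  have hB : ∀ v, chartSymmD x₀ y (chartD x₀ (e.symm y) v) = v := fun v => by
    have := chartSymmD_chartD hx v
    rwa [e.right_inv hy] at this
  refine ⟨fun h0 => h.ne_zero ?_, dForm_swap _ _, fun v hv hw => ?_⟩
  · ext v
    rw [α.val_eq_inChart hx, e.right_inv hy, h0]; rfl
  · have h1 : chartSymmD x₀ y v = 0 := h.nondegenerate _ hv fun w hw' => by
      have := hw (chartD x₀ (e.symm y) w) (by rw [α.inChart_apply, hB]; exact hw')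
      rwa [hd, hB] at this
    rw [← hA v, h1, map_zero]

/-- The Hamiltonian `H` in a chart. -/
noncomputable def hamInChart (H : ℝ → M → ℝ) (x₀ : M) (p : ℝ × E) : ℝ :=
  H p.1 ((extChartAt 𝓘(ℝ, E) x₀).symm p.2)

/-- The time-dependent function `H` is smooth on `[0,1] × M`. -/
def IsSmoothHam (H : ℝ → M → ℝ) : Prop :=
  ContMDiffOn (𝓘(ℝ, ℝ).prod 𝓘(ℝ, E)) 𝓘(ℝ, ℝ) ∞ (fun p : ℝ × M => H p.1 p.2) (Icc 0 1 ×ˢ univ)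

lemma IsSmoothHam.contDiffOn {H : ℝ → M → ℝ} (hH : IsSmoothHam (E := E) H) (x₀ : M) :
    ContDiffOn ℝ ∞ (hamInChart (E := E) H x₀) (Icc 0 1 ×ˢ (extChartAt 𝓘(ℝ, E) x₀).target) := by
  have := contDiffOn_inCharts hH x₀ (0 : ℝ)
    (S' := Icc 0 1 ×ˢ (extChartAt 𝓘(ℝ, E) x₀).target)
    fun q hq => ⟨hq.2, ⟨hq.1, mem_univ _⟩, by
      rw [extChartAt_model_space_eq_id]; exact mem_univ _⟩
  rw [extChartAt_model_space_eq_id] at this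
  exact this

lemma IsSmoothHam.fderiv_hamInChart {H : ℝ → M → ℝ} (hH : IsSmoothHam (E := E) H) {x₀ : M} {t : ℝ}
    (ht : t ∈ Icc (0 : ℝ) 1) {y : E} (hy : y ∈ (extChartAt 𝓘(ℝ, E) x₀).target) (w : E) :
    fderiv ℝ (fun y => hamInChart H x₀ (t, y)) y w =
      (scalarD (E := E) (H t) ((extChartAt 𝓘(ℝ, E) x₀).symm y))
        (chartSymmD x₀ y w) := by
  have h1 : ContMDiff 𝓘(ℝ, E) 𝓘(ℝ, ℝ) ∞ (H t) := by
    rw [← contMDiffOn_univ]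
    exact hH.comp (contMDiffOn_const.prodMk contMDiffOn_id) fun x _ => ⟨ht, mem_univ _⟩
  have h2 := ((h1 ((extChartAt 𝓘(ℝ, E) x₀).symm y)).mdifferentiableAt
    (by simp)).hasMFDerivAt.comp y (hasMFDerivAt_chart_symm hy)
  have h3 : HasFDerivAt (fun y => hamInChart H x₀ (t, y))
      ((scalarD (E := E) (H t) ((extChartAt 𝓘(ℝ, E) x₀).symm y)).comp
        (chartSymmD x₀ y)) y := hasMFDerivAt_iff_hasFDerivAt.1 h2
  rw [h3.fderiv]
  rfl

variable [FiniteDimensional ℝ E] {α : OneForm E M} {H : ℝ → M → ℝ}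

/-- The two equations that characterise the contact vector are natural under charts, so the chart
expression of the field is the contact vector of the chart expressions. Smoothness of the field
follows. -/
lemma fieldInChart_contactField (hα : IsContactForm α) (hH : IsSmoothHam (E := E) H) {x₀ : M} {t : ℝ}
    (ht : t ∈ Icc (0 : ℝ) 1) {y : E} (hy : y ∈ (extChartAt 𝓘(ℝ, E) x₀).target) :
    fieldInChart (contactField α H) x₀ (t, y) = contactVec (α.inChart x₀ y) (dForm (α.inChart x₀) y)
      (hamInChart H x₀ (t, y)) (fderiv ℝ (fun y => hamInChart H x₀ (t, y)) y) := by
  set e := extChartAt 𝓘(ℝ, E) x₀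
  have hx : e.symm y ∈ e.source := e.map_target hy
  obtain ⟨h1, h2⟩ := (hα.isContactPair (e.symm y)).contactVec_spec (H t (e.symm y))
    (scalarD (H t) (e.symm y))
  refine (hα.isContactPair_inChart hy).eq_contactVec ?_ fun w hw => ?_
  · rw [fieldInChart, ← e.right_inv hy, e.left_inv hx, ← α.val_eq_inChart hx, e.right_inv hy]
    exact h1
  · rw [hH.fderiv_hamInChart ht hy]
    have h3 := h2 (chartSymmD x₀ y w)
    rw [← α.inChart_apply, hw, mul_zero, zero_sub, hα.smooth.dval_eq_dForm hx,
      chartD_chartSymmD hy, e.right_inv hy] at h3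
    exact h3

lemma contDiff_clm_flip {G H K : Type*} [NormedAddCommGroup G] [NormedSpace ℝ G]
    [NormedAddCommGroup H] [NormedSpace ℝ H] [NormedAddCommGroup K] [NormedSpace ℝ K] :
    ContDiff ℝ ∞ (fun B : G →L[ℝ] H →L[ℝ] K => B.flip) :=
  IsBoundedLinearMap.contDiff (𝕜 := ℝ) (f := fun B : G →L[ℝ] H →L[ℝ] K => B.flip)
    ⟨⟨fun _ _ => rfl, fun _ _ => rfl⟩, 1, one_pos, fun x => by simp⟩

lemma contDiffOn_dForm {G : Type*} [NormedAddCommGroup G] [NormedSpace ℝ G] {β : G → G →L[ℝ] ℝ}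
    {U : Set G} (hU : IsOpen U) (hβ : ContDiffOn ℝ ∞ β U) : ContDiffOn ℝ ∞ (dForm β) U := by
  have h1 : ContDiffOn ℝ ∞ (fderiv ℝ β) U := hβ.fderiv_of_isOpen hU (by simp)
  exact h1.sub (contDiff_clm_flip.comp_contDiffOn h1)

lemma isSmoothField_contactField (hα : IsContactForm α) (hH : IsSmoothHam (E := E) H) :
    IsSmoothField (contactField α H) := by
  intro x₀
  have ho := isOpen_extChartAt_target (I := 𝓘(ℝ, E)) x₀
  have hβ := hα.smooth.contDiffOn_inChart x₀
  have hsnd : MapsTo (Prod.snd : ℝ × E → E) (Icc (0 : ℝ) 1 ×ˢ (extChartAt 𝓘(ℝ, E) x₀).target)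
    (extChartAt 𝓘(ℝ, E) x₀).target := fun p hp => hp.2
  refine (contDiffOn_contactVec (hβ.comp contDiffOn_snd hsnd)
    ((contDiffOn_dForm ho hβ).comp contDiffOn_snd hsnd)
    (fun p hp => hα.isContactPair_inChart hp.2) (hH.contDiffOn x₀)
    (contDiffOn_fderiv_snd (uniqueDiffOn_Icc zero_lt_one) ho (hH.contDiffOn x₀))).congr ?_
  rintro ⟨t, y⟩ hp
  exact fieldInChart_contactField hα hH hp.1 hp.2

end ContactField

/-! ### Evolution of the contact form along a contact flow -/

section FlowContact

/-- The differential inequality comes from charts that change with time, so its constants are only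
local; compactness of `[0,1]` provides one constant, and Grönwall concludes. -/
lemma eq_zero_of_norm_deriv_le {g : ℝ → ℝ}
    (hg : ∀ t₀ ∈ Icc (0 : ℝ) 1, ∃ C : ℝ, ∀ᶠ t in 𝓝[Icc 0 1] t₀, ∃ g', HasDerivWithinAt g g' (Icc 0 1) t ∧
      ‖g'‖ ≤ C * ‖g t‖) (h0 : g 0 = 0) {t : ℝ} (ht : t ∈ Icc (0 : ℝ) 1) : g t = 0 := by
  obtain ⟨C, hC⟩ : ∃ C : ℝ, ∀ t ∈ Icc (0 : ℝ) 1, ∃ g', HasDerivWithinAt g g' (Icc 0 1) t ∧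
      ‖g'‖ ≤ C * ‖g t‖ := by
    refine isCompact_Icc.induction_on (p := fun S => ∃ C : ℝ, ∀ t ∈ S, ∃ g',
      HasDerivWithinAt g g' (Icc 0 1) t ∧ ‖g'‖ ≤ C * ‖g t‖) ⟨0, by simp⟩ ?_ ?_ ?_
    · rintro s t hst ⟨C, hC⟩
      exact ⟨C, fun x hx => hC x (hst hx)⟩
    · rintro s t ⟨C, hC⟩ ⟨C', hC'⟩
      refine ⟨max C C', ?_⟩
      rintro x (hx | hx)
      · obtain ⟨g', h1, h2⟩ := hC x hx
        exact ⟨g', h1, h2.trans (mul_le_mul_of_nonneg_right (le_max_left _ _) (norm_nonneg _))⟩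
      · obtain ⟨g', h1, h2⟩ := hC' x hx
        exact ⟨g', h1, h2.trans (mul_le_mul_of_nonneg_right (le_max_right _ _) (norm_nonneg _))⟩
    · intro t₀ ht₀
      obtain ⟨C, hC⟩ := hg t₀ ht₀
      exact ⟨_, hC, C, fun t ht => ht⟩
  choose! g' h1 h2 using hC
  have := norm_le_of_norm_deriv_le (f := g) (f' := g') (K := max C 0) (ε := 0) (le_max_right _ _) le_rfl
    (left_mem_Icc.2 zero_le_one) h1 (fun t ht => by
      rw [add_zero]
      exact (h2 t ht).trans (mul_le_mul_of_nonneg_right (le_max_left _ _) (norm_nonneg _))) ht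
  rw [h0, norm_zero, add_zero, zero_mul] at this
  exact norm_le_zero_iff.1 this

/-- The evolution of `α` along the linearised flow of a contact vector field, in a chart. -/
lemma hasDerivWithinAt_pullback_of_solution {G P : Type*} [NormedAddCommGroup G] [NormedSpace ℝ G]
    [FiniteDimensional ℝ G] [NormedAddCommGroup P] [NormedSpace ℝ P]
    {β : G → G →L[ℝ] ℝ} {Ω : Set G} (hΩ : IsOpen Ω) (hβ : ContDiffOn ℝ ∞ β Ω)
    (hpair : ∀ y ∈ Ω, IsContactPair (β y) (dForm β y))
    {T : Set ℝ} (hT : UniqueDiffOn ℝ T) (hT' : T ⊆ closure (interior T))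
    {h : ℝ × G → ℝ}
    {X : ℝ × G → G} (hX : ContDiffOn ℝ ∞ X (T ×ˢ Ω))
    (hXh : ∀ t ∈ T, ∀ y ∈ Ω, X (t, y) =
      contactVec (β y) (dForm β y) (h (t, y)) (fderiv ℝ (fun y => h (t, y)) y))
    {φ : ℝ × P → G} {U : Set P} (hU : IsOpen U) (hφ : ContDiffOn ℝ ∞ φ (T ×ˢ U))
    (hφΩ : ∀ t ∈ T, ∀ u ∈ U, φ (t, u) ∈ Ω)
    (hφX : ∀ t ∈ T, ∀ u ∈ U, HasDerivWithinAt (fun t => φ (t, u)) (X (t, φ (t, u))) T t)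
    {t : ℝ} (ht : t ∈ T) {u : P} (hu : u ∈ U) (v : P) :
    HasDerivWithinAt (fun t => β (φ (t, u)) (fderiv ℝ (fun u => φ (t, u)) u v))
      (fderiv ℝ (fun y => h (t, y)) (φ (t, u)) (reeb (β (φ (t, u))) (dForm β (φ (t, u)))) *
        β (φ (t, u)) (fderiv ℝ (fun u => φ (t, u)) u v)) T t := by
  set y := φ (t, u) with hy
  have hyΩ : y ∈ Ω := hφΩ t ht u hu
  set w := fderiv ℝ (fun u => φ (t, u)) u v
  have hβd : HasFDerivAt β (fderiv ℝ β y) y :=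
    ((hβ.contDiffAt (hΩ.mem_nhds hyΩ)).differentiableAt (by simp)).hasFDerivAt
  have hXd : HasFDerivAt (fun z => X (t, z)) (fderiv ℝ (fun z => X (t, z)) y) y :=
    (hasFDerivAt_snd hΩ hX ht hyΩ).differentiableAt.hasFDerivAt
  have hφd : HasFDerivAt (fun u => φ (t, u)) (fderiv ℝ (fun u => φ (t, u)) u) u :=
    (hasFDerivAt_snd hU hφ ht hu).differentiableAt.hasFDerivAt
  have h1 : HasDerivWithinAt (fun t => β (φ (t, u))) (fderiv ℝ β y (X (t, y))) T t :=
    hβd.comp_hasDerivWithinAt t (hφX t ht u hu)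
  have h2 := hasDerivWithinAt_fderiv_snd hT hT' hU hφ ht hu v
  have h3 : fderiv ℝ (fun u => derivWithin (fun t => φ (t, u)) T t) u v =
      fderiv ℝ (fun z => X (t, z)) y w := by
    have : (fun u => derivWithin (fun t => φ (t, u)) T t) =ᶠ[𝓝 u] fun u => X (t, φ (t, u)) := by
      filter_upwards [hU.mem_nhds hu] with z hz
      exact (hφX t ht z hz).derivWithin (hT t ht)
    have hcomp : HasFDerivAt (fun u => X (t, φ (t, u)))
        ((fderiv ℝ (fun z => X (t, z)) y).comp (fderiv ℝ (fun u => φ (t, u)) u)) u :=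
      HasFDerivAt.comp (g := fun z => X (t, z)) u hXd hφd
    rw [this.fderiv_eq, hcomp.fderiv]
    rfl
  rw [h3] at h2
  refine (h1.clm_apply h2).congr_deriv ?_
  -- The derivative of the identity `β(X) = h`. Together with `dβ(X, ·) = dh(R) β - dh` it yields
  -- `L_X β = d(β(X)) + dβ(X, ·) = dh(R) β`.
  have h4 : fderiv ℝ β y w (X (t, y)) + β y (fderiv ℝ (fun z => X (t, z)) y w) =
      fderiv ℝ (fun y => h (t, y)) y w := by
    have e : (fun z => β z (X (t, z))) =ᶠ[𝓝 y] fun z => h (t, z) := by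
      filter_upwards [hΩ.mem_nhds hyΩ] with z hz
      rw [hXh t ht z hz, ((hpair z hz).contactVec_spec _ _).1]
    rw [← e.fderiv_eq, (hβd.clm_apply hXd).fderiv]
    simp [add_comm]
  have h5 := ((hpair y hyΩ).contactVec_spec (h (t, y)) (fderiv ℝ (fun y => h (t, y)) y)).2 w
  rw [← hXh t ht y hyΩ, dForm_apply] at h5
  linarith

end FlowContact

/-! ### Differentials of families of maps in charts -/

section MapsInCharts

variable {E : Type*} [NormedAddCommGroup E] [NormedSpace ℝ E]
  {M : Type*} [TopologicalSpace M] [ChartedSpace E M]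
  {F : Type*} [NormedAddCommGroup F] [NormedSpace ℝ F]
  {N : Type*} [TopologicalSpace N] [ChartedSpace F N]

/-- The differential of a map of manifolds, as a linear map of the model spaces. -/
noncomputable def mapD (f : N → M) (p : N) : F →L[ℝ] E := mfderiv 𝓘(ℝ, F) 𝓘(ℝ, E) f p

lemma mdifferentiableAt_of_contMDiffOn {f : ℝ → N → M}
    (hf : ContMDiffOn (𝓘(ℝ, ℝ).prod 𝓘(ℝ, F)) 𝓘(ℝ, E) ∞ (fun p : ℝ × N => f p.1 p.2)
      (Icc 0 1 ×ˢ univ)) {t : ℝ} (ht : t ∈ Icc (0 : ℝ) 1) (p : N) :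
    MDifferentiableAt 𝓘(ℝ, F) 𝓘(ℝ, E) (f t) p := by
  have h1 : ContMDiff 𝓘(ℝ, F) 𝓘(ℝ, E) ∞ (f t) := by
    rw [← contMDiffOn_univ]
    exact hf.comp (contMDiffOn_const.prodMk contMDiffOn_id) fun x _ => ⟨ht, mem_univ _⟩
  exact (h1 p).mdifferentiableAt (by simp)

variable [IsManifold 𝓘(ℝ, E) ∞ M] [IsManifold 𝓘(ℝ, F) ∞ N]

lemma chartSymmD_self (x : M) (v : E) : chartSymmD x (extChartAt 𝓘(ℝ, E) x x) v = v := by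
  have := chartSymmD_chartD (mem_extChartAt_source (I := 𝓘(ℝ, E)) x) v
  rwa [chartD_self] at this

lemma hasFDerivAt_inCharts {f : N → M} {p₀ : N} {x₀ : M} {u : F}
    (hu : u ∈ (extChartAt 𝓘(ℝ, F) p₀).target)
    (hf : MDifferentiableAt 𝓘(ℝ, F) 𝓘(ℝ, E) f ((extChartAt 𝓘(ℝ, F) p₀).symm u))
    (hx : f ((extChartAt 𝓘(ℝ, F) p₀).symm u) ∈ (extChartAt 𝓘(ℝ, E) x₀).source) :
    HasFDerivAt (fun u => extChartAt 𝓘(ℝ, E) x₀ (f ((extChartAt 𝓘(ℝ, F) p₀).symm u)))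
      ((chartD x₀ (f ((extChartAt 𝓘(ℝ, F) p₀).symm u))).comp
        ((mapD (E := E) f ((extChartAt 𝓘(ℝ, F) p₀).symm u)).comp (chartSymmD p₀ u))) u :=
  hasMFDerivAt_iff_hasFDerivAt.1
    (((hasMFDerivAt_chart hx).comp _ hf.hasMFDerivAt).comp u (hasMFDerivAt_chart_symm hu))

variable {f : ℝ → N → M}

lemma exists_nhds_inCharts
    (hf : ContMDiffOn (𝓘(ℝ, ℝ).prod 𝓘(ℝ, F)) 𝓘(ℝ, E) ∞ (fun p : ℝ × N => f p.1 p.2)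
      (Icc 0 1 ×ˢ univ)) {t₀ : ℝ} (ht₀ : t₀ ∈ Icc (0 : ℝ) 1) {p₀ : N} {x₀ : M}
    (hx : f t₀ p₀ ∈ (extChartAt 𝓘(ℝ, E) x₀).source) :
    ∃ O, IsOpen O ∧ t₀ ∈ O ∧ ∃ U, IsOpen U ∧ extChartAt 𝓘(ℝ, F) p₀ p₀ ∈ U ∧
      U ⊆ (extChartAt 𝓘(ℝ, F) p₀).target ∧
      (∀ t ∈ Icc 0 1 ∩ O, ∀ u ∈ U, f t ((extChartAt 𝓘(ℝ, F) p₀).symm u) ∈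
        (extChartAt 𝓘(ℝ, E) x₀).source) ∧
      ContDiffOn ℝ ∞ (fun q : ℝ × F =>
        extChartAt 𝓘(ℝ, E) x₀ (f q.1 ((extChartAt 𝓘(ℝ, F) p₀).symm q.2)))
        ((Icc 0 1 ∩ O) ×ˢ U) := by
  set l := extChartAt 𝓘(ℝ, F) p₀
  have hc : ContinuousOn (fun q : ℝ × F => f q.1 (l.symm q.2)) (Icc 0 1 ×ˢ l.target) :=
    hf.continuousOn.comp (continuousOn_fst.prodMk ((continuousOn_extChartAt_symm p₀).comp
      continuousOn_snd fun q hq => hq.2)) fun q hq => ⟨hq.1, mem_univ _⟩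
  have hu₀ : l p₀ ∈ l.target := mem_extChartAt_target p₀
  have h1 := (hc (t₀, l p₀) ⟨ht₀, hu₀⟩).preimage_mem_nhdsWithin
    ((isOpen_extChartAt_source x₀).mem_nhds (by rwa [extChartAt_to_inv]))
  rw [nhdsWithin_prod_eq, (isOpen_extChartAt_target p₀).nhdsWithin_eq hu₀] at h1
  obtain ⟨A, hA, B, hB, hAB⟩ := Filter.mem_prod_iff.1 h1
  obtain ⟨O, hO, htO, hOA⟩ := mem_nhdsWithin.1 hA
  obtain ⟨U, hUB, hU, huU⟩ := _root_.mem_nhds_iff.1 (inter_mem hB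
    ((isOpen_extChartAt_target p₀).mem_nhds hu₀))
  have h2 : ∀ t ∈ Icc 0 1 ∩ O, ∀ u ∈ U, f t (l.symm u) ∈ (extChartAt 𝓘(ℝ, E) x₀).source :=
    fun t ht u hu => hAB (show (t, u) ∈ A ×ˢ B from ⟨hOA ⟨ht.2, ht.1⟩, (hUB hu).1⟩)
  exact ⟨O, hO, htO, U, hU, huU, fun u hu => (hUB hu).2, h2, contDiffOn_inCharts hf p₀ x₀
    fun q hq => ⟨(hUB hq.2).2, ⟨hq.1.1, mem_univ _⟩, h2 q.1 hq.1 q.2 hq.2⟩⟩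

end MapsInCharts

/-! ### From a Hamiltonian to a contact isotopy -/

section ContactFlow

variable {E : Type*} [NormedAddCommGroup E] [NormedSpace ℝ E] [FiniteDimensional ℝ E]
  {M : Type*} [TopologicalSpace M] [ChartedSpace E M] [IsManifold 𝓘(ℝ, E) ∞ M]
  {α : OneForm E M} {H : ℝ → M → ℝ} {φ : ℝ → M → M}

/-- The function `t ↦ α(Tφ_t v)` satisfies the scalar linear equation `g' = dH_t(R) g` and starts at
zero. In a chart around `φ t₀ x` the coefficient is continuous in time, hence bounded near `t₀`. -/
lemma val_mapD_eq_zero_of_flow (hα : IsContactForm α) (hH : IsSmoothHam (E := E) H)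
    (hφ : ContMDiffOn (𝓘(ℝ, ℝ).prod 𝓘(ℝ, E)) 𝓘(ℝ, E) ∞ (fun p : ℝ × M => φ p.1 p.2)
      (Icc 0 1 ×ˢ univ)) (hφ0 : ∀ x, φ 0 x = x)
    (hφX : ∀ x, ∀ t ∈ Icc (0 : ℝ) 1, HasVelocity (φ · x) (contactField α H t (φ t x)) (Icc 0 1) t)
    {x : M} {v : E} (hv : α.val x v = 0) {t : ℝ} (ht : t ∈ Icc (0 : ℝ) 1) :
    α.val (φ t x) (mapD (φ t) x v) = 0 := by
  refine eq_zero_of_norm_deriv_le (g := fun t => α.val (φ t x) (mapD (φ t) x v)) ?_ ?_ ht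
  · intro t₀ ht₀
    set x₀ := φ t₀ x with hx₀
    set e := extChartAt 𝓘(ℝ, E) x₀
    set l := extChartAt 𝓘(ℝ, E) x
    obtain ⟨O, hO, htO, U, hU, hxU, hUl, hφs, hφc⟩ := exists_nhds_inCharts hφ ht₀ (p₀ := x)
      (x₀ := x₀) (mem_extChartAt_source _)
    set T := Icc (0 : ℝ) 1 ∩ O
    have hTs : T ×ˢ e.target ⊆ Icc 0 1 ×ˢ e.target := prod_mono_left inter_subset_left
    set Φ : ℝ × E → E := fun q => e (φ q.1 (l.symm q.2))
    have hΦt : ∀ t ∈ T, ∀ u ∈ U, Φ (t, u) ∈ e.target := fun t ht u hu =>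
      e.map_source (hφs t ht u hu)
    have hΦX : ∀ t ∈ T, ∀ u ∈ U, HasDerivWithinAt (fun t => Φ (t, u))
        (fieldInChart (contactField α H) x₀ (t, Φ (t, u))) T t := fun t ht u hu =>
      ((hφX (l.symm u) t ht.1).fieldInChart (hφs t ht u hu)).mono inter_subset_left
    have hβ := hα.smooth.contDiffOn_inChart x₀
    have hT := uniqueDiffOn_Icc_inter hO
    have main := fun t (ht : t ∈ T) => hasDerivWithinAt_pullback_of_solution
      (isOpen_extChartAt_target x₀) hβ (fun y hy => hα.isContactPair_inChart hy)
      hT (Icc_inter_subset_closure_interior hO) ((isSmoothField_contactField hα hH x₀).mono hTs)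
      (fun t ht y hy => fieldInChart_contactField hα hH ht.1 hy) hU hφc hΦt hΦX ht hxU v
    have hg : ∀ t ∈ T, α.val (φ t x) (mapD (φ t) x v) =
        α.inChart x₀ (Φ (t, l x)) (fderiv ℝ (fun u => Φ (t, u)) (l x) v) := by
      intro t ht
      have hlx : l.symm (l x) = x := extChartAt_to_inv x
      have h1 := (hasFDerivAt_inCharts (x₀ := x₀) (hUl hxU)
        (mdifferentiableAt_of_contMDiffOn hφ ht.1 _) (hφs t ht _ hxU)).fderiv
      rw [h1]
      have h2 := hφs t ht _ hxU
      simp only [ContinuousLinearMap.comp_apply]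
      rw [chartSymmD_self, hlx]
      rw [hlx] at h2
      simp only [Φ]
      rw [hlx, ← α.val_eq_inChart h2]
    have hΦc : ContinuousOn (fun t => Φ (t, l x)) T :=
      hφc.continuousOn.comp (by fun_prop) fun t ht => ⟨ht, hxU⟩
    have hcont : ContinuousOn (fun t => fderiv ℝ (fun y => hamInChart H x₀ (t, y)) (Φ (t, l x))
        (reeb (α.inChart x₀ (Φ (t, l x))) (dForm (α.inChart x₀) (Φ (t, l x))))) T := by
      have h1 := (contDiffOn_fderiv_snd (uniqueDiffOn_Icc zero_lt_one)
        (isOpen_extChartAt_target x₀) (hH.contDiffOn x₀)).continuousOn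
      have h2 := (contDiffOn_reeb hβ (contDiffOn_dForm (isOpen_extChartAt_target x₀) hβ)
        (fun y hy => hα.isContactPair_inChart hy)).continuousOn
      exact (h1.comp (continuousOn_id.prodMk hΦc) fun t ht => ⟨ht.1, hΦt t ht _ hxU⟩).clm_apply
        (h2.comp hΦc fun t ht => hΦt t ht _ hxU)
    have hTnhds : ∀ t ∈ T, T ∈ 𝓝[Icc 0 1] t := fun t ht => inter_mem_nhdsWithin _ (hO.mem_nhds ht.2)
    obtain ⟨C, hbd⟩ : ∃ C, ∀ᶠ t in 𝓝[Icc 0 1] t₀,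
        ‖fderiv ℝ (fun y => hamInChart H x₀ (t, y)) (Φ (t, l x))
          (reeb (α.inChart x₀ (Φ (t, l x))) (dForm (α.inChart x₀) (Φ (t, l x))))‖ < C :=
      ⟨_, ((hcont t₀ ⟨ht₀, htO⟩).norm.eventually (gt_mem_nhds (lt_add_one _))).filter_mono
      (nhdsWithin_le_of_mem (hTnhds t₀ ⟨ht₀, htO⟩))⟩
    refine ⟨C, ?_⟩
    filter_upwards [hbd, hTnhds t₀ ⟨ht₀, htO⟩] with t ht htT
    refine ⟨_, ((main t htT).congr hg (hg t htT)).mono_of_mem_nhdsWithin (hTnhds t htT), ?_⟩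
    rw [norm_mul, hg t htT]
    exact mul_le_mul_of_nonneg_right ht.le (norm_nonneg _)
  · have h0 : φ 0 = id := funext hφ0
    have h1 : mapD (φ 0) x v = v := by
      rw [h0, mapD, mfderiv_id]; rfl
    rw [h1, hφ0]
    exact hv

lemma finrank_ker_eq {G : Type*} [NormedAddCommGroup G] [NormedSpace ℝ G] [FiniteDimensional ℝ G]
    {a b : G →L[ℝ] ℝ} (ha : a ≠ 0) (hb : b ≠ 0) :
    Module.finrank ℝ (LinearMap.ker a.toLinearMap) =
      Module.finrank ℝ (LinearMap.ker b.toLinearMap) := by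
  have h : ∀ c : G →L[ℝ] ℝ, c ≠ 0 →
      Module.finrank ℝ (LinearMap.ker c.toLinearMap) + 1 = Module.finrank ℝ G := fun c hc =>
    Module.Dual.finrank_ker_add_one_of_ne_zero
      (f := c.toLinearMap) fun h => hc (ContinuousLinearMap.ext fun v => LinearMap.congr_fun h v)
  have h1 := h a ha
  have h2 := h b hb
  omega

/-- Both kernels are hyperplanes, so for injective `A` the inclusion is an equality by dimension. -/
lemma map_ker_eq_ker {G : Type*} [NormedAddCommGroup G] [NormedSpace ℝ G] [FiniteDimensional ℝ G]
    {a b : G →L[ℝ] ℝ} (ha : a ≠ 0) (hb : b ≠ 0) {A : G →L[ℝ] G} (hA : Function.Injective A)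
    (h : ∀ v, a v = 0 → b (A v) = 0) :
    (LinearMap.ker a.toLinearMap).map A.toLinearMap = LinearMap.ker b.toLinearMap := by
  refine Submodule.eq_of_le_of_finrank_eq ?_ ?_
  · rintro _ ⟨v, hv, rfl⟩
    exact h v hv
  · rw [← finrank_ker_eq ha hb]
    exact (Submodule.equivMapOfInjective A.toLinearMap hA _).finrank_eq.symm

/-- The conditions `hV` and `hV'` say exactly that the velocity of `j` is the contact vector of `H`,
so the curves `j · p` are integral curves of the contact field and are carried along by its flow. -/
theorem exists_contactIsotopy_of_hamiltonian [T2Space M] (hα : IsContactForm α)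
    (hH : IsSmoothHam (E := E) H) {K : Set M} (hK : IsCompact K)
    (hHK : ∀ t ∈ Icc (0 : ℝ) 1, ∀ x ∉ K, H t x = 0) {ι : Type*} {j : ℝ → ι → M} {V : ℝ → ι → E}
    (hj : ∀ p, ∀ t ∈ Icc (0 : ℝ) 1, HasVelocity (j · p) (V t p) (Icc 0 1) t)
    (hV : ∀ p, ∀ t ∈ Icc (0 : ℝ) 1, α.val (j t p) (V t p) = H t (j t p))
    (hV' : ∀ p, ∀ t ∈ Icc (0 : ℝ) 1, ∀ w, α.val (j t p) w = 0 →
      α.dval (j t p) (V t p) w = -scalarD (H t) (j t p) w) :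
    ∃ ψ : ℝ → Diffeomorph 𝓘(ℝ, E) 𝓘(ℝ, E) M M ∞, IsCompactlySupportedContactIsotopy α ψ ∧
      ∀ t ∈ Icc (0 : ℝ) 1, ∀ p, ψ t (j 0 p) = j t p := by
  have hX := isSmoothField_contactField hα hH
  obtain ⟨Φ, hΦ⟩ := exists_manifold_flow hX hK
    fun t ht x hx => contactField_eq_zero hK (hHK t ht) hx
  choose hsm hst hvel htr hid using hΦ
  have h0 : (0 : ℝ) ∈ Icc (0 : ℝ) 1 := left_mem_Icc.2 zero_le_one
  -- The flow is controlled only on `[0,1]`, but `ψ t` must be a diffeomorphism for every real `t`;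
  -- clamping the time supplies the irrelevant values.
  let τ : ℝ → ℝ := fun t => max 0 (min 1 t)
  have hτ : ∀ t, τ t ∈ Icc (0 : ℝ) 1 := fun t =>
    ⟨le_max_left _ _, max_le zero_le_one (min_le_left _ _)⟩
  have hτ' : ∀ t ∈ Icc (0 : ℝ) 1, τ t = t := fun t ht => by
    simp only [τ, min_eq_right ht.2, max_eq_right ht.1]
  have hcm : ∀ s ∈ Icc (0 : ℝ) 1, ∀ t ∈ Icc (0 : ℝ) 1, ContMDiff 𝓘(ℝ, E) 𝓘(ℝ, E) ∞ (Φ t s) := by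
    intro s hs t ht
    rw [← contMDiffOn_univ]
    exact (hsm s hs).comp (contMDiffOn_const.prodMk contMDiffOn_id) fun x _ => ⟨ht, mem_univ _⟩
  let ψ : ℝ → Diffeomorph 𝓘(ℝ, E) 𝓘(ℝ, E) M M ∞ := fun t =>
    { toFun := Φ (τ t) 0
      invFun := Φ 0 (τ t)
      left_inv := fun x => by rw [htr 0 h0 x 0 h0 (τ t) (hτ t), hst 0 h0]
      right_inv := fun x => by rw [htr (τ t) (hτ t) x (τ t) (hτ t) 0 h0, hst _ (hτ t)]
      contMDiff_toFun := hcm 0 h0 _ (hτ t)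
      contMDiff_invFun := hcm _ (hτ t) 0 h0 }
  have hψ : ∀ t ∈ Icc (0 : ℝ) 1, ⇑(ψ t) = Φ t 0 := fun t ht => by
    change Φ (τ t) 0 = Φ t 0
    rw [hτ' t ht]
  refine ⟨ψ, ⟨?_, fun x => ?_, fun t ht x => ?_, K, hK, fun t ht x hx => ?_⟩, fun t ht p => ?_⟩
  · exact (hsm 0 h0).congr fun q hq => congrFun (hψ q.1 hq.1) q.2
  · rw [hψ 0 h0, hst 0 h0]
  · have hinj : Function.Injective (mapD (F := E) (E := E) (Φ t 0) x) := by
      have h1 := ((hcm t ht 0 h0 (Φ t 0 x)).mdifferentiableAt (by simp)).hasMFDerivAt.comp x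
        ((hcm 0 h0 t ht x).mdifferentiableAt (by simp)).hasMFDerivAt
      have h2 : Φ 0 t ∘ Φ t 0 = id := funext fun x => by
        rw [Function.comp_apply, htr 0 h0 x 0 h0 t ht, hst 0 h0, id]
      rw [h2] at h1
      have h3 := hasMFDerivAt_unique h1 (hasMFDerivAt_id x)
      refine Function.LeftInverse.injective (g := mapD (F := E) (E := E) (Φ 0 t) (Φ t 0 x))
        fun v => ?_
      exact congrArg (fun L : E →L[ℝ] E => L v) h3
    rw [hψ t ht]
    exact map_ker_eq_ker (a := α.val x) (b := α.val (Φ t 0 x)) (hα.ne_zero _) (hα.ne_zero _) hinj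
      fun v hv => val_mapD_eq_zero_of_flow (φ := fun t => Φ t 0) hα hH (hsm 0 h0) (hst 0 h0) (hvel 0 h0) hv ht
  · rw [hψ t ht, hid 0 h0 x hx t ht]
  · rw [hψ t ht]
    refine eqOn_of_hasVelocity hX isPreconnected_Icc le_rfl (fun t _ => self_mem_nhdsWithin)
      (hvel 0 h0 (j 0 p)) (γ₂ := (j · p)) (fun t ht => ?_) h0 (hst 0 h0 _) ht
    have := (hα.isContactPair (j t p)).eq_contactVec (hV p t ht) (hV' p t ht)
    have h1 := hj p t ht
    rw [this] at h1
    exact h1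

end ContactFlow

/-! ### Smooth families of local inverses and left inverses -/

section Retraction

universe u

lemma isInvertible_of_norm_sub_id_le {F : Type*} [NormedAddCommGroup F] [NormedSpace ℝ F]
    [FiniteDimensional ℝ F] {D : F →L[ℝ] F} (hD : ‖D - ContinuousLinearMap.id ℝ F‖ ≤ 1 / 2) :
    D.IsInvertible := by
  have hinj : Function.Injective D.toLinearMap := by
    refine (injective_iff_map_eq_zero D).2 fun v hv => ?_
    have h1 := (D - ContinuousLinearMap.id ℝ F).le_of_opNorm_le hD v
    rw [sub_apply, hv, ContinuousLinearMap.id_apply, zero_sub, norm_neg] at h1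
    exact norm_le_zero_iff.1 (by linarith)
  exact ⟨(LinearEquiv.ofInjectiveEndo D.toLinearMap hinj).toContinuousLinearEquiv,
    ContinuousLinearMap.ext fun _ => rfl⟩

variable {F : Type u} [NormedAddCommGroup F] [NormedSpace ℝ F] [FiniteDimensional ℝ F]

/-- Local inversion of a family of maps depending smoothly on a parameter in an interval, where
the derivatives are close to the identity. -/
lemma exists_local_inverse_of_norm_le {g : ℝ × F → F} {a b r t₀ : ℝ} {u₀ : F} (hab : a < b)
    (ht₀ : t₀ ∈ Icc a b) (hr : 0 < r) (hg : ContDiffOn ℝ ∞ g (Icc a b ×ˢ ball u₀ r))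
    (hD : ∀ t ∈ Icc a b, ∀ u ∈ ball u₀ r,
      ‖fderiv ℝ (fun u => g (t, u)) u - ContinuousLinearMap.id ℝ F‖ ≤ 1 / 2) :
    ∃ O, IsOpen O ∧ t₀ ∈ O ∧ ∃ U, IsOpen U ∧ u₀ ∈ U ∧ ∃ W, IsOpen W ∧ ∃ G : ℝ × F → F,
      ContDiffOn ℝ ∞ G ((Icc a b ∩ O) ×ˢ W) ∧
      (∀ t ∈ Icc a b ∩ O, ∀ z ∈ W, G (t, z) ∈ ball u₀ r) ∧
      ∀ t ∈ Icc a b ∩ O, ∀ u ∈ U, g (t, u) ∈ W ∧ G (t, g (t, u)) = u := by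
  have hT : UniqueDiffOn ℝ (Icc a b) := uniqueDiffOn_Icc hab
  have hdiff : ∀ t ∈ Icc a b, ∀ u ∈ ball u₀ r, HasFDerivAt (fun u => g (t, u))
      (fderiv ℝ (fun u => g (t, u)) u) u := fun t ht u hu =>
    (hasFDerivAt_snd isOpen_ball hg ht hu).differentiableAt.hasFDerivAt
  have hinj : ∀ t ∈ Icc a b, ∀ u ∈ ball u₀ r, ∀ u' ∈ ball u₀ r, g (t, u) = g (t, u') → u = u' := by
    intro t ht u hu u' hu' h
    have h1 := (convex_ball u₀ r).norm_image_sub_le_of_norm_hasFDerivWithin_le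
      (f := fun u => g (t, u) - u)
      (fun x hx => ((hdiff t ht x hx).sub (hasFDerivAt_id x)).hasFDerivWithinAt)
      (fun x hx => hD t ht x hx) hu hu'
    rw [h, sub_sub_sub_cancel_left, norm_sub_rev] at h1
    exact (sub_eq_zero.1 (norm_le_zero_iff.1 (by linarith))).symm
  -- Along the flow `φ` of this field `g (t, φ_t u)` is constant in time. The inverse of `g (t, ·)`
  -- is thus `φ_t` after the inverse of `g (t₀, ·)`, and the inverse function theorem is needed only
  -- at the single time `t₀`, even if `t₀` is an endpoint.
  let Z : ℝ × F → F := fun p => -((fderiv ℝ (fun u => g (p.1, u)) p.2).inverse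
    (derivWithin (fun t => g (t, p.2)) (Icc a b) p.1))
  have hZ : ContDiffOn ℝ ∞ Z (Icc a b ×ˢ ball u₀ r) := by
    have : CompleteSpace F := FiniteDimensional.complete ℝ F
    have h1 : ContDiffOn ℝ ∞ (fun p : ℝ × F => (fderiv ℝ (fun u => g (p.1, u)) p.2).inverse)
        (Icc a b ×ˢ ball u₀ r) := fun p hp =>
      ContDiffAt.comp_contDiffWithinAt (g := ContinuousLinearMap.inverse) p
        (isInvertible_of_norm_sub_id_le (hD p.1 hp.1 p.2 hp.2)).contDiffAt_map_inverse
        (contDiffOn_fderiv_snd hT isOpen_ball hg p hp)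
    exact (h1.clm_apply (contDiffOn_derivWithin_fst hT isOpen_ball hg)).neg
  let χ : ContDiffBump u₀ := ⟨r / 4, r / 2, by positivity, by linarith⟩
  let Y : ℝ → F → F := fun t u => χ u • Z (t, u)
  have hY0 : ∀ t, ∀ u ∉ closedBall u₀ (r / 2), Y t u = 0 := by
    intro t u hu
    have : χ u = 0 := χ.zero_of_le_dist (by simpa using (not_le.1 hu).le)
    simp [Y, this]
  have hY : ContDiffOn ℝ ∞ (fun p : ℝ × F => Y p.1 p.2) (Icc a b ×ˢ univ) := by
    rintro ⟨t, u⟩ ⟨ht, -⟩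
    by_cases hu : u ∈ closedBall u₀ (r / 2)
    · have hu' : u ∈ ball u₀ r := closedBall_subset_ball (by linarith) hu
      have h1 : ContDiffOn ℝ ∞ (fun p : ℝ × F => Y p.1 p.2) (Icc a b ×ˢ ball u₀ r) :=
        (χ.contDiff.comp contDiff_snd).contDiffOn.smul hZ
      exact (h1 (t, u) ⟨ht, hu'⟩).mono_of_mem_nhdsWithin (by
        rw [nhdsWithin_prod_eq]
        exact prod_mem_prod self_mem_nhdsWithin (mem_nhdsWithin_of_mem_nhds
          (isOpen_ball.mem_nhds hu')))
    · refine (contDiffWithinAt_const (c := (0 : F))).congr_of_eventuallyEq ?_ (hY0 t u hu)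
      have : (Prod.snd ⁻¹' (closedBall u₀ (r / 2))ᶜ : Set (ℝ × F)) ∈ 𝓝 (t, u) :=
        (isClosed_closedBall.isOpen_compl.preimage continuous_snd).mem_nhds hu
      filter_upwards [mem_nhdsWithin_of_mem_nhds this] with p hp using hY0 p.1 p.2 hp
  obtain ⟨L, hL⟩ := exists_flow hab hY (isCompact_closedBall u₀ (r / 2)) (fun t _ => hY0 t)
  obtain ⟨φ, hφ, hφs, hφv, hφL⟩ := hL t₀ ht₀
  have hδ : 0 < r / 8 / (|L| + 1) := by positivity
  set δ := r / 8 / (|L| + 1)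
  -- During time `δ` a point moves by at most `r / 8`, so it stays where the cutoff is `1` and the
  -- flow is the genuine one.
  have hin : ∀ u ∈ ball u₀ (r / 8), ∀ t ∈ Icc a b ∩ ball t₀ δ, φ t u ∈ ball u₀ (r / 4) := by
    intro u hu t ht
    have h1 := hφL u t ht.1
    have h3 : |t - t₀| < δ := by simpa [Real.dist_eq] using ht.2
    have h4 : L * |t - t₀| ≤ r / 8 := by
      calc L * |t - t₀| ≤ (|L| + 1) * |t - t₀| := by
            gcongr; linarith [le_abs_self L]
        _ ≤ (|L| + 1) * δ := by gcongr
        _ = r / 8 := by simp only [δ]; field_simp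
    rw [mem_ball] at hu ⊢
    calc dist (φ t u) u₀ ≤ dist (φ t u) u + dist u u₀ := dist_triangle _ _ _
      _ < r / 4 := by rw [dist_eq_norm (φ t u)]; linarith
  have hin' : ball u₀ (r / 4) ⊆ ball u₀ r := ball_subset_ball (by linarith)
  have hcons : ∀ u ∈ ball u₀ (r / 8), ∀ t ∈ Icc a b ∩ ball t₀ δ, g (t, φ t u) = g (t₀, u) := by
    intro u hu t ht
    have hs : Convex ℝ (Icc a b ∩ ball t₀ δ) := (convex_Icc a b).inter (convex_ball _ _)
    have hder : ∀ s ∈ Icc a b ∩ ball t₀ δ,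
        HasDerivWithinAt (fun s => g (s, φ s u)) 0 (Icc a b ∩ ball t₀ δ) s := by
      intro s hs
      have hmem := hin' (hin u hu s hs)
      have h1 := ((hg.differentiableOn (by simp)) (s, φ s u) ⟨hs.1, hmem⟩).hasFDerivWithinAt
      have h2 : HasDerivWithinAt (fun s => (s, φ s u)) (1, Y s (φ s u)) (Icc a b ∩ ball t₀ δ) s :=
        (hasDerivWithinAt_id s _).prodMk ((hφv u s hs.1).mono inter_subset_left)
      have h3 := h1.comp_hasDerivWithinAt s h2 fun x hx => mem_prod.2 ⟨hx.1, hin' (hin u hu x hx)⟩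
      refine h3.congr_deriv ?_
      have e1 : ((1 : ℝ), Y s (φ s u)) = (1, 0) + (0, Y s (φ s u)) := by simp
      have e2 := (hasDerivWithinAt_fst hg hs.1 hmem).derivWithin (hT s hs.1)
      have e3 := (hasFDerivAt_snd isOpen_ball hg hs.1 hmem).fderiv
      have e4 : Y s (φ s u) = Z (s, φ s u) := by
        simp only [Y]
        rw [χ.one_of_mem_closedBall (ball_subset_closedBall (hin u hu s hs)), one_smul]
      obtain ⟨A, hA⟩ := isInvertible_of_norm_sub_id_le (hD s hs.1 _ hmem)
      rw [e1, map_add, ← e2, e4]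
      have e5 : fderivWithin ℝ g (Icc a b ×ˢ ball u₀ r) (s, φ s u) (0, Z (s, φ s u)) =
        fderiv ℝ (fun u => g (s, u)) (φ s u) (Z (s, φ s u)) := by rw [e3]; simp
      rw [e5]
      simp only [Z]
      rw [map_neg, ← hA]
      simp
    have h0 := hs.norm_image_sub_le_of_norm_hasDerivWithin_le (C := 0) hder (by simp)
      ⟨ht₀, mem_ball_self hδ⟩ ht
    simp only [hφs] at h0
    rw [zero_mul] at h0
    exact sub_eq_zero.1 (norm_le_zero_iff.1 h0)
  have hg₀ : ∀ u ∈ ball u₀ r, ContDiffAt ℝ ∞ (fun u => g (t₀, u)) u := fun u hu =>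
    (hg.comp (contDiffOn_const.prodMk contDiffOn_id) fun x hx => ⟨ht₀, hx⟩).contDiffAt
      (isOpen_ball.mem_nhds hu)
  have : CompleteSpace F := FiniteDimensional.complete ℝ F
  obtain ⟨A₀, hA₀⟩ := isInvertible_of_norm_sub_id_le (hD t₀ ht₀ u₀ (mem_ball_self hr))
  have hd₀ : HasFDerivAt (fun u => g (t₀, u)) (A₀ : F →L[ℝ] F) u₀ := by
    rw [hA₀]; exact hdiff t₀ ht₀ u₀ (mem_ball_self hr)
  let e := ((hg₀ u₀ (mem_ball_self hr)).toOpenPartialHomeomorph _ hd₀ (by simp)).restrOpen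
    (ball u₀ (r / 8)) isOpen_ball
  have he : ⇑e = fun u => g (t₀, u) := rfl
  have hes : e.source ⊆ ball u₀ (r / 8) := fun x hx => hx.2
  have hu₀e : u₀ ∈ e.source :=
    ⟨ContDiffAt.mem_toOpenPartialHomeomorph_source _ _ _, mem_ball_self (by positivity)⟩
  have hesymm : ContDiffOn ℝ ∞ e.symm e.target := by
    intro z hz
    have hmem : e.symm z ∈ ball u₀ r :=
      ball_subset_ball (by linarith) (hes (e.map_target hz))
    obtain ⟨A, hA⟩ := isInvertible_of_norm_sub_id_le (hD t₀ ht₀ _ hmem)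
    refine (e.contDiffAt_symm (f₀' := A) hz ?_ (hg₀ _ hmem)).contDiffWithinAt
    rw [hA]
    exact hdiff t₀ ht₀ _ hmem
  have hnear : g ⁻¹' e.target ∈ 𝓝[Icc a b ×ˢ ball u₀ r] (t₀, u₀) :=
    (hg.continuousOn (t₀, u₀) ⟨ht₀, mem_ball_self hr⟩).preimage_mem_nhdsWithin
      (e.open_target.mem_nhds (e.map_source hu₀e))
  rw [nhdsWithin_prod_eq, isOpen_ball.nhdsWithin_eq (mem_ball_self hr)] at hnear
  obtain ⟨P, hP, Q, hQ, hPQ⟩ := Filter.mem_prod_iff.1 hnear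
  obtain ⟨O, hO, htO, hOP⟩ := mem_nhdsWithin.1 hP
  obtain ⟨U, hUQ, hU, huU⟩ := _root_.mem_nhds_iff.1 (inter_mem hQ (ball_mem_nhds u₀ hr))
  refine ⟨O ∩ ball t₀ δ, hO.inter isOpen_ball, ⟨htO, mem_ball_self hδ⟩, U, hU, huU, e.target,
    e.open_target, fun p => φ p.1 (e.symm p.2), ?_, fun t ht z hz => ?_, fun t ht u hu => ?_⟩
  · exact hφ.comp (contDiffOn_fst.prodMk (hesymm.comp contDiffOn_snd fun p hp => hp.2))
      fun p hp => ⟨hp.1.1, mem_univ _⟩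
  · exact hin' (hin _ (hes (e.map_target hz)) t ⟨ht.1, ht.2.2⟩)
  · have hW : g (t, u) ∈ e.target :=
      hPQ (show (t, u) ∈ P ×ˢ Q from ⟨hOP ⟨ht.2.1, ht.1⟩, (hUQ hu).1⟩)
    -- Conservation shows that `G` is a right inverse; injectivity of `g (t, ·)` on the ball makes
    -- it a left inverse.
    refine ⟨hW, hinj t ht.1 _ (hin' (hin _ (hes (e.map_target hW)) t ⟨ht.1, ht.2.2⟩)) u
      (hUQ hu).2 ?_⟩
    rw [hcons _ (hes (e.map_target hW)) t ⟨ht.1, ht.2.2⟩]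
    exact e.right_inv hW

variable {E : Type*} [NormedAddCommGroup E] [NormedSpace ℝ E] [FiniteDimensional ℝ E]

/-- A family of immersions depending smoothly on a parameter in `[0,1]` has, locally, a smooth
family of left inverses. -/
lemma exists_local_retraction {f : ℝ × F → E} {O : Set ℝ} (hO : IsOpen O) {U : Set F}
    (hU : IsOpen U) (hf : ContDiffOn ℝ ∞ f ((Icc 0 1 ∩ O) ×ˢ U)) {t₀ : ℝ} (ht₀ : t₀ ∈ Icc 0 1 ∩ O)
    {u₀ : F} (hu₀ : u₀ ∈ U)
    (hinj : Function.Injective (fderiv ℝ (fun u => f (t₀, u)) u₀)) :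
    ∃ O', IsOpen O' ∧ t₀ ∈ O' ∧ O' ⊆ O ∧ ∃ U', IsOpen U' ∧ u₀ ∈ U' ∧ U' ⊆ U ∧
      ∃ W, IsOpen W ∧ ∃ q : ℝ × E → F,
      ContDiffOn ℝ ∞ q ((Icc 0 1 ∩ O') ×ˢ W) ∧
      (∀ t ∈ Icc 0 1 ∩ O', ∀ y ∈ W, q (t, y) ∈ U) ∧
      ∀ t ∈ Icc 0 1 ∩ O', ∀ u ∈ U', f (t, u) ∈ W ∧ q (t, f (t, u)) = u := by
  obtain ⟨P, hP⟩ := LinearMap.exists_leftInverse_of_injective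
    (fderiv ℝ (fun u => f (t₀, u)) u₀).toLinearMap (LinearMap.ker_eq_bot.2 hinj)
  -- A linear left inverse of the derivative at `(t₀, u₀)`. The maps `proj ∘ f (t, ·)` have
  -- derivative close to the identity nearby, and inverting them gives the retraction `y ↦ G (t,
  -- proj y)`.
  let proj : E →L[ℝ] F := P.toContinuousLinearMap
  have hproj : proj.comp (fderiv ℝ (fun u => f (t₀, u)) u₀) = ContinuousLinearMap.id ℝ F :=
    ContinuousLinearMap.ext fun v => LinearMap.congr_fun hP v
  have hT := uniqueDiffOn_Icc_inter hO
  have hcont : ContinuousOn (fun p : ℝ × F => ‖proj.comp (fderiv ℝ (fun u => f (p.1, u)) p.2) -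
      ContinuousLinearMap.id ℝ F‖) ((Icc 0 1 ∩ O) ×ˢ U) :=
    ((continuousOn_const.clm_comp (contDiffOn_fderiv_snd hT hU hf).continuousOn).sub
      continuousOn_const).norm
  have hev := (hcont (t₀, u₀) ⟨ht₀, hu₀⟩).eventually_lt
    (continuousWithinAt_const (b := (1 / 2 : ℝ))) (by simp only [hproj, sub_self, norm_zero]; norm_num)
  rw [nhdsWithin_prod_eq, hU.nhdsWithin_eq hu₀, nhdsWithin_inter_of_mem'
    (mem_nhdsWithin_of_mem_nhds (hO.mem_nhds ht₀.2))] at hev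
  obtain ⟨S, hS, Q, hQ, hSQ⟩ := Filter.mem_prod_iff.1 hev
  obtain ⟨δ, hδ, hδS⟩ := Metric.mem_nhdsWithin_iff.1
    (inter_mem hS (mem_nhdsWithin_of_mem_nhds (hO.mem_nhds ht₀.2)))
  obtain ⟨r, hr, hrQ⟩ := Metric.mem_nhds_iff.1 (inter_mem hQ (hU.mem_nhds hu₀))
  -- A nondegenerate closed subinterval of `[0,1]` around `t₀` on which the derivative estimate
  -- holds.
  set a := max 0 (t₀ - δ / 2)
  set b := min 1 (t₀ + δ / 2)
  have hab : a < b := by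
    simp only [a, b, max_lt_iff, lt_min_iff]
    refine ⟨⟨one_pos, ?_⟩, ?_, ?_⟩ <;> linarith [ht₀.1.1, ht₀.1.2]
  have hIcc : ∀ t, t ∈ Icc a b ↔ t ∈ Icc (0 : ℝ) 1 ∧ |t - t₀| ≤ δ / 2 := by
    intro t
    simp only [a, b, mem_Icc, max_le_iff, le_min_iff, abs_le]
    constructor
    · rintro ⟨⟨h1, h2⟩, h3, h4⟩
      exact ⟨⟨h1, h3⟩, by linarith, by linarith⟩
    · rintro ⟨⟨h1, h2⟩, h3, h4⟩
      exact ⟨⟨h1, by linarith⟩, h2, by linarith⟩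
  have hsub : ∀ t ∈ Icc a b, t ∈ S ∧ t ∈ Icc 0 1 ∩ O := fun t ht => by
    have h1 := (hIcc t).1 ht
    have h2 := hδS ⟨by rw [mem_ball, Real.dist_eq]; linarith, h1.1⟩
    exact ⟨h2.1, h1.1, h2.2⟩
  have hg : ContDiffOn ℝ ∞ (fun p => proj (f p)) (Icc a b ×ˢ ball u₀ r) :=
    proj.contDiff.comp_contDiffOn (hf.mono (prod_mono (fun t ht => (hsub t ht).2)
      fun u hu => (hrQ hu).2))
  obtain ⟨O₁, hO₁, htO₁, U₁, hU₁, huU₁, W₁, hW₁, G, hG, hGU, hGl⟩ :=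
    exists_local_inverse_of_norm_le hab ((hIcc t₀).2 ⟨ht₀.1, by simp; positivity⟩) hr hg
      fun t ht u hu => by
        have h1 : HasFDerivAt (fun u => proj (f (t, u)))
            (proj.comp (fderiv ℝ (fun u => f (t, u)) u)) u :=
          proj.hasFDerivAt.comp u (hasFDerivAt_snd hU hf (hsub t ht).2
            (hrQ hu).2).differentiableAt.hasFDerivAt
        rw [h1.fderiv]
        exact (hSQ (show (t, u) ∈ S ×ˢ Q from ⟨(hsub t ht).1, (hrQ hu).1⟩)).le
  have hO' : ∀ t ∈ Icc 0 1 ∩ (O₁ ∩ O ∩ ball t₀ (δ / 2)), t ∈ Icc a b ∩ O₁ := fun t ht =>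
    ⟨(hIcc t).2 ⟨ht.1, by rw [← Real.dist_eq]; exact (mem_ball.1 ht.2.2).le⟩, ht.2.1.1⟩
  refine ⟨O₁ ∩ O ∩ ball t₀ (δ / 2), (hO₁.inter hO).inter isOpen_ball,
    ⟨⟨htO₁, ht₀.2⟩, mem_ball_self (by positivity)⟩, fun t ht => ht.1.2, U₁ ∩ U, hU₁.inter hU,
    ⟨huU₁, hu₀⟩, inter_subset_right, proj ⁻¹' W₁, hW₁.preimage proj.continuous, fun p => G (p.1, proj p.2),
    ?_, fun t ht y hy => ?_, fun t ht u hu => ?_⟩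
  · exact hG.comp (contDiffOn_fst.prodMk (proj.contDiff.comp_contDiffOn contDiffOn_snd))
      fun p hp => ⟨hO' p.1 hp.1, hp.2⟩
  · exact (hrQ (hGU t (hO' t ht) _ hy)).2
  · exact hGl t (hO' t ht) u hu.1

end Retraction

/-! ### Local Hamiltonians from Cartan's identity -/

section LocalHamiltonian

lemma hasFDerivAt_comp_snd {F H E : Type*} [NormedAddCommGroup F] [NormedSpace ℝ F]
    [NormedAddCommGroup H] [NormedSpace ℝ H] [NormedAddCommGroup E] [NormedSpace ℝ E] {k : ℝ × F → H} {T : Set ℝ} {U : Set F}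
    (hU : IsOpen U) (hk : ContDiffOn ℝ ∞ k (T ×ˢ U)) {t : ℝ} (ht : t ∈ T) {q : E → F} {y : E}
    (hy : q y ∈ U) {q' : E →L[ℝ] F} (hq : HasFDerivAt q q' y) :
    HasFDerivAt (fun y => k (t, q y)) ((fderiv ℝ (fun u => k (t, u)) (q y)).comp q') y :=
  HasFDerivAt.comp (g := fun u => k (t, u)) y
    (hasFDerivAt_snd hU hk ht hy).differentiableAt.hasFDerivAt hq

universe u
variable {F : Type u} [NormedAddCommGroup F] [NormedSpace ℝ F] [FiniteDimensional ℝ F]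
  {E : Type*} [NormedAddCommGroup E] [NormedSpace ℝ E]

/-- The Cartan identity for the pullbacks of a form under a family of maps. -/
lemma fderiv_apply_velocity {F : Type*} [NormedAddCommGroup F] [NormedSpace ℝ F]
    {f : ℝ × F → E} {T : Set ℝ} (hT : UniqueDiffOn ℝ T)
    (hT' : T ⊆ closure (interior T)) {U : Set F} (hU : IsOpen U)
    (hf : ContDiffOn ℝ ∞ f (T ×ˢ U)) {β : E → E →L[ℝ] ℝ} {Ω : Set E} (hΩ : IsOpen Ω)
    (hβ : ContDiffOn ℝ ∞ β Ω) {t : ℝ} (ht : t ∈ T) {u : F} (hu : u ∈ U) (hfΩ : f (t, u) ∈ Ω) (z : F) :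
    fderiv ℝ (fun u => β (f (t, u)) (derivWithin (fun t => f (t, u)) T t)) u z =
      derivWithin (fun t => β (f (t, u)) (fderiv ℝ (fun u => f (t, u)) u z)) T t -
        dForm β (f (t, u)) (derivWithin (fun t => f (t, u)) T t)
          (fderiv ℝ (fun u => f (t, u)) u z) := by
  have hV := contDiffOn_derivWithin_fst hT hU hf
  have hβd : HasFDerivAt β (fderiv ℝ β (f (t, u))) (f (t, u)) :=
    ((hβ.contDiffAt (hΩ.mem_nhds hfΩ)).differentiableAt (by simp)).hasFDerivAt
  have hfd : HasFDerivAt (fun u => f (t, u)) (fderiv ℝ (fun u => f (t, u)) u) u :=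
    (hasFDerivAt_snd hU hf ht hu).differentiableAt.hasFDerivAt
  have hVd : HasFDerivAt (fun u => derivWithin (fun t => f (t, u)) T t)
      (fderiv ℝ (fun u => derivWithin (fun t => f (t, u)) T t) u) u :=
    (hasFDerivAt_snd hU hV ht hu).differentiableAt.hasFDerivAt
  have hft : HasDerivWithinAt (fun t => f (t, u)) (derivWithin (fun t => f (t, u)) T t) T t :=
    (hasDerivWithinAt_fst hf ht hu).differentiableWithinAt.hasDerivWithinAt
  have h0 : HasFDerivAt (fun u => β (f (t, u)))
    ((fderiv ℝ β (f (t, u))).comp (fderiv ℝ (fun u => f (t, u)) u)) u :=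
    HasFDerivAt.comp (g := β) u hβd hfd
  have h1 := h0.clm_apply hVd
  have h2 : HasDerivWithinAt (fun t => β (f (t, u)))
      (fderiv ℝ β (f (t, u)) (derivWithin (fun t => f (t, u)) T t)) T t :=
    HasFDerivAt.comp_hasDerivWithinAt (l := β) t hβd hft
  have h3 := (h2.clm_apply (hasDerivWithinAt_fderiv_snd hT hT' hU hf ht hu z)).derivWithin (hT t ht)
  rw [h1.fderiv, h3, dForm_apply]
  simp only [add_apply, ContinuousLinearMap.comp_apply, ContinuousLinearMap.flip_apply]
  ring

variable [FiniteDimensional ℝ E]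

/-- If the pullbacks of `β` under a family of immersions satisfy `∂ₜβₜ = c βₜ` with a smooth `c`,
then the velocity of the family is given by a Hamiltonian. -/
lemma exists_local_hamiltonian {f : ℝ × F → E} {O : Set ℝ} (hO : IsOpen O) {U : Set F}
    (hU : IsOpen U) (hf : ContDiffOn ℝ ∞ f ((Icc 0 1 ∩ O) ×ˢ U)) {t₀ : ℝ} (ht₀ : t₀ ∈ Icc 0 1 ∩ O)
    {u₀ : F} (hu₀ : u₀ ∈ U) (hinj : Function.Injective (fderiv ℝ (fun u => f (t₀, u)) u₀))
    {β : E → E →L[ℝ] ℝ} {Ω : Set E} (hΩ : IsOpen Ω) (hβ : ContDiffOn ℝ ∞ β Ω)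
    (hfΩ : ∀ t ∈ Icc 0 1 ∩ O, ∀ u ∈ U, f (t, u) ∈ Ω) {c : ℝ × F → ℝ}
    (hc : ContDiffOn ℝ ∞ c ((Icc 0 1 ∩ O) ×ˢ U))
    (hcβ : ∀ t ∈ Icc 0 1 ∩ O, ∀ u ∈ U, ∀ w, derivWithin
      (fun t => β (f (t, u)) (fderiv ℝ (fun u => f (t, u)) u w)) (Icc 0 1 ∩ O) t =
        c (t, u) * β (f (t, u)) (fderiv ℝ (fun u => f (t, u)) u w)) :
    ∃ O', IsOpen O' ∧ t₀ ∈ O' ∧ O' ⊆ O ∧ ∃ U', IsOpen U' ∧ u₀ ∈ U' ∧ U' ⊆ U ∧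
      ∃ W, IsOpen W ∧ ∃ h : ℝ × E → ℝ, ContDiffOn ℝ ∞ h ((Icc 0 1 ∩ O') ×ˢ W) ∧
      ∀ t ∈ Icc 0 1 ∩ O', ∀ u ∈ U', f (t, u) ∈ W ∧
        ∀ v, HasDerivWithinAt (fun t => f (t, u)) v (Icc 0 1 ∩ O) t →
        h (t, f (t, u)) = β (f (t, u)) v ∧ ∀ w, β (f (t, u)) w = 0 →
          dForm β (f (t, u)) v w = -fderiv ℝ (fun y => h (t, y)) (f (t, u)) w := by
  obtain ⟨O', hO', htO', hOO', U', hU', huU', hUU', W, hW, q, hq, hqU, hqf⟩ :=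
    exists_local_retraction hO hU hf ht₀ hu₀ hinj
  set T := Icc (0 : ℝ) 1 ∩ O
  have hT : UniqueDiffOn ℝ T := uniqueDiffOn_Icc_inter hO
  have hT' : T ⊆ closure (interior T) := Icc_inter_subset_closure_interior hO
  let V : ℝ × F → E := fun p => derivWithin (fun t => f (t, p.2)) T p.1
  have hV : ContDiffOn ℝ ∞ V (T ×ˢ U) := contDiffOn_derivWithin_fst hT hU hf
  have hfΩ' : MapsTo f (T ×ˢ U) Ω := fun p hp => hfΩ p.1 hp.1 p.2 hp.2
  have hβf : ContDiffOn ℝ ∞ (fun p => β (f p)) (T ×ˢ U) := hβ.comp hf hfΩ'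
  let η : ℝ × F → ℝ := fun p => β (f p) (V p)
  have hη : ContDiffOn ℝ ∞ η (T ×ˢ U) := hβf.clm_apply hV
  -- The intended differential of the Hamiltonian at `f p`. On `ker β` it is `-dβ(V, ·)`, and the
  -- multiple of `β` is what makes it restrict to `dη` on the image.
  let θ : ℝ × F → E →L[ℝ] ℝ := fun p => c p • β (f p) - dForm β (f p) (V p)
  have hθ : ContDiffOn ℝ ∞ θ (T ×ˢ U) :=
    (hc.smul hβf).sub (((contDiffOn_dForm hΩ hβ).comp hf hfΩ').clm_apply hV)
  have hTT : Icc 0 1 ∩ O' ⊆ T := inter_subset_inter_right _ hOO'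
  let Q : ℝ × E → ℝ × F := fun p => (p.1, q p)
  have hQ : ContDiffOn ℝ ∞ Q ((Icc 0 1 ∩ O') ×ˢ W) := contDiffOn_fst.prodMk hq
  have hQm : MapsTo Q ((Icc 0 1 ∩ O') ×ˢ W) (T ×ˢ U) := fun p hp =>
    ⟨hTT hp.1, hqU p.1 hp.1 p.2 hp.2⟩
  have key : ∀ t ∈ T, ∀ u ∈ U, ∀ z, fderiv ℝ (fun u => η (t, u)) u z =
      θ (t, u) (fderiv ℝ (fun u => f (t, u)) u z) := by
    intro t ht u hu z
    have h1 := fderiv_apply_velocity hT hT' hU hf hΩ hβ ht hu (hfΩ t ht u hu) z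
    rw [hcβ t ht u hu z] at h1
    exact h1
  -- The Hamiltonian is the first-order expansion at the foot point `f (t, q (t, y))`, with value
  -- `η` and slope `θ`.
  refine ⟨O', hO', htO', hOO', U', hU', huU', hUU', W, hW,
    fun p => η (Q p) + θ (Q p) (p.2 - f (Q p)), ?_, fun t ht u hu => ⟨(hqf t ht u hu).1, ?_⟩⟩
  · exact (hη.comp hQ hQm).add ((hθ.comp hQ hQm).clm_apply (contDiffOn_snd.sub (hf.comp hQ hQm)))
  · intro v hv
    have hvV : v = V (t, u) := (hv.derivWithin (hT t (hTT ht))).symm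
    obtain ⟨hfW, hqu⟩ := hqf t ht u hu
    have hQu : Q (t, f (t, u)) = (t, u) := by simp only [Q, hqu]
    refine ⟨by simp only [hQu, sub_self, map_zero, add_zero, hvV, η], fun w hw => ?_⟩
    have hqd : HasFDerivAt (fun y => q (t, y)) (fderiv ℝ (fun y => q (t, y)) (f (t, u)))
        (f (t, u)) :=
      (hasFDerivAt_snd hW hq ht hfW).differentiableAt.hasFDerivAt
    have hqU' : q (t, f (t, u)) ∈ U := by rw [hqu]; exact hUU' hu
    have d1 := hasFDerivAt_comp_snd (q := fun y => q (t, y)) hU hη (hTT ht) hqU' hqd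
    have d2 := hasFDerivAt_comp_snd (q := fun y => q (t, y)) hU hθ (hTT ht) hqU' hqd
    have d3 := hasFDerivAt_comp_snd (q := fun y => q (t, y)) hU hf (hTT ht) hqU' hqd
    -- On the image the displacement `y - f (t, q (t, y))` vanishes, so the derivative of `θ` drops
    -- out. What is left is `dη ∘ Dq + θ ∘ (id - Df ∘ Dq)`, which equals `θ` by `key`.
    have hfin := d1.add (d2.clm_apply ((hasFDerivAt_id (f (t, u))).sub d3))
    have h0 : ((id : E → E) - fun y => f (t, q (t, y))) (f (t, u)) = 0 := by
      rw [Pi.sub_apply, id, hqu, sub_self]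
    rw [h0] at hfin
    refine Eq.trans ?_ (congrArg (fun L : E →L[ℝ] ℝ => -L w) hfin.fderiv.symm)
    simp only [add_apply, ContinuousLinearMap.comp_apply, hqu,
      sub_apply, map_zero, map_sub, ContinuousLinearMap.id_apply,
      add_zero]
    rw [key t (hTT ht) u (hUU' hu)]
    simp only [θ, sub_apply, smul_apply, hw, smul_zero, hvV]
    ring

end LocalHamiltonian

/-! ### Injectivity of the differential of an immersion -/

section ImmersionDerivative

variable {E : Type*} [NormedAddCommGroup E] [NormedSpace ℝ E]
  {M : Type*} [TopologicalSpace M] [ChartedSpace E M]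
  {F : Type*} [NormedAddCommGroup F] [NormedSpace ℝ F]
  {N : Type*} [TopologicalSpace N] [ChartedSpace F N]

lemma injective_mapD_of_isImmersionAt {f : N → M} {p : N}
    (h : Manifold.IsImmersionAt 𝓘(ℝ, F) 𝓘(ℝ, E) ∞ f p) :
    Function.Injective (mapD (F := F) (E := E) f p) := by
  have hd := h.mem_domChart_source
  have hdom : MDifferentiableAt 𝓘(ℝ, F) 𝓘(ℝ, F) h.domChart p :=
    (contMDiffAt_of_mem_maximalAtlas h.domChart_mem_maximalAtlas hd).mdifferentiableAt (by simp)
  have hsymm : MDifferentiableAt 𝓘(ℝ, F) 𝓘(ℝ, F) h.domChart.symm (h.domChart p) :=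
    (contMDiffAt_symm_of_mem_maximalAtlas h.domChart_mem_maximalAtlas
      (h.domChart.map_source hd)).mdifferentiableAt (by simp)
  have hcod : MDifferentiableAt 𝓘(ℝ, E) 𝓘(ℝ, E) h.codChart (f p) :=
    (contMDiffAt_of_mem_maximalAtlas h.codChart_mem_maximalAtlas
      h.mem_codChart_source).mdifferentiableAt (by simp)
  have hf : MDifferentiableAt 𝓘(ℝ, F) 𝓘(ℝ, E) f p := h.contMDiffAt.mdifferentiableAt (by simp)
  let B : F →L[ℝ] E := h.equiv.toContinuousLinearMap.comp (ContinuousLinearMap.inl ℝ F h.complement)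
  have hB : Function.Injective B := h.equiv.injective.comp LinearMap.inl_injective
  have hBd : HasMFDerivAt 𝓘(ℝ, F) 𝓘(ℝ, E) B (h.domChart p) B :=
    hasMFDerivAt_iff_hasFDerivAt.2 B.hasFDerivAt
  have hnear : h.domChart.source ∈ 𝓝 p := h.domChart.open_source.mem_nhds hd
  have h1 : (fun q => h.codChart (f q)) =ᶠ[𝓝 p] fun q => B (h.domChart q) := by
    filter_upwards [hnear] with q hq
    have := h.writtenInCharts (show h.domChart q ∈ (h.domChart.extend 𝓘(ℝ, F)).target by
      simpa using h.domChart.map_source hq)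
    have e : h.codChart (f q) = h.equiv (h.domChart q, 0) := by
      simpa [h.domChart.left_inv hq] using this
    exact e
  have h2 : (fun q => h.domChart.symm (h.domChart q)) =ᶠ[𝓝 p] id := by
    filter_upwards [hnear] with q hq using h.domChart.left_inv hq
  have d1 := (hcod.hasMFDerivAt.comp p hf.hasMFDerivAt).congr_of_eventuallyEq
    (f₁ := fun q => B (h.domChart q)) h1.symm
  have d2 := hBd.comp p hdom.hasMFDerivAt
  have d3 := hasMFDerivAt_unique d1 d2
  have d4 := hasMFDerivAt_unique ((hsymm.hasMFDerivAt.comp p hdom.hasMFDerivAt).congr_of_eventuallyEq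
    h2.symm) (hasMFDerivAt_id p)
  have i1 : Function.Injective (mfderiv 𝓘(ℝ, F) 𝓘(ℝ, F) h.domChart p : F →L[ℝ] F) :=
    Function.LeftInverse.injective
      (g := (mfderiv 𝓘(ℝ, F) 𝓘(ℝ, F) h.domChart.symm (h.domChart p) : F →L[ℝ] F))
      fun v => congrArg (fun L : F →L[ℝ] F => L v) d4
  intro v w hvw
  refine i1 (hB ?_)
  have e := fun v => congrArg (fun L : F →L[ℝ] E => L v) d3
  refine (e v).symm.trans (Eq.trans ?_ (e w))
  exact congrArg (mfderiv 𝓘(ℝ, E) 𝓘(ℝ, E) h.codChart (f p) : E →L[ℝ] E) hvw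

end ImmersionDerivative

/-! ### Velocity and space-time image of an isotopy -/

section IsotopyBasics

variable {E : Type*} [NormedAddCommGroup E] [NormedSpace ℝ E]
  {M : Type*} [TopologicalSpace M] [ChartedSpace E M]
  {F : Type*} [NormedAddCommGroup F] [NormedSpace ℝ F]
  {L : Type*} [TopologicalSpace L] [ChartedSpace F L] {j : ℝ → L → M}

lemma IsIsotopyOfEmbeddings.injective_mapD (hj : IsIsotopyOfEmbeddings E F j) {t : ℝ}
    (ht : t ∈ Icc (0 : ℝ) 1) (p : L) : Function.Injective (mapD (F := F) (E := E) (j t) p) :=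
  injective_mapD_of_isImmersionAt ((hj.embedding t ht).isImmersion.isImmersionAt p)

lemma IsIsotopyOfEmbeddings.injective (hj : IsIsotopyOfEmbeddings E F j) {t : ℝ}
    (ht : t ∈ Icc (0 : ℝ) 1) : Function.Injective (j t) :=
  (hj.embedding t ht).isEmbedding.injective

/-- The velocity of an isotopy. -/
noncomputable def velocity (j : ℝ → L → M) (t : ℝ) (p : L) : E :=
  (mfderivWithin 𝓘(ℝ, ℝ) 𝓘(ℝ, E) (j · p) (Icc 0 1) t : ℝ →L[ℝ] E) 1

lemma clm_eq_toSpanSingleton (A : ℝ →L[ℝ] E) : A = ContinuousLinearMap.toSpanSingleton ℝ (A 1) := by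
  ext
  simp

lemma IsIsotopyOfEmbeddings.hasVelocity (hj : IsIsotopyOfEmbeddings E F j) (p : L) {t : ℝ}
    (ht : t ∈ Icc (0 : ℝ) 1) : HasVelocity (E := E) (j · p) (velocity j t p) (Icc 0 1) t := by
  have h1 : ContMDiffOn 𝓘(ℝ, ℝ) 𝓘(ℝ, E) ∞ (j · p) (Icc 0 1) :=
    hj.smooth.comp (contMDiffOn_id.prodMk contMDiffOn_const) fun s hs => ⟨hs, mem_univ _⟩
  have h2 := ((h1 t ht).mdifferentiableWithinAt (by simp)).hasMFDerivWithinAt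
  exact h2.congr_mfderiv (clm_eq_toSpanSingleton (E := E)
    (mfderivWithin 𝓘(ℝ, ℝ) 𝓘(ℝ, E) (j · p) (Icc 0 1) t : ℝ →L[ℝ] E))

lemma IsIsotopyOfEmbeddings.isCompact_image [CompactSpace L] (hj : IsIsotopyOfEmbeddings E F j)
    {S : Set L} (hS : IsClosed S) :
    IsCompact ((fun q : ℝ × L => (q.1, j q.1 q.2)) '' (Icc 0 1 ×ˢ S)) :=
  (isCompact_Icc.prod hS.isCompact).image_of_continuousOn
    (continuousOn_fst.prodMk (hj.smooth.continuousOn.mono (prod_mono_right (subset_univ S))))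

end IsotopyBasics

/-! ### Contact jets and their gluing -/

section JetCondition

variable {E : Type*} [NormedAddCommGroup E] [NormedSpace ℝ E]
  {M : Type*} [TopologicalSpace M] [ChartedSpace E M]

/-- The 1-jet of `h` at `x` is that of a contact Hamiltonian whose vector field has the value `v`
at `x`. -/
def HasContactJet (α : OneForm E M) (h : M → ℝ) (x : M) (v : E) : Prop :=
  h x = α.val x v ∧ ∀ w, α.val x w = 0 → α.dval x v w = -scalarD h x w

lemma hasFDerivAt_scalarD {h : M → ℝ} {x : M} (hh : MDifferentiableAt 𝓘(ℝ, E) 𝓘(ℝ, ℝ) h x) :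
    HasFDerivAt (fun y => h ((extChartAt 𝓘(ℝ, E) x).symm y)) (scalarD (E := E) h x)
      (extChartAt 𝓘(ℝ, E) x x) := by
  have h1 : HasFDerivWithinAt (fun y => h ((extChartAt 𝓘(ℝ, E) x).symm y)) (scalarD (E := E) h x)
      univ (extChartAt 𝓘(ℝ, E) x x) := by
    have := hh.hasMFDerivAt.2
    rw [ModelWithCorners.range_eq_univ] at this
    exact this
  exact hasFDerivWithinAt_univ.1 h1

variable {P : Type*} [NormedAddCommGroup P] [NormedSpace ℝ P]

lemma HasContactJet.congr {α : OneForm E M} {h h' : M → ℝ} {x : M} {v : E}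
    (hh : HasContactJet α h x v) (e : h' =ᶠ[𝓝 x] h) : HasContactJet α h' x v := by
  refine ⟨e.self_of_nhds.trans hh.1, fun w hw => ?_⟩
  rw [scalarD, Filter.EventuallyEq.mfderiv_eq e]
  exact hh.2 w hw

/-- Contact jets form an affine space: they may be glued by a partition of unity. -/
lemma hasContactJet_finsum {α : OneForm E M} {ι : Type*} {ρ h : ι → M → ℝ} {x : M} {v : E}
    (hf : LocallyFinite fun i => Function.support (ρ i)) (hsum : ∀ z, ∑ᶠ i, ρ i z = 1)
    (hρ : ∀ i, MDifferentiableAt 𝓘(ℝ, E) 𝓘(ℝ, ℝ) (ρ i) x)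
    (hh : ∀ i, x ∈ tsupport (ρ i) →
      MDifferentiableAt 𝓘(ℝ, E) 𝓘(ℝ, ℝ) (h i) x ∧ HasContactJet α (h i) x v)
    (hd : MDifferentiableAt 𝓘(ℝ, E) 𝓘(ℝ, ℝ) (fun z => ∑ᶠ i, ρ i z * h i z) x) :
    HasContactJet α (fun z => ∑ᶠ i, ρ i z * h i z) x v := by
  obtain ⟨N, hN, hfin⟩ := hf x
  set s := hfin.toFinset
  have hs : ∀ z ∈ N, ∀ i, ρ i z ≠ 0 → i ∈ s := fun z hz i hi =>
    hfin.mem_toFinset.2 ⟨z, hi, hz⟩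
  have hsum' : ∀ z ∈ N, ∑ i ∈ s, ρ i z = 1 := fun z hz => by
    rw [← hsum z, finsum_eq_sum_of_support_subset]
    exact fun i hi => hs z hz i hi
  have hsumh : ∀ z ∈ N, ∑ᶠ i, ρ i z * h i z = ∑ i ∈ s, ρ i z * h i z := fun z hz => by
    rw [finsum_eq_sum_of_support_subset]
    exact fun i hi => hs z hz i (left_ne_zero_of_mul hi)
  -- Since the weights sum to `1`, the common value `α(v)` can be split off. The factors `h i -
  -- α(v)` vanish at `x` whenever `x` is in the support of `ρ i`, so the differentials of the
  -- weights do not contribute.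
  have hdiff : ∀ z ∈ N, ∑ᶠ i, ρ i z * h i z =
      α.val x v + ∑ i ∈ s, ρ i z * (h i z - α.val x v) := fun z hz => by
    rw [hsumh z hz]
    simp_rw [mul_sub]
    rw [Finset.sum_sub_distrib, ← Finset.sum_mul, hsum' z hz]
    ring
  have hxN : x ∈ N := mem_of_mem_nhds hN
  have hzero : ∀ i, ρ i x * (h i x - α.val x v) = 0 := fun i => by
    by_cases hi : x ∈ tsupport (ρ i)
    · rw [(hh i hi).2.1, sub_self, mul_zero]
    · rw [image_eq_zero_of_notMem_tsupport hi, zero_mul]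
  refine ⟨?_, fun w hw => ?_⟩
  · refine (hdiff x hxN).trans ?_
    rw [Finset.sum_eq_zero fun i _ => hzero i, add_zero]
  set e := extChartAt 𝓘(ℝ, E) x
  have hex : e.symm (e x) = x := extChartAt_to_inv x
  have hder : ∀ i, ∃ D : E →L[ℝ] ℝ, HasFDerivAt
      (fun y => ρ i (e.symm y) * (h i (e.symm y) - α.val x v)) D (e x) ∧
      D w = ρ i x * -α.dval x v w := by
    intro i
    by_cases hi : x ∈ tsupport (ρ i)
    · have h1 := hasFDerivAt_scalarD (hρ i)
      have h2 := (hasFDerivAt_scalarD (hh i hi).1).sub_const (α.val x v)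
      refine ⟨_, h1.mul h2, ?_⟩
      have h3 := (hh i hi).2.1
      have h4 := (hh i hi).2.2 w hw
      simp only [add_apply, smul_apply, smul_eq_mul, e, extChartAt_to_inv, h3, sub_self, zero_mul,
        add_zero, h4, neg_neg]
    · refine ⟨0, ?_, by simp [image_eq_zero_of_notMem_tsupport hi]⟩
      refine (hasFDerivAt_const (0 : ℝ) (e x)).congr_of_eventuallyEq ?_
      have hz : ∀ᶠ z in 𝓝 (e.symm (e x)), ρ i z = 0 := by
        rw [hex]
        exact (notMem_tsupport_iff_eventuallyEq.1 hi)
      filter_upwards [(continuousAt_extChartAt_symm x).eventually hz] with y hy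
      rw [hy, zero_mul]
  choose D hD hDw using hder
  have hfinal : HasFDerivAt (fun y => ∑ᶠ i, ρ i (e.symm y) * h i (e.symm y)) (∑ i ∈ s, D i)
      (e x) := by
    have h1 := (HasFDerivAt.fun_sum fun i (_ : i ∈ s) => hD i).const_add (α.val x v)
    refine h1.congr_of_eventuallyEq ?_
    have hz : ∀ᶠ z in 𝓝 (e.symm (e x)), z ∈ N := by rwa [hex]
    filter_upwards [(continuousAt_extChartAt_symm x).eventually hz] with y hy using hdiff _ hy
  rw [(hasFDerivAt_scalarD hd).unique hfinal, sum_apply]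
  simp only [hDw]
  rw [← Finset.sum_mul, hsum' x hxN]
  ring

end JetCondition

/-! ### Contact jets along an isotopy, locally in space-time -/

section PulledBackForm

universe u
variable {E : Type*} [NormedAddCommGroup E] [NormedSpace ℝ E]
  {M : Type*} [TopologicalSpace M] [ChartedSpace E M]
  {F : Type u} [NormedAddCommGroup F] [NormedSpace ℝ F]
  {L : Type*} [TopologicalSpace L] [ChartedSpace F L]

/-- The pullbacks of `α` under the maps `j t`, in the preferred chart at `p₀`. -/
noncomputable def pullForm (α : OneForm E M) (j : ℝ → L → M) (p₀ : L) (q : ℝ × F) : F →L[ℝ] ℝ :=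
  (α.val (j q.1 ((extChartAt 𝓘(ℝ, F) p₀).symm q.2))).comp
    ((mapD (j q.1) ((extChartAt 𝓘(ℝ, F) p₀).symm q.2)).comp (chartSymmD p₀ q.2))

/-- Near `(t₀, p₀)`, the pullbacks `βₜ` of `α` satisfy `∂ₜβₜ = c βₜ` with a smooth function `c`. -/
def HasLocalFactor (α : OneForm E M) (j : ℝ → L → M) (t₀ : ℝ) (p₀ : L) : Prop :=
  ∃ O, IsOpen O ∧ t₀ ∈ O ∧ ∃ U, IsOpen U ∧ extChartAt 𝓘(ℝ, F) p₀ p₀ ∈ U ∧ ∃ c : ℝ × F → ℝ,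
    ContDiffOn ℝ ∞ c ((Icc 0 1 ∩ O) ×ˢ U) ∧ ∀ t ∈ Icc 0 1 ∩ O, ∀ u ∈ U, ∀ w,
      derivWithin (fun t => pullForm α j p₀ (t, u) w) (Icc 0 1) t =
        c (t, u) * pullForm α j p₀ (t, u) w

variable [IsManifold 𝓘(ℝ, E) ∞ M] [IsManifold 𝓘(ℝ, F) ∞ L] {α : OneForm E M} {j : ℝ → L → M}

lemma pullForm_eq_inChart
    (hj : ContMDiffOn (𝓘(ℝ, ℝ).prod 𝓘(ℝ, F)) 𝓘(ℝ, E) ∞ (fun p : ℝ × L => j p.1 p.2)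
      (Icc 0 1 ×ˢ univ)) {p₀ : L} {x₀ : M} {t : ℝ} (ht : t ∈ Icc (0 : ℝ) 1) {u : F}
    (hu : u ∈ (extChartAt 𝓘(ℝ, F) p₀).target)
    (hx : j t ((extChartAt 𝓘(ℝ, F) p₀).symm u) ∈ (extChartAt 𝓘(ℝ, E) x₀).source) :
    pullForm α j p₀ (t, u) =
      (α.inChart x₀ (extChartAt 𝓘(ℝ, E) x₀ (j t ((extChartAt 𝓘(ℝ, F) p₀).symm u)))).comp
        (fderiv ℝ (fun u => extChartAt 𝓘(ℝ, E) x₀ (j t ((extChartAt 𝓘(ℝ, F) p₀).symm u))) u) := by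
  rw [(hasFDerivAt_inCharts hu (mdifferentiableAt_of_contMDiffOn hj ht _) hx).fderiv]
  ext w
  simp only [pullForm, ContinuousLinearMap.comp_apply, α.val_eq_inChart hx]

/-- The Hamiltonian built in charts near `(t₀, p₀)` handles only the sheet of the isotopy close to
`p₀`. Since `j t₀` is injective and `L` compact, other sheets can be kept out of a small
neighbourhood in `ℝ × M`. -/
lemma exists_local_contactJet [FiniteDimensional ℝ E] [FiniteDimensional ℝ F] [T2Space M]
    [CompactSpace L] (hα : IsContactForm α) (hj : IsIsotopyOfEmbeddings E F j) {t₀ : ℝ}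
    (ht₀ : t₀ ∈ Icc (0 : ℝ) 1) {p₀ : L} (hfac : HasLocalFactor (F := F) α j t₀ p₀) :
    ∃ S : Set (ℝ × M), IsOpen S ∧ (t₀, j t₀ p₀) ∈ S ∧ ∃ h : ℝ → M → ℝ,
      ContMDiffOn (𝓘(ℝ, ℝ).prod 𝓘(ℝ, E)) 𝓘(ℝ, ℝ) ∞ (fun q : ℝ × M => h q.1 q.2)
        (Icc 0 1 ×ˢ univ ∩ S) ∧
      ∀ t ∈ Icc (0 : ℝ) 1, ∀ p, (t, j t p) ∈ S →
        MDifferentiableAt 𝓘(ℝ, E) 𝓘(ℝ, ℝ) (h t) (j t p) ∧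
        HasContactJet α (h t) (j t p) (velocity j t p) := by
  set x₀ := j t₀ p₀
  set e := extChartAt 𝓘(ℝ, E) x₀
  set l := extChartAt 𝓘(ℝ, F) p₀
  obtain ⟨O₁, hO₁, htO₁, U₁, hU₁, hu₁, hUl, hfs, hf⟩ := exists_nhds_inCharts hj.smooth ht₀ (p₀ := p₀)
    (x₀ := x₀) (mem_extChartAt_source _)
  obtain ⟨O₂, hO₂, htO₂, U₂, hU₂, hu₂, c, hc, hcβ⟩ := hfac
  set O := O₁ ∩ O₂
  set U := U₁ ∩ U₂
  have hO : IsOpen O := hO₁.inter hO₂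
  have hU : IsOpen U := hU₁.inter hU₂
  have hOO₁ : Icc 0 1 ∩ O ⊆ Icc 0 1 ∩ O₁ := inter_subset_inter_right _ inter_subset_left
  have hOO₂ : Icc 0 1 ∩ O ⊆ Icc 0 1 ∩ O₂ := inter_subset_inter_right _ inter_subset_right
  set f : ℝ × F → E := fun q => e (j q.1 (l.symm q.2))
  have hpull : ∀ t ∈ Icc 0 1 ∩ O, ∀ u ∈ U, pullForm α j p₀ (t, u) =
      (α.inChart x₀ (f (t, u))).comp (fderiv ℝ (fun u => f (t, u)) u) := fun t ht u hu =>
    pullForm_eq_inChart hj.smooth ht.1 (hUl hu.1) (hfs t (hOO₁ ht) u hu.1)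
  have hinj : Function.Injective (fderiv ℝ (fun u => f (t₀, u)) (l p₀)) := by
    have hlp : l.symm (l p₀) = p₀ := extChartAt_to_inv p₀
    rw [(hasFDerivAt_inCharts (hUl hu₁) (mdifferentiableAt_of_contMDiffOn hj.smooth ht₀ _)
      (hfs t₀ ⟨ht₀, htO₁⟩ _ hu₁)).fderiv]
    intro v w hvw
    simp only [ContinuousLinearMap.comp_apply, chartSymmD_self] at hvw
    rw [extChartAt_to_inv] at hvw
    rw [chartD_self, chartD_self] at hvw
    exact hj.injective_mapD ht₀ p₀ hvw
  have hder : ∀ t ∈ Icc 0 1 ∩ O, ∀ g : ℝ → ℝ, derivWithin g (Icc 0 1 ∩ O) t =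
      derivWithin g (Icc 0 1) t := fun t ht g =>
    derivWithin_inter (hO.mem_nhds ht.2)
  obtain ⟨O', hO', htO', hOO', U', hU', huU', hUU', W, hW, h, hh, hjet⟩ :=
    exists_local_hamiltonian hO hU
      (hf.mono (prod_mono hOO₁ inter_subset_left)) ⟨ht₀, htO₁, htO₂⟩ ⟨hu₁, hu₂⟩ hinj
      (isOpen_extChartAt_target x₀) (hα.smooth.contDiffOn_inChart x₀)
      (fun t ht u hu => e.map_source (hfs t (hOO₁ ht) u hu.1))
      (hc.mono (prod_mono hOO₂ inter_subset_right)) fun t ht u hu w => by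
        rw [hder t ht]
        have h1 := hcβ t (hOO₂ ht) u hu.2 w
        rw [hpull t ht u hu] at h1
        refine Eq.trans ?_ h1
        rw [← hder t ht, ← hder t ht]
        refine derivWithin_congr (fun s hs => ?_) ?_
        · rw [hpull s hs u hu]; rfl
        · rw [hpull t ht u hu]; rfl
  -- The space-time image of the points outside the good neighbourhood of `p₀`: compact, hence
  -- closed, and missing `(t₀, j t₀ p₀)`. Off `B`, a point `(t, j t p)` can only come from a good
  -- `p`.
  set B := (fun q : ℝ × L => (q.1, j q.1 q.2)) '' (Icc 0 1 ×ˢ (l.source ∩ l ⁻¹' U')ᶜ)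
  have hlU : IsOpen (l.source ∩ l ⁻¹' U') :=
    (continuousOn_extChartAt p₀).isOpen_inter_preimage (isOpen_extChartAt_source p₀) hU'
  have heW : IsOpen (e.source ∩ e ⁻¹' W) :=
    (continuousOn_extChartAt x₀).isOpen_inter_preimage (isOpen_extChartAt_source x₀) hW
  have hB : IsClosed B := (hj.isCompact_image hlU.isClosed_compl).isClosed
  have hmem : ∀ t ∈ Icc (0 : ℝ) 1, ∀ p, (t, j t p) ∉ B → p ∈ l.source ∩ l ⁻¹' U' := by
    intro t ht p hp
    by_contra hcon
    exact hp ⟨(t, p), ⟨ht, hcon⟩, rfl⟩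
  refine ⟨(O' ×ˢ (e.source ∩ e ⁻¹' W)) ∩ Bᶜ, (hO'.prod heW).inter hB.isOpen_compl,
    ⟨⟨htO', mem_extChartAt_source _, ?_⟩, ?_⟩, fun t x => h (t, e x), ?_, ?_⟩
  · have h1 := (hjet t₀ ⟨ht₀, htO'⟩ _ huU').1
    simp only [f, l, extChartAt_to_inv] at h1
    exact h1
  · rintro ⟨⟨t, p⟩, ⟨-, hp⟩, heq⟩
    obtain ⟨rfl, h2⟩ := Prod.mk.inj heq
    obtain rfl := hj.injective ht₀ h2
    exact hp ⟨mem_extChartAt_source _, huU'⟩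
  · have h1 : ContMDiffOn (𝓘(ℝ, ℝ).prod 𝓘(ℝ, E)) 𝓘(ℝ, ℝ) ∞ h ((Icc 0 1 ∩ O') ×ˢ W) :=
      contMDiffOn_prod_self_iff.2 hh
    refine h1.comp (t := (Icc 0 1 ∩ O') ×ˢ W) (contMDiffOn_fst.prodMk
      ((contMDiffOn_extChartAt (x := x₀)).comp contMDiffOn_snd fun q hq => ?_))
      fun q hq => ⟨⟨hq.1.1, hq.2.1.1⟩, hq.2.1.2.2⟩
    simpa [e] using hq.2.1.2.1
  · rintro t ht p ⟨⟨htO, hxe, hxW⟩, hxB⟩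
    obtain ⟨hpl, hpU⟩ := hmem t ht p hxB
    have hlp : l.symm (l p) = p := l.left_inv hpl
    have hfp : f (t, l p) = e (j t p) := by simp only [f, hlp]
    have hv := ((hj.hasVelocity p ht).chart hxe).mono (inter_subset_left (t := O))
    obtain ⟨h1, h2⟩ := (hjet t ⟨ht, htO⟩ (l p) hpU).2 (chartD x₀ (j t p) (velocity j t p)) (by
      refine hv.congr (fun s _ => ?_) ?_ <;> simp only [f, hlp] <;> rfl)
    rw [hfp] at h1 h2
    have hd : HasFDerivAt (fun y => h (t, y)) (fderiv ℝ (fun y => h (t, y)) (e (j t p)))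
        (e (j t p)) :=
      (hasFDerivAt_snd hW hh ⟨ht, htO⟩ hxW).differentiableAt.hasFDerivAt
    have hmd := (hasMFDerivAt_iff_hasFDerivAt.2 hd).comp (j t p) (hasMFDerivAt_chart hxe)
    refine ⟨hmd.mdifferentiableAt, h1.trans (α.val_eq_inChart hxe _).symm, fun w hw => ?_⟩
    rw [hα.smooth.dval_eq_dForm hxe, h2 _ (by rw [← α.val_eq_inChart hxe]; exact hw)]
    exact congrArg (fun D : E →L[ℝ] ℝ => -D w) hmd.mfderiv.symm

end PulledBackForm

/-! ### The global Hamiltonian -/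

section Globalization

universe u v
variable {E : Type v} [NormedAddCommGroup E] [NormedSpace ℝ E] [FiniteDimensional ℝ E]
  {M : Type*} [TopologicalSpace M] [ChartedSpace E M] [IsManifold 𝓘(ℝ, E) ∞ M] [T2Space M]
  {F : Type u} [NormedAddCommGroup F] [NormedSpace ℝ F] [FiniteDimensional ℝ F]
  {L : Type*} [TopologicalSpace L] [ChartedSpace F L] [IsManifold 𝓘(ℝ, F) ∞ L] [CompactSpace L]
  {α : OneForm E M} {j : ℝ → L → M}

/-- Away from the closed space-time image of the isotopy the zero function will do, as there is no
jet to match. -/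
lemma exists_local_contactJet_of_mem (hα : IsContactForm α) (hj : IsIsotopyOfEmbeddings E F j)
    (hfac : ∀ t ∈ Icc (0 : ℝ) 1, ∀ p, HasLocalFactor (F := F) α j t p) (q : ℝ × M) :
    ∃ S : Set (ℝ × M), IsOpen S ∧ q ∈ S ∧ ∃ h : ℝ → M → ℝ,
      ContMDiffOn (𝓘(ℝ, ℝ).prod 𝓘(ℝ, E)) 𝓘(ℝ, ℝ) ∞ (fun q : ℝ × M => h q.1 q.2)
        (Icc 0 1 ×ˢ univ ∩ S) ∧
      ∀ t ∈ Icc (0 : ℝ) 1, ∀ p, (t, j t p) ∈ S →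
        MDifferentiableAt 𝓘(ℝ, E) 𝓘(ℝ, ℝ) (h t) (j t p) ∧
        HasContactJet α (h t) (j t p) (velocity j t p) := by
  set B := (fun q : ℝ × L => (q.1, j q.1 q.2)) '' (Icc 0 1 ×ˢ univ)
  have hB : IsClosed B := (hj.isCompact_image isClosed_univ).isClosed
  by_cases hq : q ∈ B
  · obtain ⟨⟨t, p⟩, ⟨ht, -⟩, rfl⟩ := hq
    exact exists_local_contactJet hα hj ht (hfac t ht p)
  · exact ⟨Bᶜ, hB.isOpen_compl, hq, fun _ _ => 0, contMDiffOn_const,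
      fun t ht p hp => absurd ⟨(t, p), ⟨ht, mem_univ _⟩, rfl⟩ hp⟩

variable [SecondCountableTopology M]

/-- All three cases pass through this reduction: the local factor solves the jet problem near each
point of `ℝ × M`, and the solutions are averaged and cut off without changing the jets along `j`. -/
theorem exists_contactIsotopy_of_hasLocalFactor (hα : IsContactForm α)
    (hj : IsIsotopyOfEmbeddings E F j)
    (hfac : ∀ t ∈ Icc (0 : ℝ) 1, ∀ p, HasLocalFactor (F := F) α j t p) :
    ∃ ψ : ℝ → Diffeomorph 𝓘(ℝ, E) 𝓘(ℝ, E) M M ∞, IsCompactlySupportedContactIsotopy α ψ ∧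
      ∀ t ∈ Icc (0 : ℝ) 1, ∀ p, ψ t (j 0 p) = j t p := by
  have : ProperSpace E := FiniteDimensional.proper_real E
  have : LocallyCompactSpace M := ChartedSpace.locallyCompactSpace E M
  choose S hSo hqS h hsm hjet using exists_local_contactJet_of_mem hα hj hfac
  -- The partition lives on `ℝ × M`, since the local Hamiltonians are defined on space-time
  -- neighbourhoods.
  obtain ⟨ρ, hρ⟩ := SmoothPartitionOfUnity.exists_isSubordinate (𝓘(ℝ, ℝ).prod 𝓘(ℝ, E))
    (isClosed_univ (X := ℝ × M)) S hSo (fun q _ => mem_iUnion.2 ⟨q, hqS q⟩)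
  set Γ : Set M := Prod.snd '' ((fun q : ℝ × L => (q.1, j q.1 q.2)) '' (Icc 0 1 ×ˢ univ))
  have hΓ : IsCompact Γ := (hj.isCompact_image isClosed_univ).image continuous_snd
  -- Two nested compact sets: the cutoff is `1` on `K₁`, a neighbourhood of all the images, so it
  -- leaves 1-jets there unchanged; it is `0` off the interior of `K`.
  obtain ⟨K₁, hK₁, hΓK⟩ := exists_compact_superset hΓ
  obtain ⟨K, hK, hKK⟩ := exists_compact_superset hK₁
  obtain ⟨χ, hχs, -, hχ0, hχ1⟩ := exists_contMDiff_zero_iff_one_iff_of_isClosed (n := ⊤) 𝓘(ℝ, E)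
    (s := (interior K)ᶜ) (t := K₁) isOpen_interior.isClosed_compl hK₁.isClosed
    (disjoint_compl_left_iff_subset.2 hKK)
  let G : ℝ → M → ℝ := fun t x => ∑ᶠ i, ρ i (t, x) * h i t x
  have hG : ContMDiffOn (𝓘(ℝ, ℝ).prod 𝓘(ℝ, E)) 𝓘(ℝ, ℝ) ∞ (fun q : ℝ × M => G q.1 q.2)
      (Icc 0 1 ×ˢ univ) := by
    intro q hq
    refine contMDiffWithinAt_finsum (ρ.locallyFinite.subset fun i x hx => left_ne_zero_of_mul hx)
      fun i => ?_
    by_cases hi : q ∈ tsupport (ρ i)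
    · have hqS' := hρ i hi
      refine ((ρ i).contMDiff q).contMDiffWithinAt.mul ((hsm i q ⟨hq, hqS'⟩).mono_of_mem_nhdsWithin
        (inter_mem_nhdsWithin _ ((hSo i).mem_nhds hqS')))
    · refine (contMDiffWithinAt_const (c := (0 : ℝ))).congr_of_eventuallyEq ?_
        (by rw [image_eq_zero_of_notMem_tsupport hi, zero_mul])
      filter_upwards [mem_nhdsWithin_of_mem_nhds (notMem_tsupport_iff_eventuallyEq.1 hi)] with x hx
      rw [hx, Pi.zero_apply, zero_mul]
  let H : ℝ → M → ℝ := fun t x => χ x * G t x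
  have hH : IsSmoothHam (E := E) H :=
    ContMDiffOn.mul (hχs.comp contMDiff_snd).contMDiffOn hG
  have hjetG : ∀ t ∈ Icc (0 : ℝ) 1, ∀ p, HasContactJet α (G t) (j t p) (velocity j t p) := by
    intro t ht p
    have hcont : Continuous fun x : M => (t, x) := by fun_prop
    refine hasContactJet_finsum (ρ := fun i x => ρ i (t, x)) (h := fun i => h i t)
      (ρ.locallyFinite.preimage_continuous hcont) (fun z => ρ.sum_eq_one (mem_univ (t, z)))
      (fun i => ?_) (fun i hi => ?_) ?_
    · exact (((ρ i).contMDiff.comp (contMDiff_const.prodMk contMDiff_id)) (j t p)).mdifferentiableAt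
        (by simp)
    · exact hjet i t ht p (hρ i (tsupport_comp_subset_preimage (ρ i) hcont hi))
    · exact mdifferentiableAt_of_contMDiffOn (f := G) hG ht _
  have hjetH : ∀ t ∈ Icc (0 : ℝ) 1, ∀ p, HasContactJet α (H t) (j t p) (velocity j t p) := by
    intro t ht p
    refine (hjetG t ht p).congr ?_
    have hmem : j t p ∈ Γ := ⟨_, ⟨(t, p), ⟨ht, mem_univ _⟩, rfl⟩, rfl⟩
    filter_upwards [isOpen_interior.mem_nhds (hΓK hmem)] with x hx
    simp only [H, (hχ1 x).1 (interior_subset hx), one_mul]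
  refine exists_contactIsotopy_of_hamiltonian hα hH hK (fun t ht x hx => ?_)
    (fun p t ht => hj.hasVelocity p ht) (fun p t ht => (hjetH t ht p).1.symm)
    (fun p t ht => (hjetH t ht p).2)
  have : χ x = 0 := (hχ0 x).1 fun hx' => hx (interior_subset hx')
  simp only [H, this, zero_mul]

end Globalization

/-! ### Integrals depending smoothly on parameters -/

section ParametricIntegral

universe u

lemma intervalIntegrable_of_continuousOn_prod {P G : Type*} [TopologicalSpace P]
    [NormedAddCommGroup G] {K : ℝ × P → G} {S : Set P} (hK : ContinuousOn K (Icc 0 1 ×ˢ S)) {p : P}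
    (hp : p ∈ S) : IntervalIntegrable (fun r => K (r, p)) MeasureTheory.volume 0 1 :=
  (hK.comp (f := fun r => (r, p)) (by fun_prop)
    fun r hr => ⟨by rwa [uIcc_of_le zero_le_one] at hr, hp⟩).intervalIntegrable

/-- The mean value inequality on a small ball intersected with the convex `S` bounds the error of
the integrand uniformly in `r`. Convexity replaces openness, since one parameter is a time in
`[0,1]`. -/
lemma hasFDerivWithinAt_integral {P G : Type*} [NormedAddCommGroup P] [NormedSpace ℝ P]
    [NormedAddCommGroup G] [NormedSpace ℝ G] [CompleteSpace G] {K : ℝ × P → G}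
    {K' : ℝ × P → P →L[ℝ] G} {S : Set P} (hS : Convex ℝ S)
    (hK : ContinuousOn K (Icc 0 1 ×ˢ S)) (hK' : ContinuousOn K' (Icc 0 1 ×ˢ S))
    (hd : ∀ r ∈ Icc (0 : ℝ) 1, ∀ p ∈ S, HasFDerivWithinAt (fun p => K (r, p)) (K' (r, p)) S p)
    {p₀ : P} (hp₀ : p₀ ∈ S) :
    HasFDerivWithinAt (fun p => ∫ r in (0 : ℝ)..1, K (r, p)) (∫ r in (0 : ℝ)..1, K' (r, p₀)) S
      p₀ := by
  have hintK := fun p hp => intervalIntegrable_of_continuousOn_prod hK (p := p) hp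
  have hintK' := intervalIntegrable_of_continuousOn_prod hK' hp₀
  rw [hasFDerivWithinAt_iff_isLittleO, Asymptotics.isLittleO_iff]
  intro ε hε
  have h1 := eventually_forall_Icc_norm_lt (P := S) (U := univ) (a := 0) (b := 1)
    (h := fun q => K' (q.1, q.2) - K' (q.1, p₀)) isOpen_univ
    ((hK'.comp (f := fun q : ℝ × S => (q.1, (q.2 : P))) (by fun_prop)
      fun q hq => ⟨hq.1, q.2.2⟩).sub (hK'.comp (f := fun q : ℝ × S => (q.1, p₀)) (by fun_prop)
      fun q hq => ⟨hq.1, hp₀⟩)) (u₀ := ⟨p₀, hp₀⟩) (mem_univ _) (by simp) hε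
  obtain ⟨δ, hδ, hball⟩ := Metric.eventually_nhds_iff_ball.1 h1
  filter_upwards [inter_mem_nhdsWithin S (ball_mem_nhds p₀ hδ)] with p hp
  have hbound : ∀ r ∈ Icc (0 : ℝ) 1,
      ‖K (r, p) - K (r, p₀) - K' (r, p₀) (p - p₀)‖ ≤ ε * ‖p - p₀‖ := fun r hr =>
    (hS.inter (convex_ball p₀ δ)).norm_image_sub_le_of_norm_hasFDerivWithin_le'
      (f := fun p => K (r, p)) (f' := fun p => K' (r, p))
      (fun x hx => (hd r hr x hx.1).mono inter_subset_left)
      (fun x hx => (hball ⟨x, hx.1⟩ hx.2 r hr).le) ⟨hp₀, mem_ball_self hδ⟩ hp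
  have happ : (∫ r in (0 : ℝ)..1, K' (r, p₀)) (p - p₀) = ∫ r in (0 : ℝ)..1, K' (r, p₀) (p - p₀) :=
    ContinuousLinearMap.intervalIntegral_apply hintK' _
  have hintK'' := intervalIntegrable_of_continuousOn_prod
    (hK'.clm_apply (continuousOn_const (c := p - p₀))) hp₀
  rw [happ, ← intervalIntegral.integral_sub (hintK p hp.1) (hintK p₀ hp₀),
    ← intervalIntegral.integral_sub ((hintK p hp.1).sub (hintK p₀ hp₀)) hintK'']
  refine (intervalIntegral.norm_integral_le_of_norm_le_const (C := ε * ‖p - p₀‖)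
    fun r hr => ?_).trans (by simp)
  rw [uIoc_of_le zero_le_one] at hr
  exact hbound r (Ioc_subset_Icc_self hr)

/-- The derivative is again an integral with smooth integrand, now valued in `P →L[ℝ] G`, so
induction on the order works once the target is allowed to vary. -/
lemma contDiffOn_nat_integral {P : Type u} [NormedAddCommGroup P] [NormedSpace ℝ P] {S : Set P}
    (hS : Convex ℝ S) (hSu : UniqueDiffOn ℝ S) (n : ℕ) : ∀ (G : Type u) [NormedAddCommGroup G]
    [NormedSpace ℝ G] [CompleteSpace G] {K : ℝ × P → G} (_ : ContDiffOn ℝ ∞ K (Icc 0 1 ×ˢ S)),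
    ContDiffOn ℝ n (fun p => ∫ r in (0 : ℝ)..1, K (r, p)) S := by
  have key : ∀ (G : Type u) [NormedAddCommGroup G] [NormedSpace ℝ G] [CompleteSpace G]
      {K : ℝ × P → G} (_ : ContDiffOn ℝ ∞ K (Icc 0 1 ×ˢ S)), ∃ K' : ℝ × P → P →L[ℝ] G,
      ContDiffOn ℝ ∞ K' (Icc 0 1 ×ˢ S) ∧ ∀ p ∈ S, HasFDerivWithinAt
        (fun p => ∫ r in (0 : ℝ)..1, K (r, p)) (∫ r in (0 : ℝ)..1, K' (r, p)) S p := by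
    intro G _ _ _ K hK
    have hK' : ContDiffOn ℝ ∞ (fun q => (fderivWithin ℝ K (Icc 0 1 ×ˢ S) q).comp
        (ContinuousLinearMap.inr ℝ ℝ P)) (Icc 0 1 ×ˢ S) :=
      (hK.fderivWithin ((uniqueDiffOn_Icc zero_lt_one).prod hSu) (by simp)).clm_comp
        contDiffOn_const
    refine ⟨_, hK', fun p hp => hasFDerivWithinAt_integral hS hK.continuousOn hK'.continuousOn
      (fun r hr p hp => ?_) hp⟩
    have h1 := ((hK.differentiableOn (by simp)) (r, p) ⟨hr, hp⟩).hasFDerivWithinAt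
    exact h1.comp p (hasFDerivAt_prodMk_right r p).hasFDerivWithinAt fun z hz => mem_prod.2 ⟨hr, hz⟩
  induction n with
  | zero =>
    intro G _ _ _ K hK
    obtain ⟨K', -, hd⟩ := key G hK
    exact contDiffOn_zero.2 fun p hp => (hd p hp).continuousWithinAt
  | succ n ih =>
    intro G _ _ _ K hK
    obtain ⟨K', hK', hd⟩ := key G hK
    push_cast
    rw [contDiffOn_succ_iff_hasFDerivWithinAt_of_uniqueDiffOn hSu]
    exact ⟨by simp, _, ih _ hK', hd⟩

/-- An integral over `[0,1]` depends smoothly on parameters in a convex set, not necessarily open. -/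
lemma contDiffOn_integral {P G : Type u} [NormedAddCommGroup P] [NormedSpace ℝ P]
    [NormedAddCommGroup G] [NormedSpace ℝ G] [CompleteSpace G] {S : Set P}
    (hS : Convex ℝ S) (hSu : UniqueDiffOn ℝ S) {K : ℝ × P → G}
    (hK : ContDiffOn ℝ ∞ K (Icc 0 1 ×ˢ S)) :
    ContDiffOn ℝ ∞ (fun p => ∫ r in (0 : ℝ)..1, K (r, p)) S :=
  contDiffOn_infty.2 fun n => contDiffOn_nat_integral hS hSu n G hK

end ParametricIntegral

/-! ### Hadamard's lemma -/

section Divisibility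

variable {F : Type} [NormedAddCommGroup F] [NormedSpace ℝ F]

/-- Hadamard's lemma, with a parameter: a smooth function that vanishes on the hyperplane `ℓ = 0`
is divisible by `ℓ`. -/
lemma exists_eq_mul_of_eq_zero {T : Set ℝ} (hT : Convex ℝ T) (hTu : UniqueDiffOn ℝ T) {R : ℝ}
    (hR : 0 < R) {z₀ v : F} {ℓ : F →L[ℝ] ℝ} (hv : ℓ v = 1) (hz₀ : ℓ z₀ = 0) {k : ℝ × F → ℝ}
    (hk : ContDiffOn ℝ ∞ k (T ×ˢ ball z₀ R))
    (hk0 : ∀ t ∈ T, ∀ z ∈ ball z₀ R, ℓ z = 0 → k (t, z) = 0) :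
    ∃ ρ > 0, ρ ≤ R ∧ ∃ n : ℝ × F → ℝ, ContDiffOn ℝ ∞ n (T ×ˢ ball z₀ ρ) ∧
      ∀ t ∈ T, ∀ z ∈ ball z₀ ρ, k (t, z) = ℓ z * n (t, z) := by
  -- The maps `σ (r, t, ·)` enlarge distances from `z₀` by at most this factor, so radius `R / B`
  -- keeps the segments inside the ball of radius `R`.
  set B := 1 + ‖ℓ‖ * ‖v‖
  have hB : 1 ≤ B := le_add_of_nonneg_right (by positivity)
  set ρ := R / B
  have hρ : 0 < ρ := by positivity
  have hρR : ρ ≤ R := div_le_self hR.le hB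
  -- The segment in direction `v` from the hyperplane `ℓ = 0` (at `r = 0`) to `z` (at `r = 1`), with
  -- `ℓ(σ) = r ℓ(z)`. Its velocity is `ℓ(z) v`, whence the factor `ℓ(z)` in the integral of the
  -- derivative of `k`.
  set σ : ℝ × (ℝ × F) → F := fun q => q.2.2 + ((q.1 - 1) * ℓ q.2.2) • v
  have hσ : ∀ r ∈ Icc (0 : ℝ) 1, ∀ t, ∀ z ∈ ball z₀ ρ, σ (r, t, z) ∈ ball z₀ R := by
    intro r hr t z hz
    rw [mem_ball_iff_norm] at hz ⊢
    have h1 : |ℓ z| ≤ ‖ℓ‖ * ‖z - z₀‖ := by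
      have := ℓ.le_opNorm (z - z₀)
      rwa [map_sub, hz₀, sub_zero, Real.norm_eq_abs] at this
    have h2 : |r - 1| ≤ 1 := abs_le.2 ⟨by linarith [hr.1], by linarith [hr.2]⟩
    calc ‖σ (r, t, z) - z₀‖ = ‖(z - z₀) + ((r - 1) * ℓ z) • v‖ := by simp only [σ]; congr 1; abel
      _ ≤ ‖z - z₀‖ + |r - 1| * |ℓ z| * ‖v‖ := by
        refine (norm_add_le _ _).trans_eq ?_
        rw [norm_smul, norm_mul, Real.norm_eq_abs, Real.norm_eq_abs]
      _ ≤ ‖z - z₀‖ + 1 * (‖ℓ‖ * ‖z - z₀‖) * ‖v‖ := by gcongr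
      _ = B * ‖z - z₀‖ := by simp only [B]; ring
      _ < B * ρ := by gcongr
      _ = R := by simp only [ρ]; field_simp
  have hσd : ContDiff ℝ ∞ σ := by fun_prop
  set D : ℝ × F → ℝ := fun p => fderiv ℝ (fun y => k (p.1, y)) p.2 v
  have hD : ContDiffOn ℝ ∞ D (T ×ˢ ball z₀ R) :=
    (contDiffOn_fderiv_snd hTu isOpen_ball hk).clm_apply contDiffOn_const
  have hint : ContDiffOn ℝ ∞ (fun q : ℝ × (ℝ × F) => D (q.2.1, σ q))
      (Icc 0 1 ×ˢ (T ×ˢ ball z₀ ρ)) :=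
    hD.comp (f := fun q : ℝ × (ℝ × F) => (q.2.1, σ q))
      ((contDiff_fst.comp contDiff_snd).prodMk hσd).contDiffOn
      fun q hq => ⟨hq.2.1, hσ q.1 hq.1 _ _ hq.2.2⟩
  refine ⟨ρ, hρ, hρR, fun p => ∫ r in (0 : ℝ)..1, D (p.1, σ (r, p)),
    contDiffOn_integral (hT.prod (convex_ball _ _)) (hTu.prod isOpen_ball.uniqueDiffOn) hint, ?_⟩
  intro t ht z hz
  have hline : ∀ r ∈ uIcc (0 : ℝ) 1,
      HasDerivAt (fun r => k (t, σ (r, t, z))) (ℓ z * D (t, σ (r, t, z))) r := by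
    intro r hr
    rw [uIcc_of_le zero_le_one] at hr
    have h1 : HasDerivAt (fun r => σ (r, t, z)) (ℓ z • v) r := by
      exact (((((hasDerivAt_id r).sub_const 1).mul_const (ℓ z)).smul_const v).const_add
        z).congr_deriv (by simp)
    have h2 : HasFDerivAt (fun y => k (t, y)) (fderiv ℝ (fun y => k (t, y)) (σ (r, t, z)))
        (σ (r, t, z)) :=
      (hasFDerivAt_snd isOpen_ball hk ht (hσ r hr t z hz)).differentiableAt.hasFDerivAt
    exact (HasFDerivAt.comp_hasDerivAt (l := fun y => k (t, y)) r h2 h1).congr_deriv (by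
      simp [D])
  have hci := intervalIntegrable_of_continuousOn_prod
    ((continuousOn_const (c := ℓ z)).mul hint.continuousOn) (p := (t, z)) ⟨ht, hz⟩
  have hfund := intervalIntegral.integral_eq_sub_of_hasDerivAt hline hci
  have e1 : σ (1, t, z) = z := by simp [σ]
  have e0 : k (t, σ (0, t, z)) = 0 := by
    refine hk0 t ht _ (hσ 0 (by simp) t z hz) ?_
    simp [σ, hv]
  rw [intervalIntegral.integral_const_mul, e1, e0, sub_zero] at hfund
  exact hfund.symm

end Divisibility

/-! ### The logarithmic time derivative of a family of forms with fixed kernel -/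

section Factor

lemma exists_ball_of_eventually_nhdsWithin {G : Type*} [NormedAddCommGroup G]
    {T : Set ℝ} {U : Set G} {t₀ : ℝ} {u₀ : G} (hU : U ∈ 𝓝 u₀) {p : ℝ × G → Prop}
    (hp : ∀ᶠ q in 𝓝[T ×ˢ U] (t₀, u₀), p q) :
    ∃ ε > 0, ball u₀ ε ⊆ U ∧ ∀ t ∈ T, t ∈ ball t₀ ε → ∀ u ∈ ball u₀ ε, p (t, u) := by
  obtain ⟨ε, hε, h⟩ := Metric.mem_nhdsWithin_iff.1 hp
  obtain ⟨δ, hδ, h'⟩ := Metric.mem_nhds_iff.1 hU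
  have hmin : 0 < min ε δ := lt_min hε hδ
  refine ⟨min ε δ, hmin, (ball_subset_ball (min_le_right _ _)).trans h', fun t ht htb u hu => ?_⟩
  have hu' := (ball_subset_ball (min_le_right _ _)).trans h' hu
  refine h ⟨?_, ht, hu'⟩
  rw [← ball_prod_same]
  exact ⟨ball_subset_ball (min_le_left _ _) htb, ball_subset_ball (min_le_left _ _) hu⟩

section General

variable {F : Type*} [NormedAddCommGroup F] [NormedSpace ℝ F]

/-- Near `(t₀, u₀)`, the family of 1-forms `b` satisfies `∂ₜ b = c b` with a smooth function
`c`. -/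
def HasFactor (b : ℝ × F → F →L[ℝ] ℝ) (t₀ : ℝ) (u₀ : F) : Prop :=
  ∃ O, IsOpen O ∧ t₀ ∈ O ∧ ∃ U, IsOpen U ∧ u₀ ∈ U ∧ ∃ c : ℝ × F → ℝ,
    ContDiffOn ℝ ∞ c ((Icc 0 1 ∩ O) ×ˢ U) ∧ ∀ t ∈ Icc 0 1 ∩ O, ∀ u ∈ U, ∀ w,
      derivWithin (fun t => b (t, u) w) (Icc 0 1) t = c (t, u) * b (t, u) w

/-- The kernels of the 1-forms `b (t, u)` do not depend on `t`. -/
def HasConstKer (b : ℝ × F → F →L[ℝ] ℝ) (O : Set ℝ) (U : Set F) : Prop :=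
  ∀ u ∈ U, ∀ t ∈ Icc 0 1 ∩ O, ∀ s ∈ Icc 0 1 ∩ O, ∀ w, b (t, u) w = 0 → b (s, u) w = 0

variable {b : ℝ × F → F →L[ℝ] ℝ} {O : Set ℝ} {U : Set F} {t₀ : ℝ} {u₀ : F}

/-- With `r` the ratio of the two values at time `t`, the vector `w' - r w` lies in the kernel at
one time and hence at all times. The ratio is therefore constant, and `b w' = r b w` may be
differentiated. -/
lemma HasConstKer.derivWithin_mul (hK : HasConstKer b O U) (hO : IsOpen O)
    (hb : ContDiffOn ℝ ∞ b ((Icc 0 1 ∩ O) ×ˢ U)) {t : ℝ} (ht : t ∈ Icc 0 1 ∩ O) {u : F}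
    (hu : u ∈ U) {w : F} (hw : b (t, u) w ≠ 0) (w' : F) :
    derivWithin (fun t => b (t, u) w') (Icc 0 1) t * b (t, u) w =
      derivWithin (fun t => b (t, u) w) (Icc 0 1) t * b (t, u) w' := by
  have hd : ∀ w, HasDerivWithinAt (fun t => b (t, u) w)
      (derivWithin (fun t => b (t, u) w) (Icc 0 1) t) (Icc 0 1 ∩ O) t := fun w => by
    rw [← derivWithin_inter (hO.mem_nhds ht.2)]
    exact (hasDerivWithinAt_fst (hb.clm_apply (contDiffOn_const (c := w))) ht
      hu).differentiableWithinAt.hasDerivWithinAt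
  set r := b (t, u) w' / b (t, u) w
  have hr : ∀ s ∈ Icc 0 1 ∩ O, b (s, u) w' = r * b (s, u) w := by
    intro s hs
    have h := hK u hu t ht s hs (w' - r • w) (by simp [r, hw])
    rw [map_sub, map_smul, smul_eq_mul] at h
    linarith
  have h1 := (uniqueDiffOn_Icc_inter hO t ht).eq_deriv _ (hd w')
    (((hd w).const_mul r).congr hr (hr t ht))
  rw [h1, hr t ht]
  ring

/-- Near a nonzero value the factor is the quotient `∂ₜ(b w) / b w`; by constancy of the kernel it
serves for every other vector. -/
lemma HasConstKer.hasFactor_of_apply_ne_zero (hK : HasConstKer b O U) (hO : IsOpen O)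
    (hU : IsOpen U) (hb : ContDiffOn ℝ ∞ b ((Icc 0 1 ∩ O) ×ˢ U)) (ht₀ : t₀ ∈ Icc 0 1 ∩ O)
    (hu₀ : u₀ ∈ U) {w : F} (hw : b (t₀, u₀) w ≠ 0) : HasFactor b t₀ u₀ := by
  have hbw : ContDiffOn ℝ ∞ (fun q => b q w) ((Icc 0 1 ∩ O) ×ˢ U) :=
    hb.clm_apply contDiffOn_const
  obtain ⟨ε, hε, hεU, hne⟩ := exists_ball_of_eventually_nhdsWithin (hU.mem_nhds hu₀)
    ((hbw.continuousOn (t₀, u₀) ⟨ht₀, hu₀⟩).eventually_ne hw)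
  have hsub : (Icc 0 1 ∩ (O ∩ ball t₀ ε)) ×ˢ ball u₀ ε ⊆ (Icc 0 1 ∩ O) ×ˢ U :=
    prod_mono (inter_subset_inter_right _ inter_subset_left) hεU
  refine ⟨O ∩ ball t₀ ε, hO.inter isOpen_ball, ⟨ht₀.2, mem_ball_self hε⟩, ball u₀ ε, isOpen_ball,
    mem_ball_self hε, fun q => derivWithin (fun t => b (t, q.2) w) (Icc 0 1 ∩ O) q.1 / b q w,
    ((contDiffOn_derivWithin_fst (uniqueDiffOn_Icc_inter hO) hU hbw).mono hsub).div
      (hbw.mono hsub) fun q hq => hne q.1 ⟨hq.1.1, hq.1.2.1⟩ hq.1.2.2 q.2 hq.2,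
    fun t ht u hu w' => ?_⟩
  have h1 := hne t ⟨ht.1, ht.2.1⟩ ht.2.2 u hu
  have h2 := hK.derivWithin_mul hO hb ⟨ht.1, ht.2.1⟩ (hεU hu) h1 w'
  simp only [derivWithin_inter (hO.mem_nhds ht.2.1)]
  field_simp
  exact h2

end General

variable {F : Type} [NormedAddCommGroup F] [NormedSpace ℝ F] [FiniteDimensional ℝ F]
  {b : ℝ × F → F →L[ℝ] ℝ} {O : Set ℝ} {U : Set F} {t₀ : ℝ} {u₀ : F}

/-- A family of smooth functions with a constant zero set is the product of one of them, which is
assumed to have no critical point, with a family of functions without zeros. -/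
lemma exists_eq_mul_of_zero_set {g : ℝ × F → ℝ} (hO : IsOpen O) (hU : IsOpen U)
    (hg : ContDiffOn ℝ ∞ g ((Icc 0 1 ∩ O) ×ˢ U))
    (hK : ∀ u ∈ U, ∀ t ∈ Icc 0 1 ∩ O, g (t₀, u) = 0 → g (t, u) = 0)
    (ht₀ : t₀ ∈ Icc 0 1 ∩ O) (hu₀ : u₀ ∈ U) (h0 : g (t₀, u₀) = 0) {v : F}
    (hv : fderiv ℝ (fun u => g (t₀, u)) u₀ v = 1) :
    ∃ O', IsOpen O' ∧ t₀ ∈ O' ∧ O' ⊆ O ∧ ∃ U', IsOpen U' ∧ u₀ ∈ U' ∧ U' ⊆ U ∧ ∃ N : ℝ × F → ℝ,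
      ContDiffOn ℝ ∞ N ((Icc 0 1 ∩ O') ×ˢ U') ∧
      (∀ t ∈ Icc 0 1 ∩ O', ∀ u ∈ U', N (t, u) ≠ 0 ∧ g (t, u) = g (t₀, u) * N (t, u)) ∧
      ∀ u ∈ U', fderiv ℝ (fun u => g (t₀, u)) u v ≠ 0 := by
  have : CompleteSpace F := FiniteDimensional.complete ℝ F
  set g₀ : F → ℝ := fun u => g (t₀, u)
  have hg₀ : ContDiffOn ℝ ∞ g₀ U :=
    hg.comp (contDiff_prodMk_right t₀).contDiffOn fun u hu => ⟨ht₀, hu⟩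
  have hg₀d : ContDiffOn ℝ ∞ (fderiv ℝ g₀) U := hg₀.fderiv_of_isOpen hU (by simp)
  set ℓ := fderiv ℝ g₀ u₀
  -- A straightening of `g₀`: since `ℓ v = 1` one has `ℓ ∘ Θ = g₀`, and `Θ` has the identity as
  -- derivative at `u₀`. In the new coordinate the zero set of `g₀` is the hyperplane of Hadamard's
  -- lemma.
  set Θ : F → F := fun u => u + (g₀ u - ℓ u) • v
  have hΘ : ContDiffOn ℝ ∞ Θ U :=
    contDiffOn_id.add ((hg₀.sub ℓ.contDiff.contDiffOn).smul contDiffOn_const)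
  have hΘℓ : ∀ u, ℓ (Θ u) = g₀ u := fun u => by simp [Θ, hv]
  have hΘu₀ : HasFDerivAt Θ (ContinuousLinearMap.id ℝ F) u₀ := by
    have h1 : HasFDerivAt g₀ ℓ u₀ :=
      ((hg₀.contDiffAt (hU.mem_nhds hu₀)).differentiableAt (by simp)).hasFDerivAt
    refine ((hasFDerivAt_id u₀).add ((h1.sub ℓ.hasFDerivAt).smul_const v)).congr_fderiv ?_
    ext w
    simp
  have hat : ∀ u ∈ U, ContDiffAt ℝ ∞ Θ u := fun u hu => hΘ.contDiffAt (hU.mem_nhds hu)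
  set e := (hat u₀ hu₀).toOpenPartialHomeomorph Θ
    (f' := ContinuousLinearEquiv.refl ℝ F) hΘu₀ (by simp)
  have hΘd : ∀ᶠ u in 𝓝 u₀, ‖fderiv ℝ Θ u - ContinuousLinearMap.id ℝ F‖ < 1 / 2 := by
    have h1 := ((hΘ.fderiv_of_isOpen hU (m := ∞) (by simp)).continuousOn.continuousAt
      (hU.mem_nhds hu₀)).sub (continuousAt_const (y := ContinuousLinearMap.id ℝ F))
    refine h1.norm.eventually (gt_mem_nhds ?_)
    simp only [Pi.sub_apply, hΘu₀.fderiv, sub_self, norm_zero]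
    norm_num
  have hgd : ∀ᶠ u in 𝓝 u₀, fderiv ℝ g₀ u v ≠ 0 :=
    ((hg₀d.clm_apply (contDiffOn_const (c := v))).continuousOn.continuousAt
      (hU.mem_nhds hu₀)).eventually_ne (hv.trans_ne one_ne_zero)
  obtain ⟨V, hVs, hV, huV⟩ :=
    _root_.eventually_nhds_iff.1 ((hU.eventually_mem hu₀).and (hΘd.and hgd))
  have hVU : V ⊆ U := fun u hu => (hVs u hu).1
  have heu₀ : u₀ ∈ e.source := (hat u₀ hu₀).mem_toOpenPartialHomeomorph_source
    (f' := ContinuousLinearEquiv.refl ℝ F) hΘu₀ (by simp)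
  have hW : IsOpen (e.target ∩ e.symm ⁻¹' V) := e.isOpen_inter_preimage_symm hV
  have hinv : ContDiffOn ℝ ∞ e.symm (e.target ∩ e.symm ⁻¹' V) := by
    rintro z ⟨hz, hzV⟩
    have h1 := hat _ (hVU hzV)
    obtain ⟨A, hA⟩ := isInvertible_of_norm_sub_id_le (hVs _ hzV).2.1.le
    exact (e.contDiffAt_symm hz (f₀' := A)
      (by rw [hA]; exact (h1.differentiableAt (by simp)).hasFDerivAt) h1).contDiffWithinAt
  have hz₀ : Θ u₀ ∈ e.target ∩ e.symm ⁻¹' V := by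
    refine ⟨e.map_source heu₀, ?_⟩
    rw [mem_preimage, show Θ u₀ = e u₀ from rfl, e.left_inv heu₀]
    exact huV
  obtain ⟨R, hR, hRW⟩ := Metric.isOpen_iff.1 hW _ hz₀
  obtain ⟨δ, hδ, hδO⟩ := Metric.isOpen_iff.1 hO _ ht₀.2
  have hT : Icc 0 1 ∩ ball t₀ δ ⊆ Icc 0 1 ∩ O := inter_subset_inter_right _ hδO
  obtain ⟨ρ, hρ, hρR, n, hn, hgn⟩ := exists_eq_mul_of_eq_zero
    (T := Icc 0 1 ∩ ball t₀ δ) ((convex_Icc 0 1).inter (convex_ball _ _))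
    (uniqueDiffOn_Icc_inter isOpen_ball) hR hv ((hΘℓ u₀).trans h0)
    (k := fun q => g (q.1, e.symm q.2))
    (hg.comp (f := fun q : ℝ × F => (q.1, e.symm q.2))
      (contDiffOn_fst.prodMk (hinv.comp contDiffOn_snd fun q hq => hRW hq.2))
      fun q hq => ⟨hT hq.1, hVU (hRW hq.2).2⟩)
    (fun t ht z hz hzℓ => by
      refine hK _ (hVU (hRW hz).2) t (hT ht) ?_
      change g₀ _ = 0
      rw [← hΘℓ, show Θ (e.symm z) = z from e.right_inv (hRW hz).1, hzℓ])
  obtain ⟨U₁, hU₁s, hU₁, huU₁⟩ := _root_.eventually_nhds_iff.1 ((hV.eventually_mem huV).and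
    ((e.open_source.eventually_mem heu₀).and
      (hΘu₀.continuousAt.eventually_mem (isOpen_ball.mem_nhds (mem_ball_self hρ)))))
  have hN : ContDiffOn ℝ ∞ (fun q : ℝ × F => n (q.1, Θ q.2)) ((Icc 0 1 ∩ ball t₀ δ) ×ˢ U₁) :=
    hn.comp (f := fun q : ℝ × F => (q.1, Θ q.2)) (contDiffOn_fst.prodMk
      (hΘ.comp contDiffOn_snd fun q hq => hVU (hU₁s _ hq.2).1)) fun q hq => ⟨hq.1, (hU₁s _ hq.2).2.2⟩
  have hgN : ∀ t ∈ Icc 0 1 ∩ ball t₀ δ, ∀ u ∈ U₁, g (t, u) = g (t₀, u) * n (t, Θ u) := by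
    intro t ht u hu
    have h1 := hgn t ht _ (hU₁s _ hu).2.2
    rw [hΘℓ] at h1
    simpa only [show e.symm (Θ u) = u from e.left_inv (hU₁s _ hu).2.1] using h1
  have ht₀' : t₀ ∈ Icc 0 1 ∩ ball t₀ δ := ⟨ht₀.1, mem_ball_self hδ⟩
  -- The derivative of `g₀ = g₀ N` at the zero `u₀` in direction `v` would read `1 = 0`.
  have hN₀ : n (t₀, Θ u₀) ≠ 0 := by
    intro hcon
    have h1 : g₀ =ᶠ[𝓝 u₀] fun u => g₀ u * n (t₀, Θ u) := by
      filter_upwards [hU₁.mem_nhds huU₁] with u hu using hgN t₀ ht₀' u hu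
    have h2 := (hasFDerivAt_snd hU₁ hN ht₀' huU₁).differentiableAt.hasFDerivAt
    have h3 : HasFDerivAt g₀ ℓ u₀ :=
      ((hg₀.contDiffAt (hU.mem_nhds hu₀)).differentiableAt (by simp)).hasFDerivAt
    have h4 := congrArg (fun L : F →L[ℝ] ℝ => L v) (h1.fderiv_eq.trans (h3.mul h2).fderiv)
    simp only [hcon, show g₀ u₀ = 0 from h0, zero_smul, add_zero] at h4
    rw [hv] at h4
    exact one_ne_zero h4
  obtain ⟨ε, hε, hεU, hne⟩ := exists_ball_of_eventually_nhdsWithin (hU₁.mem_nhds huU₁)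
    ((hN.continuousOn (t₀, u₀) ⟨ht₀', huU₁⟩).eventually_ne hN₀)
  refine ⟨ball t₀ δ ∩ ball t₀ ε, isOpen_ball.inter isOpen_ball, ⟨mem_ball_self hδ, mem_ball_self hε⟩,
    inter_subset_left.trans hδO, ball u₀ ε, isOpen_ball, mem_ball_self hε,
    fun u hu => hVU (hU₁s _ (hεU hu)).1, _,
    hN.mono (prod_mono (inter_subset_inter_right _ inter_subset_left) hεU),
    fun t ht u hu => ⟨hne t ⟨ht.1, ht.2.1⟩ ht.2.2 u hu, hgN t ⟨ht.1, ht.2.1⟩ u (hεU hu)⟩,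
    fun u hu => (hVs _ (hU₁s _ (hεU hu)).1).2.2⟩

/-- Some coefficient `b w` has nonzero differential at the zero. Writing it as its value at `t₀`
times a nonvanishing `N` gives the candidate `c = ∂ₜN / N`. For other vectors the identity holds
where `b w ≠ 0`. That set is dense because `b (t₀, ·) w` has no critical points nearby, and
continuity does the rest. -/
lemma HasConstKer.hasFactor_of_fderiv_ne_zero (hK : HasConstKer b O U) (hO : IsOpen O)
    (hU : IsOpen U) (hb : ContDiffOn ℝ ∞ b ((Icc 0 1 ∩ O) ×ˢ U)) (ht₀ : t₀ ∈ Icc 0 1 ∩ O)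
    (hu₀ : u₀ ∈ U) (h0 : b (t₀, u₀) = 0) (hd : fderiv ℝ (fun u => b (t₀, u)) u₀ ≠ 0) :
    HasFactor b t₀ u₀ := by
  obtain ⟨v', w, hvw⟩ : ∃ v w, fderiv ℝ (fun u => b (t₀, u)) u₀ v w ≠ 0 := by
    by_contra! hcon
    exact hd (by ext v w; exact hcon v w)
  have hbw : ∀ w, ContDiffOn ℝ ∞ (fun q => b q w) ((Icc 0 1 ∩ O) ×ˢ U) := fun w =>
    hb.clm_apply contDiffOn_const
  have hfd : fderiv ℝ (fun u => b (t₀, u) w) u₀ v' = fderiv ℝ (fun u => b (t₀, u)) u₀ v' w := by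
    have h1 := (hasFDerivAt_snd hU hb ht₀ hu₀).differentiableAt.hasFDerivAt.clm_apply
      (hasFDerivAt_const w u₀)
    rw [h1.fderiv]
    simp
  set v := (fderiv ℝ (fun u => b (t₀, u)) u₀ v' w)⁻¹ • v'
  obtain ⟨O', hO', htO', hOO', U', hU', huU', hUU', N, hN, hgN, hgd⟩ :=
    exists_eq_mul_of_zero_set hO hU (hbw w) (fun u hu t ht h => hK u hu t₀ ht₀ t ht w h) ht₀ hu₀
      (by simp [h0]) (v := v) (by rw [map_smul, hfd, smul_eq_mul, inv_mul_cancel₀ hvw])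
  have hT : Icc 0 1 ∩ O' ⊆ Icc 0 1 ∩ O := inter_subset_inter_right _ hOO'
  have hTu := uniqueDiffOn_Icc_inter hO'
  have hdN := contDiffOn_derivWithin_fst hTu hU' hN
  have hc := hdN.div hN fun q hq => (hgN q.1 hq.1 q.2 hq.2).1
  refine ⟨O', hO', htO', U', hU', huU', _, hc, fun t ht u hu w' => ?_⟩
  have hder : ∀ f : ℝ → ℝ, derivWithin f (Icc 0 1) t = derivWithin f (Icc 0 1 ∩ O') t := fun f =>
    (derivWithin_inter (hO'.mem_nhds ht.2)).symm
  have hfac : ∀ x ∈ U', derivWithin (fun t => b (t, x) w) (Icc 0 1) t =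
      derivWithin (fun t => N (t, x)) (Icc 0 1 ∩ O') t / N (t, x) * b (t, x) w := by
    intro x hx
    have h1 : HasDerivWithinAt (fun t => b (t, x) w)
        (b (t₀, x) w * derivWithin (fun t => N (t, x)) (Icc 0 1 ∩ O') t) (Icc 0 1 ∩ O') t :=
      ((hasDerivWithinAt_fst hN ht hx).differentiableWithinAt.hasDerivWithinAt.const_mul _).congr
        (fun s hs => (hgN s hs x hx).2) (hgN t ht x hx).2
    have h2 := (hgN t ht x hx).1
    rw [hder, h1.derivWithin (hTu t ht), (hgN t ht x hx).2]
    field_simp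
  -- The defect of the identity for `w'`. Were it nonzero at `u`, then `b (t₀, ·) w` would vanish on
  -- a neighbourhood of `u`, contrary to its nonzero differential.
  set Q : F → ℝ := fun x => derivWithin (fun t => b (t, x) w') (Icc 0 1 ∩ O') t -
    derivWithin (fun t => N (t, x)) (Icc 0 1 ∩ O') t / N (t, x) * b (t, x) w'
  have hQ : ContinuousOn Q U' := by
    have hbw' := (hbw w').mono (prod_mono hT hUU')
    exact (((contDiffOn_derivWithin_fst hTu hU' hbw').sub (hc.mul hbw')).continuousOn).comp
      (f := fun x => (t, x)) (by fun_prop) fun x hx => ⟨ht, hx⟩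
  rw [hder]
  refine sub_eq_zero.1 (?_ : Q u = 0)
  by_contra hcon
  refine hgd u hu ?_
  have h0 : (fun x => b (t₀, x) w) =ᶠ[𝓝 u] fun _ => 0 := by
    filter_upwards [hU'.mem_nhds hu, (hQ.continuousAt (hU'.mem_nhds hu)).eventually_ne hcon]
      with x hx hQx
    by_contra hx0
    have hne : b (t, x) w ≠ 0 := by
      rw [(hgN t ht x hx).2]
      exact mul_ne_zero hx0 (hgN t ht x hx).1
    have h1 := hK.derivWithin_mul hO hb (hT ht) (hUU' hx) hne w'
    rw [hfac x hx, hder] at h1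
    refine hQx (sub_eq_zero.2 (mul_right_cancel₀ hne (h1.trans ?_)))
    ring
  rw [h0.fderiv_eq]
  simp

end Factor

/-! ### The local factor for isotropic and contact embeddings -/

section LocalFactor

universe u
variable {E : Type*} [NormedAddCommGroup E] [NormedSpace ℝ E]
  {M : Type*} [TopologicalSpace M] [ChartedSpace E M]
  {F : Type u} [NormedAddCommGroup F] [NormedSpace ℝ F]
  {L : Type*} [TopologicalSpace L] [ChartedSpace F L]
  {α : OneForm E M} {j : ℝ → L → M} {t₀ : ℝ} {p₀ : L}

/-- The value at `p` of the pullback of `α` under `f`, as a linear form on the model space. -/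
noncomputable def pullVal (α : OneForm E M) (f : L → M) (p : L) : F →L[ℝ] ℝ :=
  (α.val (f p)).comp (mapD f p)

lemma pullForm_apply (α : OneForm E M) (j : ℝ → L → M) (p₀ : L) (t : ℝ) (u w : F) :
    pullForm α j p₀ (t, u) w =
      pullVal α (j t) ((extChartAt 𝓘(ℝ, F) p₀).symm u) (chartSymmD p₀ u w) := rfl

lemma mem_characteristicFoliation {f : L → M} {p : L} {v : F} :
    v ∈ (characteristicFoliation α f p : Submodule ℝ F) ↔ pullVal α f p v = 0 ∧
      ∀ w : F, pullVal α f p w = 0 → α.dval (f p) (mapD f p v) (mapD f p w) = 0 := Iff.rfl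

lemma hasConstKer_pullForm (h : ∀ t ∈ Icc (0 : ℝ) 1, ∀ s ∈ Icc (0 : ℝ) 1, ∀ p : L, ∀ v : F,
    pullVal α (j t) p v = 0 → pullVal α (j s) p v = 0) (O : Set ℝ) (U : Set F) :
    HasConstKer (pullForm α j p₀) O U := fun u _ t ht s hs w => by
  simpa only [pullForm_apply] using h t ht.1 s hs.1 _ _

/-- All pullbacks vanish, so the factor `0` will do. -/
lemma hasLocalFactor_of_isIsotropic
    (h : ∀ t ∈ Icc (0 : ℝ) 1, IsIsotropic (F := F) α (j t)) : HasLocalFactor (F := F) α j t₀ p₀ := by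
  have h0 : ∀ t ∈ Icc (0 : ℝ) 1, ∀ u w : F, pullForm α j p₀ (t, u) w = 0 :=
    fun t ht u w => h t ht _ (chartSymmD p₀ u w)
  refine ⟨univ, isOpen_univ, mem_univ _, univ, isOpen_univ, mem_univ _, 0, contDiffOn_const,
    fun t ht u _ w => ?_⟩
  rw [derivWithin_congr (fun s hs => h0 s hs u w) (h0 t ht.1 u w)]
  simp

variable [IsManifold 𝓘(ℝ, F) ∞ L]

lemma pullForm_self (α : OneForm E M) (j : ℝ → L → M) (p₀ : L) (t : ℝ) :
    pullForm α j p₀ (t, extChartAt 𝓘(ℝ, F) p₀ p₀) = pullVal α (j t) p₀ := by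
  ext w
  rw [pullForm_apply, chartSymmD_self, extChartAt_to_inv]

variable [IsManifold 𝓘(ℝ, E) ∞ M]

lemma exists_contDiffOn_pullForm (hα : α.IsSmooth)
    (hj : ContMDiffOn (𝓘(ℝ, ℝ).prod 𝓘(ℝ, F)) 𝓘(ℝ, E) ∞ (fun p : ℝ × L => j p.1 p.2)
      (Icc 0 1 ×ˢ univ)) (ht₀ : t₀ ∈ Icc (0 : ℝ) 1) (p₀ : L) :
    ∃ O, IsOpen O ∧ t₀ ∈ O ∧ ∃ U, IsOpen U ∧ extChartAt 𝓘(ℝ, F) p₀ p₀ ∈ U ∧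
      ContDiffOn ℝ ∞ (pullForm α j p₀) ((Icc 0 1 ∩ O) ×ˢ U) := by
  obtain ⟨O, hO, htO, U, hU, hu, hUl, hfs, hf⟩ := exists_nhds_inCharts hj ht₀ (p₀ := p₀)
    (x₀ := j t₀ p₀) (mem_extChartAt_source _)
  refine ⟨O, hO, htO, U, hU, hu, ContDiffOn.congr ?_ fun q hq =>
    pullForm_eq_inChart hj hq.1.1 (hUl hq.2) (hfs q.1 hq.1 q.2 hq.2)⟩
  exact ((hα.contDiffOn_inChart (j t₀ p₀)).comp hf fun q hq =>
    (extChartAt 𝓘(ℝ, E) (j t₀ p₀)).map_source (hfs q.1 hq.1 q.2 hq.2)).clm_comp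
    (contDiffOn_fderiv_snd (uniqueDiffOn_Icc_inter hO) hU hf)

lemma dForm_pullForm (hα : α.IsSmooth)
    (hj : ContMDiffOn (𝓘(ℝ, ℝ).prod 𝓘(ℝ, F)) 𝓘(ℝ, E) ∞ (fun p : ℝ × L => j p.1 p.2)
      (Icc 0 1 ×ˢ univ)) (ht₀ : t₀ ∈ Icc (0 : ℝ) 1) (p₀ : L) (v w : F) :
    dForm (fun u => pullForm α j p₀ (t₀, u)) (extChartAt 𝓘(ℝ, F) p₀ p₀) v w =
      α.dval (j t₀ p₀) (mapD (j t₀) p₀ v) (mapD (j t₀) p₀ w) := by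
  obtain ⟨O, hO, htO, U, hU, hu, hUl, hfs, hf⟩ := exists_nhds_inCharts hj ht₀ (p₀ := p₀)
    (x₀ := j t₀ p₀) (mem_extChartAt_source _)
  set τ : F → E := fun u =>
    extChartAt 𝓘(ℝ, E) (j t₀ p₀) (j t₀ ((extChartAt 𝓘(ℝ, F) p₀).symm u))
  have hτ : ContDiffOn ℝ ∞ τ U :=
    hf.comp (contDiff_prodMk_right t₀).contDiffOn fun u hu => ⟨⟨ht₀, htO⟩, hu⟩
  have hτ0 : τ (extChartAt 𝓘(ℝ, F) p₀ p₀) = extChartAt 𝓘(ℝ, E) (j t₀ p₀) (j t₀ p₀) := by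
    simp only [τ, extChartAt_to_inv]
  have hτ1 : ∀ v, fderiv ℝ τ (extChartAt 𝓘(ℝ, F) p₀ p₀) v = mapD (j t₀) p₀ v := by
    intro v
    rw [(hasFDerivAt_inCharts (hUl hu) (mdifferentiableAt_of_contMDiffOn hj ht₀ _)
      (hfs t₀ ⟨ht₀, htO⟩ _ hu)).fderiv]
    simp only [ContinuousLinearMap.comp_apply, chartSymmD_self]
    rw [extChartAt_to_inv, chartD_self]
  rw [dForm_pullback (hτ.contDiffAt (hU.mem_nhds hu)) (β := α.inChart (j t₀ p₀)) ?_ ?_,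
    α.dval_eq_dForm_self, hτ0, hτ1, hτ1]
  · rw [hτ0]
    exact ((hα.contDiffOn_inChart (j t₀ p₀)).contDiffAt
      (extChartAt_target_mem_nhds _)).differentiableAt (by simp)
  · filter_upwards [hU.mem_nhds hu] with u hu
    exact pullForm_eq_inChart hj ht₀ (hUl hu) (hfs t₀ ⟨ht₀, htO⟩ u hu)

lemma hasLocalFactor_of_pullVal_ne_zero (hα : α.IsSmooth)
    (hj : ContMDiffOn (𝓘(ℝ, ℝ).prod 𝓘(ℝ, F)) 𝓘(ℝ, E) ∞ (fun p : ℝ × L => j p.1 p.2)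
      (Icc 0 1 ×ˢ univ)) (ht₀ : t₀ ∈ Icc (0 : ℝ) 1)
    (h : ∀ t ∈ Icc (0 : ℝ) 1, ∀ s ∈ Icc (0 : ℝ) 1, ∀ p : L, ∀ v : F,
      pullVal α (j t) p v = 0 → pullVal α (j s) p v = 0)
    (h0 : pullVal (F := F) α (j t₀) p₀ ≠ 0) : HasLocalFactor (F := F) α j t₀ p₀ := by
  obtain ⟨O, hO, htO, U, hU, hu, hb⟩ := exists_contDiffOn_pullForm hα hj ht₀ p₀
  obtain ⟨w, hw⟩ := ContinuousLinearMap.exists_ne_zero h0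
  exact (hasConstKer_pullForm h O U).hasFactor_of_apply_ne_zero hO hU hb ⟨ht₀, htO⟩ hu (w := w)
    (by rwa [pullForm_self])

/-- As `Tj_t` is injective, the contact condition says that the pullback of `α` has the same kernel
as `α'`: a kernel independent of time and never the whole tangent space. -/
lemma hasLocalFactor_of_isContactMap {α' : OneForm F L} (hα' : IsContactForm α') (hα : α.IsSmooth)
    (hj : IsIsotopyOfEmbeddings E F j) (h : ∀ t ∈ Icc (0 : ℝ) 1, IsContactMap α' α (j t))
    (ht₀ : t₀ ∈ Icc (0 : ℝ) 1) : HasLocalFactor (F := F) α j t₀ p₀ := by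
  have key : ∀ t ∈ Icc (0 : ℝ) 1, ∀ p : L, ∀ v : F, pullVal α (j t) p v = 0 ↔ α'.val p v = 0 := by
    intro t ht p v
    constructor
    · intro hv
      obtain ⟨v', hv', heq⟩ := (h t ht p).le ⟨⟨v, rfl⟩, hv⟩
      obtain rfl : v' = v := hj.injective_mapD ht p heq
      exact hv'
    · intro hv
      exact ((h t ht p).ge ⟨v, hv, rfl⟩).2
  refine hasLocalFactor_of_pullVal_ne_zero hα hj.smooth ht₀
    (fun t ht s hs p v hv => (key s hs p v).2 ((key t ht p v).1 hv)) fun h0 => ?_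
  refine hα'.ne_zero p₀ (ContinuousLinearMap.ext fun v => (key t₀ ht₀ p₀ v).1 ?_)
  rw [h0]
  rfl

end LocalFactor

/-! ### Linear algebra of surfaces in contact 3-manifolds -/

section LinearAlgebra

variable {E : Type*} [NormedAddCommGroup E] [NormedSpace ℝ E]
  {F : Type*} [NormedAddCommGroup F] [NormedSpace ℝ F]

/-- The kernel of a nonzero form on a plane is a line, and an alternating form vanishes on a line.
At regular points the characteristic foliation is therefore the whole kernel of the pullback. -/
lemma IsContactPair.apply_eq_zero_of_finrank_eq_two [FiniteDimensional ℝ F] {a : E →L[ℝ] ℝ} {b : E →L[ℝ] E →L[ℝ] ℝ}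
    (h : IsContactPair a b) (hF : Module.finrank ℝ F = 2) {A : F →L[ℝ] E} (hA : a.comp A ≠ 0)
    {v w : F} (hv : a (A v) = 0) (hw : a (A w) = 0) : b (A v) (A w) = 0 := by
  have h1 := Module.Dual.finrank_ker_add_one_of_ne_zero (f := (a.comp A).toLinearMap)
    fun h => hA (ContinuousLinearMap.ext fun v => LinearMap.congr_fun h v)
  have h2 : Module.finrank ℝ (LinearMap.ker (a.comp A).toLinearMap) = 1 := by omega
  by_cases hv0 : v = 0
  · simp [hv0]
  obtain ⟨c, hc⟩ := exists_smul_eq_of_finrank_eq_one h2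
    (x := ⟨v, hv⟩) (fun h => hv0 (congrArg Subtype.val h)) ⟨w, hw⟩
  obtain rfl : c • v = w := congrArg Subtype.val hc
  have h3 := h.alt (A v) (A v)
  rw [map_smul, map_smul, show b (A v) (A v) = 0 by linarith, smul_zero]

/-- By dimension the image of `A` is all of `ker a`, where `b` is nondegenerate. At singular points
the characteristic foliation is therefore `0`. -/
lemma IsContactPair.eq_zero_of_finrank [FiniteDimensional ℝ E] {a : E →L[ℝ] ℝ}
    {b : E →L[ℝ] E →L[ℝ] ℝ} (h : IsContactPair a b)
    (hF : Module.finrank ℝ E = Module.finrank ℝ F + 1) {A : F →L[ℝ] E}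
    (hinj : Function.Injective A) (hA : a.comp A = 0) {v : F}
    (hv : ∀ w, b (A v) (A w) = 0) : v = 0 := by
  have h1 := Module.Dual.finrank_ker_add_one_of_ne_zero (f := a.toLinearMap)
    fun h' => h.ne_zero (ContinuousLinearMap.ext fun v => LinearMap.congr_fun h' v)
  have h2 : LinearMap.range A.toLinearMap = LinearMap.ker a.toLinearMap := by
    refine Submodule.eq_of_le_of_finrank_eq ?_ ?_
    · rintro _ ⟨x, rfl⟩
      exact congrArg (fun L : F →L[ℝ] ℝ => L x) hA
    · rw [LinearMap.finrank_range_of_inj hinj]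
      omega
  refine hinj ?_
  rw [map_zero]
  refine h.nondegenerate _ (congrArg (fun L : F →L[ℝ] ℝ => L v) hA) fun w hw => ?_
  obtain ⟨x, rfl⟩ : w ∈ LinearMap.range A.toLinearMap := h2 ▸ hw
  exact hv x

end LinearAlgebra

/-! ### The local factor for surfaces with fixed characteristic foliation -/

section Surfaces

variable {E : Type*} [NormedAddCommGroup E] [NormedSpace ℝ E]
  {M : Type*} [TopologicalSpace M] [ChartedSpace E M] [IsManifold 𝓘(ℝ, E) ∞ M]
  {F : Type} [NormedAddCommGroup F] [NormedSpace ℝ F] [FiniteDimensional ℝ F]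
  {L : Type*} [TopologicalSpace L] [ChartedSpace F L] [IsManifold 𝓘(ℝ, F) ∞ L]
  {α : OneForm E M} {j : ℝ → L → M} {t₀ : ℝ} {p₀ : L}

/-- At a zero of the pullback, its exterior derivative is the restriction of `dα`. If that is
nonzero, so is the derivative of the pulled-back form, which is what division requires; elsewhere a
quotient suffices. -/
lemma hasLocalFactor_of_injective (hα : IsContactForm α) (hj : IsIsotopyOfEmbeddings E F j)
    (ht₀ : t₀ ∈ Icc (0 : ℝ) 1)
    (h : ∀ t ∈ Icc (0 : ℝ) 1, ∀ s ∈ Icc (0 : ℝ) 1, ∀ p : L, ∀ v : F,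
      pullVal α (j t) p v = 0 → pullVal α (j s) p v = 0)
    (hd : pullVal (F := F) α (j t₀) p₀ = 0 →
      ∃ v w : F, α.dval (j t₀ p₀) (mapD (j t₀) p₀ v) (mapD (j t₀) p₀ w) ≠ 0) :
    HasLocalFactor (F := F) α j t₀ p₀ := by
  by_cases h0 : pullVal (F := F) α (j t₀) p₀ = 0
  · obtain ⟨O, hO, htO, U, hU, hu, hb⟩ := exists_contDiffOn_pullForm hα.smooth hj.smooth ht₀ p₀
    refine (hasConstKer_pullForm h O U).hasFactor_of_fderiv_ne_zero hO hU hb ⟨ht₀, htO⟩ hu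
      (by rwa [pullForm_self]) fun hcon => ?_
    obtain ⟨v, w, hvw⟩ := hd h0
    refine hvw ?_
    rw [← dForm_pullForm hα.smooth hj.smooth ht₀, dForm_apply, hcon]
    simp
  · exact hasLocalFactor_of_pullVal_ne_zero hα.smooth hj.smooth ht₀ h h0

/-- The foliation is a line equal to the kernel of the pullback at regular points and `0` at
singular ones, so fixing it fixes both the singular set and the kernels. At singular points `dα` is
nondegenerate on the tangent plane, in particular nonzero. -/
lemma hasLocalFactor_of_characteristicFoliation_eq [FiniteDimensional ℝ E] (hα : IsContactForm α)
    (hj : IsIsotopyOfEmbeddings E F j) (hF : Module.finrank ℝ F = 2)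
    (hE : Module.finrank ℝ E = 3) (ht₀ : t₀ ∈ Icc (0 : ℝ) 1)
    (h : ∀ t ∈ Icc (0 : ℝ) 1, ∀ p : L,
      characteristicFoliation (F := F) α (j t) p = characteristicFoliation (F := F) α (j 0) p) :
    HasLocalFactor (F := F) α j t₀ p₀ := by
  have hreg : ∀ t ∈ Icc (0 : ℝ) 1, ∀ p : L, pullVal (F := F) α (j t) p ≠ 0 → ∀ v : F,
      pullVal α (j t) p v = 0 → v ∈ (characteristicFoliation α (j 0) p : Submodule ℝ F) := by
    intro t ht p h0 v hv
    rw [← h t ht p]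
    exact mem_characteristicFoliation.2 ⟨hv, fun w hw =>
      (hα.isContactPair (j t p)).apply_eq_zero_of_finrank_eq_two hF h0 hv hw⟩
  have hsing : ∀ t ∈ Icc (0 : ℝ) 1, ∀ p : L, pullVal (F := F) α (j t) p = 0 → ∀ v : F,
      (∀ w : F, α.dval (j t p) (mapD (j t) p v) (mapD (j t) p w) = 0) → v = 0 :=
    fun t ht p h0 v hv => (hα.isContactPair (j t p)).eq_zero_of_finrank (by omega)
      (hj.injective_mapD ht p) h0 hv
  refine hasLocalFactor_of_injective hα hj ht₀ (fun t ht s hs p v hv => ?_) fun h0 => ?_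
  · by_cases h0 : pullVal (F := F) α (j t) p = 0
    -- A point singular at time `t` is singular at time `s`: otherwise the kernel at time `s` would
    -- contain a nonzero vector of the foliation, which at time `t` is zero.
    · suffices hs0 : pullVal (F := F) α (j s) p = 0 by rw [hs0]; rfl
      by_contra hs0
      have h1 := Module.Dual.finrank_ker_add_one_of_ne_zero
        (f := (pullVal (F := F) α (j s) p).toLinearMap)
        fun h' => hs0 (ContinuousLinearMap.ext fun v => LinearMap.congr_fun h' v)
      have : Nontrivial (LinearMap.ker (pullVal (F := F) α (j s) p).toLinearMap) :=
        Module.nontrivial_of_finrank_pos (R := ℝ) (by omega)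
      obtain ⟨⟨x, hx⟩, hx0⟩ := exists_ne
        (0 : LinearMap.ker (pullVal (F := F) α (j s) p).toLinearMap)
      refine hx0 (Subtype.ext (hsing t ht p h0 x fun w => ?_))
      have h2 := hreg s hs p hs0 x hx
      rw [← h t ht p] at h2
      exact (mem_characteristicFoliation.1 h2).2 w (by rw [h0]; rfl)
    · have h1 := hreg t ht p h0 v hv
      rw [← h s hs p] at h1
      exact (mem_characteristicFoliation.1 h1).1
  · by_contra! hcon
    have : Nontrivial F := Module.nontrivial_of_finrank_pos (R := ℝ) (by omega)
    obtain ⟨x, hx⟩ := exists_ne (0 : F)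
    exact hx (hsing t₀ ht₀ p₀ h0 x (hcon x))

end Surfaces

end ContactIsotopy

theorem mainTheorem9 (n : ℕ) (M : Type*) [TopologicalSpace M] [T2Space M]
    [SecondCountableTopology M] [ChartedSpace (EuclideanSpace ℝ (Fin (2 * n + 1))) M]
    [IsManifold (𝓡 (2 * n + 1)) ∞ M]
    (α : ContactIsotopy.OneForm (EuclideanSpace ℝ (Fin (2 * n + 1))) M)
    (hα : ContactIsotopy.IsContactForm α) :
    -- isotropic embeddings
    (∀ (k : ℕ) (L : Type*) [TopologicalSpace L] [T2Space L] [CompactSpace L]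
      [ChartedSpace (EuclideanSpace ℝ (Fin k)) L] [IsManifold (𝓡 k) ∞ L] (j : ℝ → L → M),
      ContactIsotopy.IsIsotopyOfEmbeddings (EuclideanSpace ℝ (Fin (2 * n + 1)))
        (EuclideanSpace ℝ (Fin k)) j →
      (∀ t ∈ Icc (0 : ℝ) 1, ContactIsotopy.IsIsotropic (F := EuclideanSpace ℝ (Fin k)) α (j t)) →
      ∃ ψ : ℝ → Diffeomorph (𝓡 (2 * n + 1)) (𝓡 (2 * n + 1)) M M ∞,
        ContactIsotopy.IsCompactlySupportedContactIsotopy α ψ ∧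
        ∀ t ∈ Icc (0 : ℝ) 1, ∀ p, ψ t (j 0 p) = j t p) ∧
    -- contact embeddings
    (∀ (m : ℕ) (M' : Type*) [TopologicalSpace M'] [T2Space M'] [CompactSpace M']
      [ChartedSpace (EuclideanSpace ℝ (Fin (2 * m + 1))) M'] [IsManifold (𝓡 (2 * m + 1)) ∞ M']
      (α' : ContactIsotopy.OneForm (EuclideanSpace ℝ (Fin (2 * m + 1))) M') (j : ℝ → M' → M),
      ContactIsotopy.IsContactForm α' →
      ContactIsotopy.IsIsotopyOfEmbeddings (EuclideanSpace ℝ (Fin (2 * n + 1)))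
        (EuclideanSpace ℝ (Fin (2 * m + 1))) j →
      (∀ t ∈ Icc (0 : ℝ) 1, ContactIsotopy.IsContactMap α' α (j t)) →
      ∃ ψ : ℝ → Diffeomorph (𝓡 (2 * n + 1)) (𝓡 (2 * n + 1)) M M ∞,
        ContactIsotopy.IsCompactlySupportedContactIsotopy α ψ ∧
        ∀ t ∈ Icc (0 : ℝ) 1, ∀ p, ψ t (j 0 p) = j t p) ∧
    -- surfaces in contact 3-manifolds with fixed characteristic foliation
    (n = 1 → ∀ (S : Type*) [TopologicalSpace S] [T2Space S] [CompactSpace S]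
      [ChartedSpace (EuclideanSpace ℝ (Fin 2)) S] [IsManifold (𝓡 2) ∞ S] (j : ℝ → S → M),
      ContactIsotopy.IsIsotopyOfEmbeddings (EuclideanSpace ℝ (Fin (2 * n + 1)))
        (EuclideanSpace ℝ (Fin 2)) j →
      (∀ t ∈ Icc (0 : ℝ) 1, ∀ p : S,
        ContactIsotopy.characteristicFoliation (F := EuclideanSpace ℝ (Fin 2)) α (j t) p =
          ContactIsotopy.characteristicFoliation (F := EuclideanSpace ℝ (Fin 2)) α (j 0) p) →
      ∃ ψ : ℝ → Diffeomorph (𝓡 (2 * n + 1)) (𝓡 (2 * n + 1)) M M ∞,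
        ContactIsotopy.IsCompactlySupportedContactIsotopy α ψ ∧
        ∀ t ∈ Icc (0 : ℝ) 1, ∀ p, ψ t (j 0 p) = j t p) := by
  refine ⟨fun k L _ _ _ _ _ j hj h => ?_, fun m M' _ _ _ _ _ α' j hα' hj h => ?_,
    fun hn S _ _ _ _ _ j hj h => ?_⟩
  · exact ContactIsotopy.exists_contactIsotopy_of_hasLocalFactor hα hj fun t _ p =>
      ContactIsotopy.hasLocalFactor_of_isIsotropic h
  · exact ContactIsotopy.exists_contactIsotopy_of_hasLocalFactor hα hj fun t ht p =>
      ContactIsotopy.hasLocalFactor_of_isContactMap hα' hα.smooth hj h ht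
  · exact ContactIsotopy.exists_contactIsotopy_of_hasLocalFactor hα hj fun t ht p =>
      ContactIsotopy.hasLocalFactor_of_characteristicFoliation_eq hα hj (by simp) (by simp [hn]) ht h
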